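/- Let $\bar X$ be a normal compact complex analytic space, let $D \subset \bar X$ be a divisor (the union of finitely many irreducible closed analytic subsets of codimension one, its irreducible components), let $X = \bar X - D$, and let $\mathcal{L}$ be a $\mathbb{Z}$-local system on $X$ whose stalks are free of finite rank $r$. Assume that, for every irreducible component $D_i$ of $D$, the monodromy of $\mathcal{L}$ around $D_i$ (that is, along a small loop around $D$ in a disk transverse to $D$ at a general point of $D_i$) has infinite order and that all its complex eigenvalues have modulus $1$. For every prime number $p$, let $X(p) \to X$ be the finite étale cover given by the total space of the local system of sets $\mathcal{I}som\left((\mathbb{Z}/p\mathbb{Z})^r_X, \mathcal{L} \otimes_{\mathbb{Z}} \mathbb{Z}/p\mathbb{Z}\right)$, and let $\pi_p : \bar X(p) \to \bar X$ be the normalization of $\bar X$ in the total ring of fractions of $X(p)$. Then, for all but finitely many prime numbers $p$, the map $\pi_p$ ramifies over every irreducible component of $D$ with an order divisible by $p$. That is: for every irreducible component $D_i$ of $D$ and every point $y \in \bar X(p)$ lying over a point of $D_i$ at which both $\bar X$ and $D$ are smooth, there is an integer $e \geq 1$ divisible by $p$ such that, locally at $y$, the pullback by $\pi_p$ of the ideal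 of functions vanishing on $D$ generates the $e$-th power of the ideal of functions vanishing on $\pi_p^{-1}(D)$. -/

import Mathlib

open Filter Topology TensorProduct

universe u v w

noncomputable section

/-! ### Spaces with a sheaf of complex valued functions, complex spaces -/

/-- A sheaf of rings of complex valued functions on a topological space, containing the constants.
`HolAt f x` means that `f` is defined and is a section of the sheaf on a neighbourhood of `x`
(the values of `f` away from `x` play no role). -/
class HolStructure (X : Type u) [TopologicalSpace X] where
  HolAt : (X → ℂ) → X → Prop
  congr : ∀ {f g : X → ℂ} {x : X}, HolAt f x → f =ᶠ[𝓝 x] g → HolAt g x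
  eventually : ∀ {f : X → ℂ} {x : X}, HolAt f x → ∀ᶠ y in 𝓝 x, HolAt f y
  const : ∀ (c : ℂ) (x : X), HolAt (fun _ => c) x
  add : ∀ {f g : X → ℂ} {x : X}, HolAt f x → HolAt g x → HolAt (f + g) x
  mul : ∀ {f g : X → ℂ} {x : X}, HolAt f x → HolAt g x → HolAt (f * g) x

open HolStructure (HolAt)

/-- The stalk of the structure sheaf at `x`, as a ring of germs of functions. -/
def holStalk {X : Type u} [TopologicalSpace X] [HolStructure X] (x : X) :
    Subring (Germ (𝓝 x) ℂ) where
  carrier := {a | ∃ f : X → ℂ, HolAt f x ∧ a = (f : Germ (𝓝 x) ℂ)}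
  mul_mem' := by
    rintro _ _ ⟨f, hf, rfl⟩ ⟨g, hg, rfl⟩
    exact ⟨f * g, HolStructure.mul hf hg, rfl⟩
  one_mem' := ⟨fun _ => 1, HolStructure.const 1 x, rfl⟩
  add_mem' := by
    rintro _ _ ⟨f, hf, rfl⟩ ⟨g, hg, rfl⟩
    exact ⟨f + g, HolStructure.add hf hg, rfl⟩
  zero_mem' := ⟨fun _ => 0, HolStructure.const 0 x, rfl⟩
  neg_mem' := by
    rintro _ ⟨f, hf, rfl⟩
    refine ⟨(fun _ => -1) * f, HolStructure.mul (HolStructure.const (-1) x) hf, ?_⟩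
    have : (fun _ => -1) * f = -f := by
      funext z
      simp
    rw [this]
    rfl

/-- A (reduced) complex analytic space: a Hausdorff space with a sheaf of functions which is locally
isomorphic to the common zero set `A` of finitely many holomorphic functions on an open subset `Ω`
of some `ℂⁿ`, equipped with the sheaf of functions on `A` which are locally restrictions of
holomorphic functions of the ambient space. -/
class IsComplexSpace (X : Type u) [TopologicalSpace X] [HolStructure X] : Prop where
  t2 : T2Space X
  exists_localModel : ∀ x : X, ∃ (U : Set X) (n : ℕ) (φ : X → (Fin n → ℂ)) (Ω : Set (Fin n → ℂ))
    (k : ℕ) (g : Fin k → (Fin n → ℂ) → ℂ),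
    IsOpen U ∧ x ∈ U ∧ IsOpen Ω ∧ (∀ i, AnalyticOnNhd ℂ (g i) Ω) ∧
    φ '' U = {z | z ∈ Ω ∧ ∀ i, g i z = 0} ∧
    IsEmbedding (U.domRestrict φ) ∧
    ∀ y ∈ U, ∀ f : X → ℂ,
      HolAt f y ↔ ∃ F : (Fin n → ℂ) → ℂ, AnalyticAt ℂ F (φ y) ∧ f =ᶠ[𝓝 y] F ∘ φ

/-- A complex space is normal if its local rings are integrally closed domains. -/
class IsNormalComplexSpace (X : Type u) [TopologicalSpace X] [HolStructure X] : Prop extends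
    IsComplexSpace X where
  isDomain : ∀ x : X, IsDomain (holStalk x)
  isIntegrallyClosed : ∀ x : X, IsIntegrallyClosed (holStalk x)

/-- Morphisms of spaces with sheaves of functions. -/
structure IsHolMap {Y : Type v} {X : Type u} [TopologicalSpace Y] [TopologicalSpace X]
    [HolStructure Y] [HolStructure X] (φ : Y → X) : Prop where
  continuous : Continuous φ
  comp : ∀ (y : Y) (f : X → ℂ), HolAt f (φ y) → HolAt (f ∘ φ) y

/-- Composition with a map, as a homomorphism of rings of germs. -/
def germComp {Y : Type v} {X : Type u} {l : Filter X} {l' : Filter Y} (φ : Y → X)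
    (hφ : Tendsto φ l' l) : Germ l ℂ →+* Germ l' ℂ where
  toFun a := a.compTendsto φ hφ
  map_one' := rfl
  map_mul' a b := by
    induction a, b using Germ.inductionOn₂
    rfl
  map_zero' := rfl
  map_add' a b := by
    induction a, b using Germ.inductionOn₂
    rfl

/-- The homomorphism of local rings induced by a morphism. -/
def holStalkMap {Y : Type v} {X : Type u} [TopologicalSpace Y] [TopologicalSpace X]
    [HolStructure Y] [HolStructure X] (φ : Y → X) (hφ : IsHolMap φ) (y : Y) :
    holStalk (φ y) →+* holStalk y :=
  ((germComp φ hφ.continuous.continuousAt).comp (holStalk (φ y)).subtype).codRestrict (holStalk y)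
    (by
      rintro ⟨_, f, hf, rfl⟩
      exact ⟨f ∘ φ, hφ.comp y f hf, rfl⟩)

/-- The ideal of germs of functions vanishing on a subset `Z`. -/
def vanishingIdealAt {X : Type u} [TopologicalSpace X] [HolStructure X] (Z : Set X) (x : X) :
    Ideal (holStalk x) where
  carrier := {a | ∃ f : X → ℂ, (a : Germ (𝓝 x) ℂ) = f ∧ ∀ᶠ z in 𝓝 x, z ∈ Z → f z = 0}
  add_mem' := by
    rintro a b ⟨f, hf, hf0⟩ ⟨g, hg, hg0⟩
    refine ⟨f + g, by rw [Subring.coe_add, hf, hg]; rfl, ?_⟩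
    filter_upwards [hf0, hg0] with z h1 h2 hz
    simp [h1 hz, h2 hz]
  zero_mem' := ⟨fun _ => 0, rfl, by simp⟩
  smul_mem' := by
    rintro ⟨_, c, hc, rfl⟩ b ⟨g, hg, hg0⟩
    refine ⟨c * g, by rw [smul_eq_mul, Subring.coe_mul, hg]; rfl, ?_⟩
    filter_upwards [hg0] with z h2 hz
    simp [h2 hz]

/-- The inverse image of the structure sheaf under a continuous map `φ`, as a sheaf of functions:
functions that locally are compositions of `φ` with holomorphic functions. This is used for open
subspaces and for étale (local homeomorphism) maps. -/
@[reducible] def HolStructure.induced {Y : Type v} {X : Type u} [TopologicalSpace Y]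
    [TopologicalSpace X] [HolStructure X] (φ : Y → X) (hφ : Continuous φ) : HolStructure Y where
  HolAt f y := ∃ g : X → ℂ, HolAt g (φ y) ∧ f =ᶠ[𝓝 y] g ∘ φ
  congr := by
    rintro f f' y ⟨g, hg, h⟩ h'
    exact ⟨g, hg, h'.symm.trans h⟩
  eventually := by
    rintro f y ⟨g, hg, h⟩
    filter_upwards [hφ.continuousAt.eventually (HolStructure.eventually hg),
      eventually_eventually_nhds.2 h] with z h1 h2
    exact ⟨g, h1, h2⟩
  const c y := ⟨fun _ => c, HolStructure.const c _, EventuallyEq.rfl⟩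
  add := by
    rintro f f' y ⟨g, hg, h⟩ ⟨g', hg', h'⟩
    exact ⟨g + g', HolStructure.add hg hg', h.add h'⟩
  mul := by
    rintro f f' y ⟨g, hg, h⟩ ⟨g', hg', h'⟩
    exact ⟨g * g', HolStructure.mul hg hg', h.mul h'⟩

/-! ### Divisors and meridians -/

/-- Closed analytic subsets: locally the common zeros of finitely many holomorphic functions. -/
def IsAnalyticSubset {X : Type u} [TopologicalSpace X] [HolStructure X] (Z : Set X) : Prop :=
  ∀ x : X, ∃ (k : ℕ) (g : Fin k → X → ℂ), (∀ i, HolAt (g i) x) ∧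
    ∀ᶠ y in 𝓝 x, (y ∈ Z ↔ ∀ i, g i y = 0)

/-- Holomorphic coordinates of the ambient space at a point `x`, in which the subset `D` is the
coordinate hyperplane `z₀ = 0`. The coordinates are scaled in such a way that the closed unit disk
of the `z₀`-axis, which is a disk transverse to `D` at `x`, lies in the image of the chart. -/
structure AdaptedChart {X : Type u} [TopologicalSpace X] [HolStructure X] (D : Set X) (x : X) where
  dim : ℕ
  chart : OpenPartialHomeomorph X (Fin (dim + 1) → ℂ)
  mem_source : x ∈ chart.source
  map_point : chart x = 0
  holAt_iff : ∀ y ∈ chart.source, ∀ f : X → ℂ,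
    HolAt f y ↔ AnalyticAt ℂ (f ∘ chart.symm) (chart y)
  mem_iff : ∀ y ∈ chart.source, (y ∈ D ↔ chart y 0 = 0)
  disk : ∀ z : ℂ, ‖z‖ ≤ 1 → Pi.single 0 z ∈ chart.target

/-- The points of `D` at which both the ambient space is smooth and `D` is a smooth hypersurface. -/
def smoothPoints {X : Type u} [TopologicalSpace X] [HolStructure X] (D : Set X) : Set X :=
  {x | x ∈ D ∧ Nonempty (AdaptedChart D x)}

/-- Irreducible analytic subsets of codimension one of a normal complex space.
As the singular locus of a normal space has codimension at least two, a closed analytic subset `Z`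
has pure codimension one if and only if the points at which both `X` and `Z` are smooth and `Z` is
a hypersurface are dense in `Z`; it is then irreducible if and only if the set of these
points (the complement of a proper analytic subset in the regular locus) is connected. -/
structure IsPrimeDivisor {X : Type u} [TopologicalSpace X] [HolStructure X] (Z : Set X) : Prop where
  isAnalyticSubset : IsAnalyticSubset Z
  dense : Z ⊆ closure (smoothPoints Z)
  isConnected : IsConnected (smoothPoints Z)

namespace AdaptedChart

variable {X : Type u} [TopologicalSpace X] [HolStructure X] {D : Set X} {x : X}

/-- The point of coordinates `(z, 0, …, 0)`, for `0 < ‖z‖ ≤ 1`, in the complement of `D`. -/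
def axisPoint (e : AdaptedChart D x) (z : ℂ) (hz : ‖z‖ ≤ 1) (hz0 : z ≠ 0) : {y // y ∉ D} :=
  ⟨e.chart.symm (Pi.single 0 z), fun h => hz0 (by
    have h1 := (e.mem_iff _ (e.chart.map_target (e.disk z hz))).1 h
    rw [e.chart.right_inv (e.disk z hz)] at h1
    simpa using h1)⟩

/-- The base point of the meridian. -/
def basePoint (e : AdaptedChart D x) : {y // y ∉ D} := e.axisPoint 1 (by simp) one_ne_zero

/-- The meridian: the boundary `t ↦ (exp (2 π i t), 0, …, 0)` of the unit disk of the `z₀`-axis, a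
loop around `D` in the complement of `D`. -/
def meridian (e : AdaptedChart D x) : Path e.basePoint e.basePoint where
  toFun t := e.axisPoint (Complex.exp (2 * Real.pi * Complex.I * (t : ℝ)))
    (by
      have : (2 * Real.pi * Complex.I * (t : ℝ) : ℂ) = ((2 * Real.pi * t : ℝ) : ℂ) * Complex.I := by
        push_cast
        ring
      rw [this, Complex.norm_exp_ofReal_mul_I])
    (Complex.exp_ne_zero _)
  continuous_toFun := by
    refine Continuous.subtype_mk ?_ _
    refine e.chart.continuousOn_symm.comp_continuous ?_ ?_
    · exact (continuous_single 0).comp (by fun_prop)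
    · intro t
      refine e.disk _ ?_
      have : (2 * Real.pi * Complex.I * (t : ℝ) : ℂ) = ((2 * Real.pi * t : ℝ) : ℂ) * Complex.I := by
        push_cast
        ring
      rw [this, Complex.norm_exp_ofReal_mul_I]
  source' := by
    simp [basePoint]
  target' := by
    simp [basePoint, Complex.exp_two_pi_mul_I]

end AdaptedChart

/-! ### Local systems and level covers -/

/-- A local system of free `ℤ`-modules of rank `r`: a locally constant sheaf, given by its stalks
and its sections. `IsFlatAt s x` means that `s` is a section of the sheaf near `x`. Near every
point, the sheaf is isomorphic to the constant sheaf `ℤʳ`. -/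
structure LocalSystem (S : Type u) [TopologicalSpace S] (r : ℕ) where
  stalk : S → Type v
  [addCommGroup : ∀ x, AddCommGroup (stalk x)]
  IsFlatAt : (∀ x, stalk x) → S → Prop
  exists_trivialization : ∀ x : S, ∃ (U : Set S) (φ : ∀ y, stalk y → (Fin r → ℤ)),
    IsOpen U ∧ x ∈ U ∧
    (∀ y ∈ U, Function.Bijective (φ y) ∧ ∀ a b, φ y (a + b) = φ y a + φ y b) ∧
    ∀ y ∈ U, ∀ s : ∀ x, stalk x, IsFlatAt s y ↔ ∀ᶠ z in 𝓝 y, φ z (s z) = φ y (s y)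

attribute [instance] LocalSystem.addCommGroup

namespace LocalSystem

variable {S : Type u} [TopologicalSpace S] {r : ℕ}

/-- `b` is obtained from `a` by parallel transport along `γ`: there is a section of the pullback
of the local system by `γ` that starts at `a` and ends at `b`. -/
def IsTransport (L : LocalSystem.{u, v} S r) {x y : S} (γ : Path x y) (a : L.stalk x)
    (b : L.stalk y) : Prop :=
  ∃ s : ∀ z, unitInterval → L.stalk z,
    s x 0 = a ∧ s y 1 = b ∧
    ∀ t₀ : unitInterval, ∃ σ : ∀ z, L.stalk z, L.IsFlatAt σ (γ t₀) ∧
      ∀ᶠ t in 𝓝 t₀, s (γ t) t = σ (γ t)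

/-- `T` is the monodromy of the local system along the loop `γ`. -/
def IsMonodromy (L : LocalSystem.{u, v} S r) {x : S} (γ : Path x x)
    (T : L.stalk x ≃ₗ[ℤ] L.stalk x) : Prop :=
  ∀ a, L.IsTransport γ a (T a)

/-- The frames at `x` of the local system `L ⊗ ℤ/n`. -/
abbrev Frame (L : LocalSystem.{u, v} S r) (n : ℕ) (x : S) : Type v :=
  (Fin r → ZMod n) ≃ₗ[ZMod n] (ZMod n ⊗[ℤ] L.stalk x)

/-- Sections near `x` of the local system of sets `Isom ((ℤ/n)ʳ, L ⊗ ℤ/n)`: the isomorphisms that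
map constant sections to sections of `L ⊗ ℤ/n`. -/
def IsFlatFrameAt (L : LocalSystem.{u, v} S r) (n : ℕ) (σ : ∀ z, L.Frame n z) (x : S) : Prop :=
  ∀ c : Fin r → ZMod n, ∃ s : ∀ z, L.stalk z, L.IsFlatAt s x ∧ ∀ᶠ z in 𝓝 x, σ z c = 1 ⊗ₜ[ℤ] s z

/-- The level `n` cover of `S`: the total (étalé) space of the local system of sets
`Isom ((ℤ/n)ʳ, L ⊗ ℤ/n)`. -/
structure LevelCover (L : LocalSystem.{u, v} S r) (n : ℕ) where
  pt : S
  frame : L.Frame n pt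

/-- The topology of the étalé space: the finest one for which the local sections are continuous. -/
instance (L : LocalSystem.{u, v} S r) (n : ℕ) : TopologicalSpace (L.LevelCover n) where
  IsOpen V := ∀ ξ ∈ V, ∀ σ : ∀ z, L.Frame n z, σ ξ.pt = ξ.frame → L.IsFlatFrameAt n σ ξ.pt →
    ∀ᶠ z in 𝓝 ξ.pt, (⟨z, σ z⟩ : L.LevelCover n) ∈ V
  isOpen_univ := by
    intros
    simp
  isOpen_inter V W hV hW ξ hξ σ h1 h2 := (hV ξ hξ.1 σ h1 h2).and (hW ξ hξ.2 σ h1 h2)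
  isOpen_sUnion V hV ξ := by
    rintro ⟨W, hW, hξ⟩ σ h1 h2
    exact (hV W hW ξ hξ σ h1 h2).mono fun z hz => ⟨W, hW, hz⟩

theorem LevelCover.continuous_pt (L : LocalSystem.{u, v} S r) (n : ℕ) :
    Continuous (LevelCover.pt : L.LevelCover n → S) :=
  ⟨fun _ hV _ hξ _ _ _ => hV.mem_nhds hξ⟩

section levelMap

variable {X : Type u} [TopologicalSpace X] {D : Set X}

/-- The projection of the level `n` cover of the complement of `D` to the ambient space `X`. -/
def levelMap (L : LocalSystem.{u, v} {x : X // x ∉ D} r) (n : ℕ) (ξ : L.LevelCover n) : X :=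
  ξ.pt.1

theorem continuous_levelMap (L : LocalSystem.{u, v} {x : X // x ∉ D} r) (n : ℕ) :
    Continuous (L.levelMap n) :=
  continuous_subtype_val.comp (LevelCover.continuous_pt L n)

/-- The structure sheaf of the level cover, which is étale over the open subspace `X - D`. -/
instance [HolStructure X] (L : LocalSystem.{u, v} {x : X // x ∉ D} r) (n : ℕ) :
    HolStructure (L.LevelCover n) :=
  HolStructure.induced (L.levelMap n) (L.continuous_levelMap n)

theorem isHolMap_levelMap [HolStructure X] (L : LocalSystem.{u, v} {x : X // x ∉ D} r) (n : ℕ) :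
    IsHolMap (L.levelMap n) :=
  ⟨L.continuous_levelMap n, fun _ g hg => ⟨g, hg, EventuallyEq.rfl⟩⟩

end levelMap

end LocalSystem

/-! ### Normalization in a covering space -/

section Normalization

variable {M : Type w} {X : Type u} [TopologicalSpace M] [TopologicalSpace X] [HolStructure M]
  [HolStructure X]

/-- The stalk at `x` of the integral closure of the structure sheaf `O` of `X` in the sheaf of
functions of `M`: the germs along the fibre (that is, on the sets `f ⁻¹ U`, where `U` runs through
the neighbourhoods of `x`) of holomorphic functions on `M` which are integral over `O_x`.
When `M` is normal, a meromorphic function on `M` that is integral over `O` is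
holomorphic, so that this is also the integral closure of `O` in the sheaf of meromorphic
functions (the total ring of fractions) of `M`. -/
def integralStalk (f : M → X) (x : X) : Subring (Germ (comap f (𝓝 x)) ℂ) where
  carrier := {a | ∃ h : M → ℂ, a = (h : Germ (comap f (𝓝 x)) ℂ) ∧
    (∀ᶠ m in comap f (𝓝 x), HolAt h m) ∧
    ((germComp f tendsto_comap).comp (holStalk x).subtype).IsIntegralElem a}
  mul_mem' := by
    rintro _ _ ⟨h, rfl, hh, hi⟩ ⟨k, rfl, hk, ki⟩
    exact ⟨h * k, rfl, by filter_upwards [hh, hk] with m h1 h2 using HolStructure.mul h1 h2,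
      hi.mul _ ki⟩
  one_mem' := ⟨fun _ => 1, rfl, .of_forall fun m => HolStructure.const 1 m,
    RingHom.isIntegralElem_one _⟩
  add_mem' := by
    rintro _ _ ⟨h, rfl, hh, hi⟩ ⟨k, rfl, hk, ki⟩
    exact ⟨h + k, rfl, by filter_upwards [hh, hk] with m h1 h2 using HolStructure.add h1 h2,
      hi.add _ ki⟩
  zero_mem' := ⟨fun _ => 0, rfl, .of_forall fun m => HolStructure.const 0 m,
    RingHom.isIntegralElem_zero _⟩
  neg_mem' := by
    rintro _ ⟨h, rfl, hh, hi⟩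
    refine ⟨(fun _ => -1) * h, ?_, ?_, hi.neg⟩
    · have : (fun _ => -1) * h = -h := by
        funext z
        simp
      rw [this]
      rfl
    · filter_upwards [hh] with m h1 using HolStructure.mul (HolStructure.const (-1) m) h1

/-- The function `h` on `M` defines an element of the integral closure at `x`. -/
def IsIntegralAt (f : M → X) (h : M → ℂ) (x : X) : Prop :=
  (h : Germ (comap f (𝓝 x)) ℂ) ∈ integralStalk f x

/-- The normalization of `X` in (the total ring of fractions of) `M`, for a holomorphic map
`f : M → X`. It is the analytic spectrum of the integral closure of the structure sheaf of `X` in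
the functions on `M`: its points over `x` are the homomorphisms to `ℂ` of the stalk at `x` of this
sheaf of algebras, whose restriction to the local ring of `X` at `x` is the evaluation at `x`. -/
structure Normalization (f : M → X) where
  pt : X
  char : integralStalk f pt →+* ℂ
  char_comp : ∀ (g : X → ℂ), HolAt g pt → ∀ (h : IsIntegralAt f (g ∘ f) pt), char ⟨_, h⟩ = g pt

namespace Normalization

variable {f : M → X}

open Classical in
/-- The function on the normalization defined by a function `h` on `M`, at the points at which `h`
is integral over the structure sheaf of `X`. -/
def eval (f : M → X) (h : M → ℂ) (y : Normalization f) : ℂ :=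
  if hy : IsIntegralAt f h y.pt then y.char ⟨_, hy⟩ else 0

theorem eval_add {h k : M → ℂ} {y : Normalization f} (hy : IsIntegralAt f h y.pt)
    (ky : IsIntegralAt f k y.pt) : eval f (h + k) y = eval f h y + eval f k y := by
  have hk : IsIntegralAt f (h + k) y.pt := (integralStalk f y.pt).add_mem hy ky
  rw [eval, eval, eval, dif_pos hy, dif_pos ky, dif_pos hk, ← map_add]
  rfl

theorem eval_mul {h k : M → ℂ} {y : Normalization f} (hy : IsIntegralAt f h y.pt)
    (ky : IsIntegralAt f k y.pt) : eval f (h * k) y = eval f h y * eval f k y := by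
  have hk : IsIntegralAt f (h * k) y.pt := (integralStalk f y.pt).mul_mem hy ky
  rw [eval, eval, eval, dif_pos hy, dif_pos ky, dif_pos hk, ← map_mul]
  rfl

/-- The topology of the analytic spectrum: the coarsest one for which the projection to `X` and the
functions defined by local sections of the sheaf of algebras are continuous. -/
instance : TopologicalSpace (Normalization f) :=
  .generateFrom {V | ∃ (U : Set X) (h : M → ℂ) (W : Set ℂ), IsOpen U ∧ IsOpen W ∧
    (∀ x ∈ U, IsIntegralAt f h x) ∧ V = {y | y.pt ∈ U ∧ eval f h y ∈ W}}

theorem continuous_pt : Continuous (pt : Normalization f → X) := by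
  refine ⟨fun U hU => ?_⟩
  refine TopologicalSpace.isOpen_generateFrom_of_mem ⟨U, fun _ => 0, Set.univ, hU, isOpen_univ,
    fun x _ => (integralStalk f x).zero_mem, ?_⟩
  ext y
  simp

theorem isIntegralAt_comp (hf : IsHolMap f) {g : X → ℂ} {x : X} (hg : HolAt g x) :
    IsIntegralAt f (g ∘ f) x :=
  ⟨g ∘ f, rfl, (tendsto_comap.eventually (HolStructure.eventually hg)).mono fun m hm => hf.comp m g hm,
    RingHom.isIntegralElem_map _ (x := (⟨_, g, hg, rfl⟩ : holStalk x))⟩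

/-- The structure sheaf of the normalization: the functions which are locally defined by sections
of the sheaf of algebras. -/
instance : HolStructure (Normalization f) where
  HolAt g y := ∃ h : M → ℂ, (∀ᶠ x in 𝓝 y.pt, IsIntegralAt f h x) ∧ g =ᶠ[𝓝 y] eval f h
  congr := by
    rintro g g' y ⟨h, hh, e⟩ e'
    exact ⟨h, hh, e'.symm.trans e⟩
  eventually := by
    rintro g y ⟨h, hh, e⟩
    filter_upwards [continuous_pt.continuousAt.eventually (eventually_eventually_nhds.2 hh),
      eventually_eventually_nhds.2 e] with z h1 h2
    exact ⟨h, h1, h2⟩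
  const c y := by
    have hc (x : X) : IsIntegralAt f (fun _ => c) x :=
      ⟨_, rfl, .of_forall fun m => HolStructure.const c m, RingHom.isIntegralElem_map _
        (x := (⟨_, fun _ => c, HolStructure.const c x, rfl⟩ : holStalk x))⟩
    refine ⟨fun _ => c, .of_forall hc, .of_forall fun z => ?_⟩
    rw [eval, dif_pos (hc z.pt)]
    exact (z.char_comp (fun _ => c) (HolStructure.const c _) (hc z.pt)).symm
  add := by
    rintro g g' y ⟨h, hh, e⟩ ⟨h', hh', e'⟩
    refine ⟨h + h', ?_, ?_⟩
    · filter_upwards [hh, hh'] with x h1 h2 using (integralStalk f x).add_mem h1 h2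
    · filter_upwards [e, e', continuous_pt.continuousAt.eventually hh,
        continuous_pt.continuousAt.eventually hh'] with z h1 h2 h3 h4
      rw [Pi.add_apply, h1, h2, eval_add h3 h4]
  mul := by
    rintro g g' y ⟨h, hh, e⟩ ⟨h', hh', e'⟩
    refine ⟨h * h', ?_, ?_⟩
    · filter_upwards [hh, hh'] with x h1 h2 using (integralStalk f x).mul_mem h1 h2
    · filter_upwards [e, e', continuous_pt.continuousAt.eventually hh,
        continuous_pt.continuousAt.eventually hh'] with z h1 h2 h3 h4
      rw [Pi.mul_apply, h1, h2, eval_mul h3 h4]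

/-- The projection from the normalization to `X` is holomorphic. -/
theorem isHolMap_pt (hf : IsHolMap f) : IsHolMap (pt : Normalization f → X) := by
  refine ⟨continuous_pt, fun y g hg => ⟨g ∘ f, ?_, ?_⟩⟩
  · filter_upwards [HolStructure.eventually hg] with x hx using isIntegralAt_comp hf hx
  · filter_upwards [continuous_pt.continuousAt.eventually (HolStructure.eventually hg)] with z hz
    rw [eval, dif_pos (isIntegralAt_comp hf hz)]
    exact (z.char_comp g hz _).symm

end Normalization

end Normalization

/-! ### Ramification -/

/-- The holomorphic map `φ : Y → X` has ramification order `e` at the point `y` along the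
hypersurface `D`: locally at `y`, the pullback of the reduced divisor `D` is `e` times the reduced
divisor `φ ⁻¹ D`. That is, the ideal generated by the pullbacks of the functions
vanishing on `D` is the `e`-th power of the ideal of functions vanishing on `φ ⁻¹ D`. -/
def HasRamificationOrderAt {Y : Type v} {X : Type u} [TopologicalSpace Y] [TopologicalSpace X]
    [HolStructure Y] [HolStructure X] (φ : Y → X) (hφ : IsHolMap φ) (D : Set X) (y : Y)
    (e : ℕ) : Prop :=
  (vanishingIdealAt D (φ y)).map (holStalkMap φ hφ y) = vanishingIdealAt (φ ⁻¹' D) y ^ e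

/-- The holomorphic map `φ : Y → X` ramifies over the irreducible component `Z` of the hypersurface
`D` with an order divisible by `p`: this holds at every point of `Y` that lies over
a general point of `Z`, that is over a point of `Z` at which both `X` and `D` are smooth. -/
def RamifiesWithOrderDivisibleBy {Y : Type v} {X : Type u} [TopologicalSpace Y]
    [TopologicalSpace X] [HolStructure Y] [HolStructure X] (φ : Y → X) (hφ : IsHolMap φ)
    (D Z : Set X) (p : ℕ) : Prop :=
  ∀ y : Y, φ y ∈ Z → φ y ∈ smoothPoints D →
    ∃ e : ℕ, 0 < e ∧ p ∣ e ∧ HasRamificationOrderAt φ hφ D y e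

end

noncomputable section

open HolStructure (HolAt)


/-! ### Integrals of analytic functions depending on a parameter -/

section ParametricIntegral

open scoped NNReal ENNReal
open MeasureTheory

variable {W V : Type*} [NormedAddCommGroup W] [NormedSpace ℂ W] [NormedAddCommGroup V]
  [NormedSpace ℂ V]

/-! Local picture. Near a point where both the ambient space and `D` are smooth, the complement of
`D` is a punctured disc times a ball. Its universal cover is a half plane times a ball, on which `ℤ`
acts by translations, and the local system is given there by one matrix `A`, conjugate to the
monodromy along the meridian. A power of `A` fixes a frame of `L ⊗ ℤ/p` only if it is trivial mod
`p`. Hence the level cover is locally a finite disjoint union of Kummer coverings `(w, b) ↦ (w ^ e,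
b)`, where `e` is the order of `A` mod `p` (`PolydiscChart.kummerModel`). Functions integral over
the base are the bounded holomorphic functions on these sheets. By Riemann's extension theorem they
extend across `w = 0`, so the normalization has one point on each sheet over each nearby point of
`D`. There the equation of `D` pulls back to `w ^ e`, and `w` generates the ideal of the preimage of
`D`. The ramification order is therefore exactly `e` (`KummerModel.hasRamificationOrderAt_iff`).

Arithmetic. The eigenvalues of `A` are algebraic integers whose characteristic polynomial has all
its roots on the unit circle. By Kronecker's theorem they are roots of unity, so some `A ^ m` is
unipotent, and `A ^ m ≠ 1` because `A` has infinite order. If `p` does not divide `e`, then `A ^ m`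
mod `p` is unipotent of order prime to `p`, hence trivial. Then `p` divides every entry of `A ^ m -
1`, one of which is nonzero, and this leaves finitely many `p`
(`LinearEquiv.finite_setOf_not_dvd_orderOf`).

Uniformity along a component. The exceptional primes obtained this way depend on the chosen point.
For fixed `p`, however, the divisibility of the ramification order by `p` is locally constant on the
smooth points of `D`. The smooth points of a component are connected, and removing the other
components, locally contained in the zeros of a nonzero analytic function, does not disconnect them
(`IsPrimeDivisor.iff_of_eventually_iff`). One point on each of the finitely many components is
therefore enough. -/

theorem FormalMultilinearSeries.exists_bound_changeOrigin
    (p : FormalMultilinearSeries ℂ W ℂ) {r r' : ℝ≥0}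
    (hr : (r + r' : ℝ≥0∞) < p.radius) :
    ∃ C : ℕ → ℝ≥0, (Summable fun k => C k * r' ^ k) ∧
      ∀ x : W, ‖x‖₊ ≤ r → ∀ k, ‖p.changeOrigin x k‖₊ ≤ C k := by
  have hr0 : (r : ℝ≥0∞) < p.radius := lt_of_le_of_lt (le_add_right le_rfl) hr
  -- The norm series bounding the re-expanded coefficients increases with the norm of `x`, so its
  -- value at radius `r` serves the whole ball. Summability against `r' ^ k` is convergence of the
  -- double series at `r + r'`.
  refine ⟨fun k => ∑' s : Σ l : ℕ, { s : Finset (Fin (k + l)) // s.card = l },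
    ‖p (k + s.1)‖₊ * r ^ s.1, ?_, fun x hx k => ?_⟩
  · simpa only [← NNReal.tsum_mul_right] using
      (NNReal.summable_sigma.1 (p.changeOriginSeries_summable_aux₁ hr)).2
  · have hx' : (‖x‖₊ : ℝ≥0∞) < p.radius := lt_of_le_of_lt (by exact_mod_cast hx) hr0
    refine (p.nnnorm_changeOrigin_le k hx').trans ?_
    refine Summable.tsum_le_tsum (fun s => ?_) (p.changeOriginSeries_summable_aux₂ hx' k)
      (p.changeOriginSeries_summable_aux₂ hr0 k)
    gcongr

/-- The series is re-expanded at `(γ θ, v₀)`, restricted to the directions of `V` and integrated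
term by term. The bounds of `exists_bound_changeOrigin` are uniform in `θ` and give both the radius
of the new series and the domination. -/
theorem HasFPowerSeriesOnBall.analyticAt_intervalIntegral {f : W × V → ℂ}
    {p : FormalMultilinearSeries ℂ (W × V) ℂ} {w₀ : W} {v₀ : V} {R : ℝ≥0∞} {r r' : ℝ≥0}
    (hf : HasFPowerSeriesOnBall f p (w₀, v₀) R) (hr' : 0 < r') (hr : (r + r' : ℝ≥0∞) < R)
    {γ : ℝ → W} (hγ : Continuous γ) {s t : ℝ} (hst : ∀ θ ∈ Set.uIcc s t, ‖γ θ - w₀‖₊ ≤ r) :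
    AnalyticAt ℂ (fun v => ∫ θ in s..t, f (γ θ, v)) v₀ := by
  have hrp : (r + r' : ℝ≥0∞) < p.radius := hr.trans_le hf.r_le
  have hr0 : (r : ℝ≥0∞) < p.radius := lt_of_le_of_lt (le_add_right le_rfl) hrp
  obtain ⟨C, hC, hCb⟩ := p.exists_bound_changeOrigin hrp
  set x : ℝ → W × V := fun θ => (γ θ - w₀, 0) with hx
  have hxc : Continuous x := by fun_prop
  have hxn (θ) (hθ : θ ∈ Set.uIcc s t) : ‖x θ‖₊ ≤ r := by
    simpa [hx, Prod.nnnorm_def] using hst θ hθ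
  have hco (k : ℕ) : ContinuousOn (fun θ => p.changeOrigin (x θ) k) (Set.uIcc s t) := by
    have h1 := (p.hasFPowerSeriesOnBall_changeOrigin k (hr0.trans_le' bot_le)).continuousOn
    refine h1.comp hxc.continuousOn fun θ hθ => ?_
    rw [mem_eball_zero_iff]
    exact lt_of_le_of_lt (by exact_mod_cast hxn θ hθ) hr0
  let J (k : ℕ) := ContinuousMultilinearMap.compContinuousLinearMapL (𝕜 := ℂ) (F := ℂ)
    (fun _ : Fin k => ContinuousLinearMap.inr ℂ W V)
  have hcJ (k : ℕ) : ContinuousOn (fun θ => J k (p.changeOrigin (x θ) k)) (Set.uIcc s t) :=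
    (J k).continuous.comp_continuousOn (hco k)
  let q : FormalMultilinearSeries ℂ V ℂ := fun k => ∫ θ in s..t, J k (p.changeOrigin (x θ) k)
  have hJn (k : ℕ) (a) : ‖J k a‖ ≤ ‖a‖ := by
    refine (ContinuousMultilinearMap.norm_compContinuousLinearMap_le _ _).trans ?_
    refine mul_le_of_le_one_right (norm_nonneg _) ?_
    refine Finset.prod_le_one (fun _ _ => norm_nonneg _) fun _ _ => ?_
    exact ContinuousLinearMap.norm_inr_le_one ℂ W V
  have hJb (k : ℕ) (θ) (hθ : θ ∈ Set.uIcc s t) : ‖J k (p.changeOrigin (x θ) k)‖ ≤ C k :=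
    (hJn k _).trans (by exact_mod_cast hCb _ (hxn θ hθ) k)
  refine ⟨q, r', ?_, by exact_mod_cast hr', fun {y} hy => ?_⟩
  · refine FormalMultilinearSeries.le_radius_of_summable_norm _ ?_
    have hs : Summable fun k => (C k * r' ^ k : ℝ) * |t - s| := by
      refine Summable.mul_right _ ?_
      exact_mod_cast hC
    refine Summable.of_nonneg_of_le (fun k => by positivity) (fun k => ?_) hs
    have := intervalIntegral.norm_integral_le_of_norm_le_const
      (f := fun θ => J k (p.changeOrigin (x θ) k)) (a := s) (b := t) (C := C k)
      fun θ hθ => hJb k θ (Set.uIoc_subset_uIcc hθ)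
    calc ‖q k‖ * (r' : ℝ) ^ k ≤ (C k * |t - s|) * r' ^ k := by gcongr
      _ = _ := by ring
  · have hyn : ‖y‖₊ < r' := by
      rw [mem_eball_zero_iff] at hy
      exact_mod_cast hy
    have hq (k : ℕ) : q k (fun _ => y) =
        ∫ θ in s..t, p.changeOrigin (x θ) k (fun _ => ((0 : W), y)) := by
      have h1 := ContinuousLinearMap.intervalIntegral_comp_comm
        (ContinuousMultilinearMap.apply ℂ (fun _ : Fin k => V) ℂ (fun _ => y))
        ((hcJ k).intervalIntegrable (μ := volume))
      exact h1.symm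
    simp_rw [hq]
    refine intervalIntegral.hasSum_integral_of_dominated_convergence
      (fun k _ => C k * r' ^ k) (fun k => ?_) (fun k => ?_) ?_ ?_ ?_
    · refine (ContinuousOn.aestronglyMeasurable ?_ measurableSet_uIcc).mono_measure
        (Measure.restrict_mono Set.uIoc_subset_uIcc le_rfl)
      exact ((ContinuousMultilinearMap.apply ℂ (fun _ : Fin k => W × V) ℂ
        (fun _ => ((0 : W), y))).continuous).comp_continuousOn (hco k)
    · refine .of_forall fun θ hθ => ?_
      refine ((p.changeOrigin (x θ) k).le_opNorm _).trans ?_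
      have h1 : ‖p.changeOrigin (x θ) k‖ ≤ C k := by
        exact_mod_cast hCb _ (hxn θ (Set.uIoc_subset_uIcc hθ)) k
      have h2 : ‖((0 : W), y)‖ ≤ r' := by
        have h3 : ‖y‖ ≤ r' := by exact_mod_cast hyn.le
        simpa [Prod.norm_def] using h3
      calc _ ≤ (C k : ℝ) * ∏ _i : Fin k, (r' : ℝ) := by gcongr
        _ = _ := by simp
    · refine .of_forall fun θ _ => ?_
      exact_mod_cast hC
    · exact intervalIntegrable_const
    · refine .of_forall fun θ hθ => ?_
      have hxθ := hxn θ (Set.uIoc_subset_uIcc hθ)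
      have h1 : (‖x θ‖₊ : ℝ≥0∞) + r' < R := lt_of_le_of_lt (by gcongr) hr
      have h2 := hf.changeOrigin (y := x θ) (lt_of_le_of_lt (le_add_right le_rfl) h1)
      have h3 := h2.hasSum (y := ((0 : W), y)) (by
        rw [mem_eball_zero_iff]
        have h4 : ‖((0 : W), y)‖ₑ = ‖y‖ₑ := by
          rw [← ofReal_norm, ← ofReal_norm]
          simp [Prod.norm_def]
        rw [h4]
        refine lt_of_lt_of_le (b := (r' : ℝ≥0∞)) (by exact_mod_cast hyn) ?_
        exact ENNReal.le_sub_of_add_le_left (by simp) h1.le)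
      have h5 : (w₀, v₀) + x θ + ((0 : W), y) = (γ θ, v₀ + y) := by
        simp [hx]
      rwa [h5] at h3

/-- The integral over an interval of an analytic function depending on a parameter is analytic. -/
theorem analyticAt_intervalIntegral {f : W × V → ℂ} {v₀ : V} {γ : ℝ → W} (hγ : Continuous γ)
    {a b : ℝ} (hf : ∀ θ, AnalyticAt ℂ f (γ θ, v₀)) :
    AnalyticAt ℂ (fun v => ∫ θ in a..b, f (γ θ, v)) v₀ := by
  have hloc (θ₀ : ℝ) : ∀ᶠ θ in 𝓝 θ₀, AnalyticAt ℂ (fun v => ∫ θ in θ₀..θ, f (γ θ, v)) v₀ := by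
    obtain ⟨p, R, hR⟩ := hf θ₀
    obtain ⟨ρ, hρ0, hρ⟩ := ENNReal.lt_iff_exists_nnreal_btwn.1 hR.r_pos
    have hρ0' : 0 < ρ := by exact_mod_cast hρ0
    have hsum : ((ρ / 2 : ℝ≥0) + (ρ / 2 : ℝ≥0) : ℝ≥0∞) < R := by
      rw [← ENNReal.coe_add, add_halves]
      exact hρ
    have h1 : {θ | ‖γ θ - γ θ₀‖₊ < ρ / 2} ∈ 𝓝 θ₀ := by
      refine (isOpen_lt (by fun_prop) continuous_const).mem_nhds ?_
      simpa using half_pos hρ0'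
    obtain ⟨δ, hδ, hball⟩ := Metric.mem_nhds_iff.1 h1
    filter_upwards [Metric.ball_mem_nhds θ₀ hδ] with θ hθ
    refine hR.analyticAt_intervalIntegral (half_pos hρ0') hsum hγ fun θ' hθ' => ?_
    refine le_of_lt (hball ?_)
    exact (Real.ball_eq_Ioo θ₀ δ ▸ Set.ordConnected_Ioo : (Metric.ball θ₀ δ).OrdConnected).uIcc_subset
      (Metric.mem_ball_self hδ) hθ hθ'
  have hint (s t : ℝ) : ∀ᶠ v in 𝓝 v₀,
      IntervalIntegrable (fun θ => f (γ θ, v)) volume s t := by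
    have h1 : ∀ᶠ v in 𝓝 v₀, ∀ θ ∈ Set.uIcc s t, AnalyticAt ℂ f (γ θ, v) := by
      refine isCompact_uIcc.eventually_forall_of_forall_eventually fun θ _ => ?_
      have : Continuous fun z : V × ℝ => (γ z.2, z.1) := by fun_prop
      exact this.continuousAt.eventually (hf θ).eventually_analyticAt
    filter_upwards [h1] with v hv
    refine ContinuousOn.intervalIntegrable fun θ hθ => ContinuousAt.continuousWithinAt ?_
    exact ContinuousAt.comp (f := fun θ => (γ θ, v)) (hv θ hθ).continuousAt (by fun_prop)
  -- The short-interval case shows that the set of good endpoints is open and closed; it contains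
  -- `a`, and `ℝ` is connected.
  let T : Set ℝ := {t | AnalyticAt ℂ (fun v => ∫ θ in a..t, f (γ θ, v)) v₀}
  have hadd (s t : ℝ) : (fun v => ∫ θ in a..t, f (γ θ, v)) =ᶠ[𝓝 v₀]
      (fun v => ∫ θ in a..s, f (γ θ, v)) + (fun v => ∫ θ in s..t, f (γ θ, v)) := by
    filter_upwards [hint a s, hint s t] with v h1 h2
    exact (intervalIntegral.integral_add_adjacent_intervals h1 h2).symm
  have hT : IsClopen T := by
    have key (s t : ℝ) (h : AnalyticAt ℂ (fun v => ∫ θ in s..t, f (γ θ, v)) v₀) :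
        s ∈ T ↔ t ∈ T := by
      constructor
      · intro hs
        exact (hs.add h).congr (hadd s t).symm
      · intro ht
        have := ht.sub h
        refine this.congr ?_
        filter_upwards [hadd s t] with v hv
        simp only [Pi.sub_apply, hv, Pi.add_apply, add_sub_cancel_right]
    refine ⟨⟨?_⟩, ?_⟩
    · rw [isOpen_iff_mem_nhds]
      intro s hs
      filter_upwards [hloc s] with t ht h
      exact hs ((key s t ht).2 h)
    · rw [isOpen_iff_mem_nhds]
      intro s hs
      filter_upwards [hloc s] with t ht
      exact (key s t ht).1 hs
  have hne : T.Nonempty := ⟨a, by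
    simp only [T, Set.mem_ofPred_eq, intervalIntegral.integral_same]
    exact analyticAt_const⟩
  have : b ∈ T := by
    rw [hT.eq_univ hne]
    trivial
  exact this

end ParametricIntegral

/-! ### Removable singularities and division along a hyperplane -/

section Hyperplane

variable {E : Type*} [NormedAddCommGroup E] [NormedSpace ℂ E]

/-- Riemann's extension theorem: a bounded analytic function on the complement of the hyperplane
`z.1 = 0` extends analytically. -/
theorem exists_analyticAt_of_bounded {F : ℂ × E → ℂ} {b : E} {C : ℝ}
    (hF : ∀ᶠ z in 𝓝 ((0 : ℂ), b), z.1 ≠ 0 → AnalyticAt ℂ F z)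
    (hC : ∀ᶠ z in 𝓝 ((0 : ℂ), b), z.1 ≠ 0 → ‖F z‖ ≤ C) :
    ∃ G : ℂ × E → ℂ, AnalyticAt ℂ G (0, b) ∧ ∀ᶠ z in 𝓝 ((0 : ℂ), b), z.1 ≠ 0 → G z = F z := by
  obtain ⟨δ, hδ, hball⟩ := Metric.eventually_nhds_iff_ball.1 (hF.and hC)
  have hmem {z : ℂ × E} (h1 : ‖z.1‖ < δ) (h2 : ‖z.2 - b‖ < δ) : z ∈ Metric.ball ((0 : ℂ), b) δ := by
    rw [Metric.mem_ball, Prod.dist_eq, dist_zero_right, dist_eq_norm]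
    exact max_lt h1 h2
  have hδ2 : 0 < δ / 2 := half_pos hδ
  let c : ℝ → ℂ := circleMap 0 (δ / 2)
  have hcn (θ) : ‖c θ‖ = δ / 2 := by simp [c, abs_of_pos hδ2]
  have hc0 (θ) : c θ ≠ 0 := by
    rw [← norm_ne_zero_iff, hcn]
    exact hδ2.ne'
  -- The Cauchy integrand in the first variable; `Complex.I * z.1` is the derivative of the circle
  -- parametrization. The circle avoids the hyperplane, so the integral is analytic in the parameter
  -- even at `z.1 = 0`.
  let f : ℂ × (ℂ × E) → ℂ := fun z => Complex.I * z.1 * (z.1 - z.2.1)⁻¹ * F (z.1, z.2.2)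
  have hf (θ : ℝ) : AnalyticAt ℂ f (c θ, ((0 : ℂ), b)) := by
    have h1 : AnalyticAt ℂ F (c θ, b) :=
      (hball (c θ, b) (hmem (by rw [hcn]; linarith) (by simpa using hδ))).1 (hc0 θ)
    have h2 : AnalyticAt ℂ (fun z : ℂ × (ℂ × E) => F (z.1, z.2.2)) (c θ, ((0 : ℂ), b)) :=
      AnalyticAt.comp (f := fun z : ℂ × (ℂ × E) => (z.1, z.2.2)) h1
        (analyticAt_fst.prod (analyticAt_snd.comp analyticAt_snd))
    refine ((analyticAt_const.mul analyticAt_fst).mul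
      ((analyticAt_fst.sub (analyticAt_fst.comp analyticAt_snd)).inv ?_)).mul h2
    simpa using hc0 θ
  refine ⟨fun v => (2 * Real.pi * Complex.I : ℂ)⁻¹ * ∫ θ in (0)..(2 * Real.pi), f (c θ, v),
    analyticAt_const.mul (analyticAt_intervalIntegral (continuous_circleMap 0 _) hf), ?_⟩
  filter_upwards [Metric.ball_mem_nhds ((0 : ℂ), b) hδ2] with z hz hz0
  rw [Metric.mem_ball, Prod.dist_eq, dist_zero_right, dist_eq_norm, max_lt_iff] at hz
  have hz2 : ‖z.2 - b‖ < δ := hz.2.trans (by linarith)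
  let g : ℂ → ℂ := fun t => F (t, z.2)
  have hg : DifferentiableOn ℂ g (Metric.ball 0 δ \ {0}) := by
    intro t ht
    have h1 := (hball (t, z.2) (hmem (by simpa using ht.1) hz2)).1 (by simpa using ht.2)
    have h2 : AnalyticAt ℂ g t := AnalyticAt.comp (f := fun t => (t, z.2)) h1 (by fun_prop)
    exact h2.differentiableAt.differentiableWithinAt
  have hgb : BddAbove (norm ∘ g '' (Metric.ball 0 δ \ {0})) := by
    refine ⟨C, ?_⟩
    rintro _ ⟨t, ht, rfl⟩
    exact (hball (t, z.2) (hmem (by simpa using ht.1) hz2)).2 (by simpa using ht.2)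
  -- In each slice the singularity at `0` is removable in one variable, so Cauchy's formula applies
  -- and identifies the integral with `F` off the hyperplane.
  have hext := Complex.differentiableOn_update_limUnder_of_bddAbove
    (Metric.ball_mem_nhds (0 : ℂ) hδ) hg hgb
  have hcauchy := (hext.mono (Metric.closedBall_subset_ball (half_lt_self hδ))
    ).circleIntegral_sub_inv_smul (w := z.1) (by simpa using hz.1)
  rw [Function.update_of_ne hz0] at hcauchy
  have hcongr : (∫ θ in (0)..(2 * Real.pi), f (c θ, z)) =
      ∮ t in C(0, δ / 2), (t - z.1)⁻¹ • Function.update g 0 (limUnder (𝓝[≠] 0) g) t := by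
    rw [circleIntegral]
    refine intervalIntegral.integral_congr fun θ _ => ?_
    have h1 : circleMap 0 (δ / 2) θ ≠ 0 := hc0 θ
    simp only [deriv_circleMap, smul_eq_mul, Function.update_of_ne h1, f, g, c]
    ring
  rw [hcongr, hcauchy, smul_eq_mul, inv_mul_cancel_left₀]
  simp [Real.pi_ne_zero]

theorem AnalyticAt.exists_eventually_norm_sub_le {V : Type*} [NormedAddCommGroup V]
    [NormedSpace ℂ V] {G : V → ℂ} {x : V} (hG : AnalyticAt ℂ G x) :
    ∃ C : ℝ, ∀ᶠ z in 𝓝 (x, x), ‖G z.1 - G z.2‖ ≤ C * ‖z.1 - z.2‖ := by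
  obtain ⟨K, t, ht, hK⟩ := hG.hasStrictFDerivAt.exists_lipschitzOnWith
  refine ⟨K, ?_⟩
  filter_upwards [prod_mem_nhds ht ht] with z hz
  exact hK.norm_sub_le hz.1 hz.2

/-- An analytic function vanishing on the hyperplane `z.1 = 0` is divisible by `z.1`. -/
theorem AnalyticAt.exists_eq_fst_mul {G : ℂ × E → ℂ} {b : E} (hG : AnalyticAt ℂ G (0, b))
    (h0 : ∀ᶠ b' in 𝓝 b, G (0, b') = 0) :
    ∃ K : ℂ × E → ℂ, AnalyticAt ℂ K (0, b) ∧ ∀ᶠ z in 𝓝 ((0 : ℂ), b), G z = z.1 * K z := by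
  have hsnd : ∀ᶠ z in 𝓝 ((0 : ℂ), b), G (0, z.2) = 0 :=
    (continuous_snd.continuousAt (x := ((0 : ℂ), b))).eventually h0
  obtain ⟨C, hC⟩ := hG.exists_eventually_norm_sub_le
  have hC' : ∀ᶠ z in 𝓝 ((0 : ℂ), b), ‖G z - G (0, z.2)‖ ≤ C * ‖z - (0, z.2)‖ :=
    ContinuousAt.tendsto (f := fun z : ℂ × E => (z, ((0 : ℂ), z.2))) (x := (0, b)) (by fun_prop)
      |>.eventually hC
  -- The quotient is bounded off the hyperplane by a local Lipschitz constant of `G`, because `G`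
  -- vanishes at the projected point `(0, z.2)`.
  obtain ⟨K, hK, hKG⟩ := exists_analyticAt_of_bounded (F := fun z => G z / z.1) (b := b) (C := C)
    (by
      filter_upwards [hG.eventually_analyticAt] with z hz hz0
      exact hz.div analyticAt_fst hz0)
    (by
      filter_upwards [hC', hsnd] with z h1 h2 hz0
      rw [norm_div, div_le_iff₀ (by simpa using hz0)]
      simpa [h2, Prod.norm_def] using h1)
  refine ⟨K, hK, ?_⟩
  filter_upwards [hKG, hsnd] with z h1 h2
  by_cases hz : z.1 = 0
  · rw [hz, zero_mul, ← h2, ← hz]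
  · rw [h1 hz]
    field_simp

end Hyperplane

/-! ### Coefficients of products of linear factors -/

/-- The coefficients are polynomials in the roots. This is the source of analyticity, boundedness
and limits for the coefficients of the polynomials attached to fibres. -/
theorem analyticAt_coeff_prod_X_sub_C {J : Type*} [Fintype J] (s : Finset J) (n : ℕ) (a : J → ℂ) :
    AnalyticAt ℂ (fun a : J → ℂ =>
      (∏ j ∈ s, (Polynomial.X - Polynomial.C (a j))).coeff n) a := by
  classical
  induction s using Finset.induction_on generalizing n with
  | empty => simpa using analyticAt_const
  | insert i s hi ih =>
    have hproj : AnalyticAt ℂ (fun a : J → ℂ => a i) a :=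
      (ContinuousLinearMap.proj (R := ℂ) (φ := fun _ : J => ℂ) i).analyticAt a
    simp only [Finset.prod_insert hi, sub_mul, Polynomial.coeff_sub, Polynomial.coeff_C_mul]
    refine AnalyticAt.sub ?_ (hproj.mul (ih n))
    cases n with
    | zero => simpa using analyticAt_const
    | succ n => simpa only [Polynomial.coeff_X_mul] using ih n

theorem neBot_nhdsWithin_fst_ne_zero {E : Type*} [TopologicalSpace E] (b : ℂ × E) :
    (𝓝[{v : ℂ × E | v.1 ≠ 0}] b).NeBot := by
  have h : Dense {v : ℂ × E | v.1 ≠ 0} :=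
    (dense_compl_singleton (0 : ℂ)).preimage isOpenMap_fst
  exact mem_closure_iff_nhdsWithin_neBot.1 (h b)

/-! ### Kummer coverings -/

/-- A space over `X` which, in a chart of `X` in which `D` is the hyperplane `z.1 = 0`, is a finite
disjoint union of Kummer coverings `(w, b) ↦ (w ^ e, b)` of the complement of the hyperplane. -/
structure KummerModel {X : Type u} {M : Type v} [TopologicalSpace X] [HolStructure X]
    [TopologicalSpace M] [HolStructure M] (D : Set X) (f : M → X)
    (E : Type) [NormedAddCommGroup E] [NormedSpace ℂ E] where
  chart : OpenPartialHomeomorph X (ℂ × E)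
  holAt_iff : ∀ x ∈ chart.source, ∀ g : X → ℂ, HolAt g x ↔ AnalyticAt ℂ (g ∘ chart.symm) (chart x)
  mem_iff : ∀ x ∈ chart.source, (x ∈ D ↔ (chart x).1 = 0)
  base : Set (ℂ × E)
  isOpen_base : IsOpen base
  base_subset : base ⊆ chart.target
  e : ℕ
  e_pos : 0 < e
  ι : Type w
  [fintype : Fintype ι]
  [nonempty : Nonempty ι]
  sheet : ι → ℂ × E → M
  map_sheet : ∀ i v, v.1 ≠ 0 → (v.1 ^ e, v.2) ∈ base → f (sheet i v) = chart.symm (v.1 ^ e, v.2)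
  exists_sheet : ∀ m, f m ∈ chart.source → chart (f m) ∈ base →
    ∃ i v, v.1 ≠ 0 ∧ (v.1 ^ e, v.2) ∈ base ∧ sheet i v = m
  sheet_inj : ∀ i j v v', v.1 ≠ 0 → (v.1 ^ e, v.2) ∈ base → v'.1 ≠ 0 → (v'.1 ^ e, v'.2) ∈ base →
    sheet i v = sheet j v' → i = j ∧ v = v'
  holAt_sheet : ∀ i v, v.1 ≠ 0 → (v.1 ^ e, v.2) ∈ base → ∀ h : M → ℂ,
    HolAt h (sheet i v) ↔ AnalyticAt ℂ (h ∘ sheet i) v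

namespace KummerModel

attribute [instance] KummerModel.fintype KummerModel.nonempty

variable {X : Type u} {M : Type v} [TopologicalSpace X] [HolStructure X]
    [TopologicalSpace M] [HolStructure M] {D : Set X} {f : M → X}
    {E : Type} [NormedAddCommGroup E] [NormedSpace ℂ E] (K : KummerModel.{u, v, w} D f E)

theorem chart_map_sheet {i : K.ι} {v : ℂ × E} (h0 : v.1 ≠ 0) (hv : (v.1 ^ K.e, v.2) ∈ K.base) :
    K.chart (f (K.sheet i v)) = (v.1 ^ K.e, v.2) := by
  rw [K.map_sheet i v h0 hv, K.chart.right_inv (K.base_subset hv)]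

theorem map_sheet_mem_source {i : K.ι} {v : ℂ × E} (h0 : v.1 ≠ 0)
    (hv : (v.1 ^ K.e, v.2) ∈ K.base) : f (K.sheet i v) ∈ K.chart.source := by
  rw [K.map_sheet i v h0 hv]
  exact K.chart.map_target (K.base_subset hv)

theorem eventually_mem_base {b : ℂ × E} (hb : (b.1 ^ K.e, b.2) ∈ K.base) :
    ∀ᶠ v in 𝓝 b, (v.1 ^ K.e, v.2) ∈ K.base :=
  ContinuousAt.eventually_mem (f := fun v : ℂ × E => (v.1 ^ K.e, v.2)) (by fun_prop)
    (K.isOpen_base.mem_nhds hb)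

theorem zero_pow_mem_base {x : X} {b : E} (hx : K.chart x = (0, b)) (hb : K.chart x ∈ K.base) :
    (((0 : ℂ), b).1 ^ K.e, ((0 : ℂ), b).2) ∈ K.base := by
  simpa [K.e_pos.ne', ← hx] using hb

/-- The neighbourhoods of a fibre over a point of `D`. -/
theorem comap_nhds {x : X} (hx : x ∈ K.chart.source) {b : E} (hxb : K.chart x = (0, b))
    (hb : K.chart x ∈ K.base) :
    comap f (𝓝 x) = ⨆ i, map (K.sheet i) (𝓝[{v | v.1 ≠ 0}] ((0 : ℂ), b)) := by
  have hxb' : K.chart.symm (0, b) = x := by rw [← hxb, K.chart.left_inv hx]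
  have hb0 := K.zero_pow_mem_base hxb hb
  apply le_antisymm
  · intro s hs
    rw [mem_iSup] at hs
    have hs' : ∀ᶠ v in 𝓝 ((0 : ℂ), b), ∀ i, v.1 ≠ 0 → K.sheet i v ∈ s := by
      rw [eventually_all]
      exact fun i => eventually_nhdsWithin_iff.1 (hs i)
    obtain ⟨δ, hδ, hball⟩ := Metric.eventually_nhds_iff_ball.1 hs'
    refine eventually_comap.2 ?_
    have hc : ContinuousAt K.chart x := K.chart.continuousAt hx
    -- Radius `δ ^ e` downstairs corresponds to radius `δ` in the coordinate `v.1` of the sheets.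
    have hδe : {z : ℂ × E | ‖z.1‖ < δ ^ K.e ∧ ‖z.2 - b‖ < δ} ∈ 𝓝 (K.chart x) := by
      refine IsOpen.mem_nhds ?_ ?_
      · exact (isOpen_lt (f := fun z : ℂ × E => ‖z.1‖) (by fun_prop) continuous_const).inter
          (isOpen_lt (f := fun z : ℂ × E => ‖z.2 - b‖) (by fun_prop) continuous_const)
      · rw [hxb]
        exact ⟨by simpa using pow_pos hδ _, by simpa using hδ⟩
    filter_upwards [K.chart.open_source.mem_nhds hx, hc.eventually_mem (K.isOpen_base.mem_nhds hb),
      hc.eventually_mem hδe] with z hz hzb hzδ m hm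
    subst hm
    obtain ⟨i, v, h0, hv, rfl⟩ := K.exists_sheet m hz hzb
    rw [K.chart_map_sheet h0 hv] at hzδ
    refine hball v ?_ i h0
    rw [Metric.mem_ball, Prod.dist_eq, dist_zero_right, dist_eq_norm]
    refine max_lt (lt_of_pow_lt_pow_left₀ K.e hδ.le ?_) hzδ.2
    simpa using hzδ.1
  · rw [iSup_le_iff]
    intro i
    rw [← tendsto_iff_comap, tendsto_map'_iff]
    have h1 : Tendsto (fun v : ℂ × E => K.chart.symm (v.1 ^ K.e, v.2)) (𝓝 ((0 : ℂ), b)) (𝓝 x) := by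
      have h2 : ContinuousAt K.chart.symm (((0 : ℂ), b).1 ^ K.e, ((0 : ℂ), b).2) :=
        K.chart.symm.continuousAt (K.base_subset hb0)
      have h3 := ContinuousAt.comp (f := fun v : ℂ × E => (v.1 ^ K.e, v.2)) h2 (by fun_prop)
      simpa [ContinuousAt, K.e_pos.ne', hxb', Function.comp_def] using h3
    refine (h1.mono_left nhdsWithin_le_nhds).congr' ?_
    rw [EventuallyEq, eventually_nhdsWithin_iff]
    filter_upwards [K.eventually_mem_base hb0] with v hv h0
    exact (K.map_sheet i v h0 hv).symm

theorem eventually_comap_iff {x : X} (hx : x ∈ K.chart.source) {b : E}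
    (hxb : K.chart x = (0, b)) (hb : K.chart x ∈ K.base) {Q : M → Prop} :
    (∀ᶠ m in comap f (𝓝 x), Q m) ↔
      ∀ i, ∀ᶠ v in 𝓝[{v | v.1 ≠ 0}] ((0 : ℂ), b), Q (K.sheet i v) := by
  rw [K.comap_nhds hx hxb hb, eventually_iSup]
  rfl

/-! ### Integrality of bounded holomorphic functions -/

instance : NeZero K.e := ⟨K.e_pos.ne'⟩

instance : Fintype (K.ι × rootsOfUnity K.e ℂ) :=
  haveI : Fintype (rootsOfUnity K.e ℂ) := Fintype.ofFinite _
  inferInstance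

/-- The values of a function at the points of the fibre that contains the points `sheet i v`. -/
def values (h : M → ℂ) (v : ℂ × E) (j : K.ι × rootsOfUnity K.e ℂ) : ℂ :=
  h (K.sheet j.1 (((j.2 : ℂˣ) : ℂ) * v.1, v.2))

/-- The monic polynomial whose roots are the values of a function along a fibre. -/
def fiberPoly (h : M → ℂ) (v : ℂ × E) : Polynomial ℂ :=
  ∏ j, (Polynomial.X - Polynomial.C (K.values h v j))

/-- Two points of the Kummer covering over the same point differ by a root of unity, and
multiplication by it permutes the factors. -/
theorem fiberPoly_congr (h : M → ℂ) {v v' : ℂ × E} (h0 : v.1 ≠ 0) (h1 : v.1 ^ K.e = v'.1 ^ K.e)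
    (h2 : v.2 = v'.2) : K.fiberPoly h v = K.fiberPoly h v' := by
  have h0' : v'.1 ≠ 0 := fun h => h0 (by
    rw [h, zero_pow K.e_pos.ne'] at h1
    exact pow_eq_zero_iff K.e_pos.ne' |>.1 h1)
  have hη : (v.1 / v'.1) ^ K.e = 1 := by
    rw [div_pow, h1, div_self (pow_ne_zero _ h0')]
  let η : rootsOfUnity K.e ℂ := rootsOfUnity.mkOfPowEq (v.1 / v'.1) hη
  have hη' : ((η : ℂˣ) : ℂ) = v.1 / v'.1 := rfl
  refine Fintype.prod_equiv ((Equiv.refl _).prodCongr (Equiv.mulRight η)) _ _ fun j => ?_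
  congr 2
  simp only [values, Equiv.prodCongr_apply, Equiv.coe_refl, Equiv.coe_mulRight, Prod.map_fst,
    Prod.map_snd, id_eq, Subgroup.coe_mul, Units.val_mul, hη', h2]
  congr 3
  field_simp

/-- A point of the Kummer covering over a point of the base. -/
def root (z : ℂ × E) : ℂ × E := (z.1 ^ ((K.e : ℂ)⁻¹), z.2)

theorem root_fst_pow (z : ℂ × E) : (K.root z).1 ^ K.e = z.1 :=
  Complex.cpow_nat_inv_pow _ K.e_pos.ne'

theorem root_fst_ne_zero {z : ℂ × E} (hz : z.1 ≠ 0) : (K.root z).1 ≠ 0 := fun h => hz (by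
  rw [← K.root_fst_pow z, h, zero_pow K.e_pos.ne'])

/-- A local analytic branch of the inverse of the Kummer covering. -/
def branch (z₀ : ℂ × E) (v₀ : ℂ × E) (z : ℂ × E) : ℂ × E :=
  (v₀.1 * Complex.exp (Complex.log (z.1 / z₀.1) / K.e), z.2)

theorem branch_self {z₀ v₀ : ℂ × E} (hz : z₀.1 ≠ 0) (h : v₀.2 = z₀.2) :
    K.branch z₀ v₀ z₀ = v₀ := by
  ext <;> simp [branch, hz, h]

theorem branch_fst_pow {z₀ v₀ : ℂ × E} (hz : z₀.1 ≠ 0) (h : v₀.1 ^ K.e = z₀.1) {z : ℂ × E}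
    (h0 : z.1 ≠ 0) : (K.branch z₀ v₀ z).1 ^ K.e = z.1 := by
  have he : (K.e : ℂ) ≠ 0 := by exact_mod_cast K.e_pos.ne'
  rw [branch, mul_pow, h, ← Complex.exp_nat_mul, mul_div_cancel₀ _ he,
    Complex.exp_log (div_ne_zero h0 hz), mul_div_cancel₀ _ hz]

theorem analyticAt_branch {z₀ v₀ : ℂ × E} (hz : z₀.1 ≠ 0) :
    AnalyticAt ℂ (K.branch z₀ v₀) z₀ := by
  refine AnalyticAt.prod (analyticAt_const.mul (AnalyticAt.cexp (AnalyticAt.div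
    (AnalyticAt.clog (analyticAt_fst.div analyticAt_const hz) ?_) analyticAt_const ?_)))
    analyticAt_snd
  · simp [hz]
  · exact_mod_cast K.e_pos.ne'

/-- The principal root `root` jumps along a cut. Since `fiberPoly` depends only on the fibre, it may
be replaced near `z` by the analytic branch through `root z`. -/
theorem analyticAt_coeff_fiberPoly {h : M → ℂ} {z : ℂ × E} (hz : z ∈ K.base) (h0 : z.1 ≠ 0)
    (hh : ∀ m, f m = K.chart.symm z → HolAt h m) (n : ℕ) :
    AnalyticAt ℂ (fun z => (K.fiberPoly h (K.root z)).coeff n) z := by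
  have hr0 := K.root_fst_ne_zero h0
  have hrp := K.root_fst_pow z
  have hself : K.branch z (K.root z) z = K.root z := K.branch_self h0 rfl
  have h1 : AnalyticAt ℂ (fun z' => (K.fiberPoly h (K.branch z (K.root z) z')).coeff n) z := by
    refine AnalyticAt.comp (g := fun a : K.ι × rootsOfUnity K.e ℂ → ℂ =>
      (∏ j, (Polynomial.X - Polynomial.C (a j))).coeff n)
      (f := fun z' => K.values h (K.branch z (K.root z) z'))
      (analyticAt_coeff_prod_X_sub_C _ n _) ?_
    rw [analyticAt_pi_iff]
    rintro ⟨i, ζ⟩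
    have hζ : ((ζ : ℂˣ) : ℂ) ^ K.e = 1 := by
      have := ζ.2
      rw [mem_rootsOfUnity'] at this
      exact this
    have hpow : (((ζ : ℂˣ) : ℂ) * (K.root z).1) ^ K.e = z.1 := by rw [mul_pow, hζ, hrp, one_mul]
    have hne : ((ζ : ℂˣ) : ℂ) * (K.root z).1 ≠ 0 := mul_ne_zero (Units.ne_zero _) hr0
    have hb : ((((ζ : ℂˣ) : ℂ) * (K.root z).1, z.2).1 ^ K.e,
      (((ζ : ℂˣ) : ℂ) * (K.root z).1, z.2).2) ∈ K.base := by simpa [hpow] using hz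
    have h2 := (K.holAt_sheet i (((ζ : ℂˣ) : ℂ) * (K.root z).1, z.2) hne hb h).1
      (hh _ (by rw [K.map_sheet i _ hne hb]; simp [hpow]))
    refine AnalyticAt.comp_of_eq (f := fun z' => (((ζ : ℂˣ) : ℂ) * (K.branch z (K.root z) z').1,
      (K.branch z (K.root z) z').2)) h2 ?_ ?_
    · exact AnalyticAt.prod (analyticAt_const.mul (analyticAt_fst.comp (K.analyticAt_branch h0)))
        (analyticAt_snd.comp (K.analyticAt_branch h0))
    · rw [hself]
      rfl
  refine h1.congr ?_
  filter_upwards [(isOpen_ne_fun continuous_fst continuous_const).mem_nhds h0] with z' hz'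
  have h3 : (K.branch z (K.root z) z').1 ^ K.e = z'.1 := K.branch_fst_pow h0 hrp hz'
  have h4 : (K.branch z (K.root z) z').1 ≠ 0 := fun h4 => by
    rw [h4, zero_pow K.e_pos.ne'] at h3
    exact hz' h3.symm
  have h5 : (K.branch z (K.root z) z').1 ^ K.e = (K.root z').1 ^ K.e := by
    rw [h3, K.root_fst_pow]
  exact congrArg (fun p => Polynomial.coeff p n) (K.fiberPoly_congr h h4 h5 rfl)

theorem norm_values_le {h : M → ℂ} {z : ℂ × E} (hz : z ∈ K.base) (h0 : z.1 ≠ 0) {C : ℝ}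
    (hC : ∀ m, f m = K.chart.symm z → ‖h m‖ ≤ C) (j) : ‖K.values h (K.root z) j‖ ≤ C := by
  obtain ⟨i, ζ⟩ := j
  have hζ : ((ζ : ℂˣ) : ℂ) ^ K.e = 1 := by
    have := ζ.2
    rw [mem_rootsOfUnity'] at this
    exact this
  have hpow : (((ζ : ℂˣ) : ℂ) * (K.root z).1) ^ K.e = z.1 := by
    rw [mul_pow, hζ, K.root_fst_pow, one_mul]
  have hne : ((ζ : ℂˣ) : ℂ) * (K.root z).1 ≠ 0 :=
    mul_ne_zero (Units.ne_zero _) (K.root_fst_ne_zero h0)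
  have hb : ((((ζ : ℂˣ) : ℂ) * (K.root z).1, z.2).1 ^ K.e,
    (((ζ : ℂˣ) : ℂ) * (K.root z).1, z.2).2) ∈ K.base := by simpa [hpow] using hz
  refine hC _ ?_
  rw [K.map_sheet i (((ζ : ℂˣ) : ℂ) * (K.root z).1, (K.root z).2) hne hb]
  simp only [hpow]
  rfl

theorem pow_add_sum_coeff_fiberPoly (h : M → ℂ) {i : K.ι} {v : ℂ × E} (h0 : v.1 ≠ 0) :
    h (K.sheet i v) ^ Fintype.card (K.ι × rootsOfUnity K.e ℂ) +
      ∑ j ∈ Finset.range (Fintype.card (K.ι × rootsOfUnity K.e ℂ)),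
        (K.fiberPoly h (K.root (v.1 ^ K.e, v.2))).coeff j * h (K.sheet i v) ^ j = 0 := by
  have h1 : K.fiberPoly h (K.root (v.1 ^ K.e, v.2)) = K.fiberPoly h v :=
    (K.fiberPoly_congr h h0 (K.root_fst_pow (v.1 ^ K.e, v.2)).symm rfl).symm
  have hm : (K.fiberPoly h v).Monic := Polynomial.monic_prod_of_monic _ _ fun j _ =>
    Polynomial.monic_X_sub_C _
  have hd : (K.fiberPoly h v).natDegree = Fintype.card (K.ι × rootsOfUnity K.e ℂ) := by
    rw [fiberPoly, Polynomial.natDegree_prod_of_monic _ _ fun j _ => Polynomial.monic_X_sub_C _]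
    simp
  have he : (K.fiberPoly h v).eval (h (K.sheet i v)) = 0 := by
    rw [fiberPoly, Polynomial.eval_prod]
    refine Finset.prod_eq_zero (Finset.mem_univ (i, 1)) ?_
    simp [values]
  rw [hm.as_sum, hd] at he
  rw [h1]
  simpa [Polynomial.eval_finsetSum] using he

/-- A bounded holomorphic function on the covering satisfies a monic equation with holomorphic
coefficients; these vanish at a point towards which the function tends to zero. -/
theorem exists_coeff_of_bounded {x : X} (hx : x ∈ K.chart.source) (hxb : K.chart x ∈ K.base)
    {h : M → ℂ} (hh : ∀ᶠ m in comap f (𝓝 x), HolAt h m)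
    (hb : ∃ C, ∀ᶠ m in comap f (𝓝 x), ‖h m‖ ≤ C) :
    ∃ (N : ℕ) (c : ℕ → X → ℂ), (∀ j, HolAt (c j) x) ∧
      (∀ᶠ m in comap f (𝓝 x), h m ^ N + ∑ j ∈ Finset.range N, c j (f m) * h m ^ j = 0) ∧
      (Tendsto h (comap f (𝓝 x)) (𝓝 0) → ∀ j < N, c j x = 0) := by
  set b := K.chart x with hbdef
  have hxb' : K.chart.symm b = x := K.chart.left_inv hx
  have hbt := K.base_subset hxb
  have hsymm : ContinuousAt K.chart.symm b := K.chart.symm.continuousAt hbt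
  have key {Q : M → Prop} (hQ : ∀ᶠ m in comap f (𝓝 x), Q m) :
      ∀ᶠ z in 𝓝 b, ∀ m, f m = K.chart.symm z → Q m := by
    rw [eventually_comap] at hQ
    rw [← hxb'] at hQ
    exact hsymm.eventually hQ
  obtain ⟨C, hC⟩ := hb
  have hbase : ∀ᶠ z in 𝓝 b, z ∈ K.base := K.isOpen_base.mem_nhds hxb
  let c₀ (j : ℕ) (z : ℂ × E) : ℂ := (K.fiberPoly h (K.root z)).coeff j
  have hana (j : ℕ) : ∀ᶠ z in 𝓝 b, z.1 ≠ 0 → AnalyticAt ℂ (c₀ j) z := by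
    filter_upwards [key hh, hbase] with z h1 h2 h0
    exact K.analyticAt_coeff_fiberPoly h2 h0 h1 j
  have hbdd (j : ℕ) : ∃ B, ∀ᶠ z in 𝓝 b, z.1 ≠ 0 → ‖c₀ j z‖ ≤ B := by
    have hcont : Continuous fun a : K.ι × rootsOfUnity K.e ℂ → ℂ =>
        (∏ j, (Polynomial.X - Polynomial.C (a j))).coeff j :=
      continuous_iff_continuousAt.2 fun a => (analyticAt_coeff_prod_X_sub_C _ j a).continuousAt
    -- The tuple of values stays in a compact polydisc of radius `C`, on which the coefficient map
    -- is bounded.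
    obtain ⟨B, hB⟩ := ((isCompact_univ_pi fun _ : K.ι × rootsOfUnity K.e ℂ =>
      isCompact_closedBall (0 : ℂ) C).image hcont).isBounded.exists_norm_le
    refine ⟨B, ?_⟩
    filter_upwards [key hC, hbase] with z h1 h2 h0
    refine hB _ ⟨K.values h (K.root z), ?_, rfl⟩
    intro j _
    simpa using K.norm_values_le h2 h0 h1 j
  have hext (j : ℕ) : ∃ G : ℂ × E → ℂ, AnalyticAt ℂ G b ∧
      ∀ᶠ z in 𝓝 b, z.1 ≠ 0 → G z = c₀ j z := by
    -- Riemann's theorem is needed only on the hyperplane; elsewhere the coefficient is already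
    -- analytic.
    by_cases h0 : b.1 = 0
    · have hb0 : b = (0, b.2) := Prod.ext h0 rfl
      obtain ⟨B, hB⟩ := hbdd j
      have := hana j
      rw [hb0] at this hB ⊢
      exact exists_analyticAt_of_bounded this hB
    · exact ⟨c₀ j, (hana j).self_of_nhds h0, .of_forall fun z _ => rfl⟩
  choose G hG hGc using hext
  refine ⟨Fintype.card (K.ι × rootsOfUnity K.e ℂ), fun j => G j ∘ K.chart, fun j => ?_, ?_,
    fun ht j hj => ?_⟩
  · rw [K.holAt_iff x hx]
    refine (hG j).congr ?_
    filter_upwards [K.chart.open_target.mem_nhds hbt] with z hz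
    simp [K.chart.right_inv hz]
  · have hGall : ∀ᶠ z in 𝓝 b, ∀ j ∈ Finset.range (Fintype.card (K.ι × rootsOfUnity K.e ℂ)),
        z.1 ≠ 0 → G j z = c₀ j z :=
      (Finset.eventually_all _).2 fun j _ => hGc j
    have hchart : ContinuousAt K.chart x := K.chart.continuousAt hx
    refine eventually_comap.2 ?_
    filter_upwards [K.chart.open_source.mem_nhds hx, hchart.eventually hbase,
      hchart.eventually hGall] with y hy hyb hyG m hm
    subst hm
    obtain ⟨i, v, h0, hv, rfl⟩ := K.exists_sheet m hy hyb
    rw [K.chart_map_sheet h0 hv] at hyG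
    rw [← K.pow_add_sum_coeff_fiberPoly h (i := i) h0]
    congr 1
    refine Finset.sum_congr rfl fun j hj => ?_
    congr 1
    simp only [Function.comp_apply, K.chart_map_sheet h0 hv]
    exact hyG j hj (pow_ne_zero _ h0)
  -- If `h` tends to zero, all roots do, so the polynomials tend to `X ^ N` and each lower
  -- coefficient has limit zero. Points off the hyperplane accumulate at `b`, so this limit is the
  -- value.
  · have hne := neBot_nhdsWithin_fst_ne_zero b
    have h1 : Tendsto (G j) (𝓝[{v | v.1 ≠ 0}] b) (𝓝 (G j b)) :=
      (hG j).continuousAt.tendsto.mono_left nhdsWithin_le_nhds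
    have h2 : Tendsto (fun z => K.values h (K.root z)) (𝓝[{v | v.1 ≠ 0}] b) (𝓝 0) := by
      rw [tendsto_pi_nhds]
      intro k
      rw [Metric.tendsto_nhds]
      intro ε hε
      have h3 : ∀ᶠ m in comap f (𝓝 x), ‖h m‖ ≤ ε / 2 := by
        filter_upwards [ht.eventually (Metric.ball_mem_nhds 0 (half_pos hε))] with m hm
        exact (by simpa using hm : ‖h m‖ < ε / 2).le
      rw [eventually_nhdsWithin_iff]
      filter_upwards [key h3, hbase] with z h4 h5 h0
      rw [Pi.zero_apply, dist_zero_right]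
      exact (K.norm_values_le h5 h0 h4 k).trans_lt (half_lt_self hε)
    have h3 := (analyticAt_coeff_prod_X_sub_C Finset.univ j
      (0 : K.ι × rootsOfUnity K.e ℂ → ℂ)).continuousAt.tendsto.comp h2
    have h4 : Tendsto (G j) (𝓝[{v | v.1 ≠ 0}] b) (𝓝 0) := by
      have h5 : (∏ k, (Polynomial.X - Polynomial.C
          ((0 : K.ι × rootsOfUnity K.e ℂ → ℂ) k))).coeff j = 0 := by
        simp [Polynomial.coeff_X_pow]
        simpa using hj.ne
      rw [h5] at h3
      refine h3.congr' ?_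
      rw [EventuallyEq, eventually_nhdsWithin_iff]
      filter_upwards [hGc j] with z hz h0
      exact (hz h0).symm
    simpa using tendsto_nhds_unique h1 h4

end KummerModel

/-! ### Integral equations of germs along a fibre -/

section IntegralEquations

set_option linter.unusedSectionVars false

variable {X : Type u} {M : Type v} [TopologicalSpace X] [HolStructure X]
    [TopologicalSpace M] [HolStructure M] {f : M → X}

theorem germ_pow_add_sum_eq_zero_iff {M : Type*} {l : Filter M} {h : M → ℂ} {N : ℕ} {c : ℕ → M → ℂ} :
    ((h : Germ l ℂ) ^ N + ∑ j ∈ Finset.range N, (c j : Germ l ℂ) * (h : Germ l ℂ) ^ j = 0) ↔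
      ∀ᶠ m in l, h m ^ N + ∑ j ∈ Finset.range N, c j m * h m ^ j = 0 := by
  have h1 : (h : Germ l ℂ) ^ N + ∑ j ∈ Finset.range N, (c j : Germ l ℂ) * (h : Germ l ℂ) ^ j =
      ((h ^ N + ∑ j ∈ Finset.range N, c j * h ^ j : M → ℂ) : Germ l ℂ) := by
    have := map_add (Germ.coeRingHom l (R := ℂ)) (h ^ N) (∑ j ∈ Finset.range N, c j * h ^ j)
    simp only [map_pow, map_sum, map_mul] at this
    exact this.symm
  rw [h1]
  have h2 := Germ.coe_eq (l := l) (f := (h ^ N + ∑ j ∈ Finset.range N, c j * h ^ j : M → ℂ))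
    (g := 0)
  refine h2.trans ?_
  simp [EventuallyEq]

theorem isIntegralElem_of_eventually {x : X} {h : M → ℂ} {N : ℕ} {c : ℕ → X → ℂ}
    (hc : ∀ j, HolAt (c j) x)
    (heq : ∀ᶠ m in comap f (𝓝 x), h m ^ N + ∑ j ∈ Finset.range N, c j (f m) * h m ^ j = 0) :
    ((germComp f (tendsto_comap (x := 𝓝 x))).comp (holStalk x).subtype).IsIntegralElem
      (h : Germ (comap f (𝓝 x)) ℂ) := by
  let a (j : ℕ) : holStalk x := ⟨(c j : Germ (𝓝 x) ℂ), c j, hc j, rfl⟩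
  refine ⟨Polynomial.X ^ N + ∑ j ∈ Finset.range N, Polynomial.C (a j) * Polynomial.X ^ j,
    Polynomial.monic_X_pow_add ?_, ?_⟩
  · rw [← Polynomial.mem_degreeLT]
    refine Submodule.sum_mem _ fun j hj => ?_
    rw [Polynomial.mem_degreeLT]
    exact (Polynomial.degree_C_mul_X_pow_le j _).trans_lt (by exact_mod_cast Finset.mem_range.1 hj)
  · simp only [Polynomial.eval₂_add, Polynomial.eval₂_pow, Polynomial.eval₂_X,
      Polynomial.eval₂_finsetSum, Polynomial.eval₂_mul, Polynomial.eval₂_C]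
    exact (germ_pow_add_sum_eq_zero_iff (c := fun j => c j ∘ f)).2 heq

theorem exists_coeff_of_isIntegralElem {x : X} {h : M → ℂ}
    (hi : ((germComp f (tendsto_comap (x := 𝓝 x))).comp (holStalk x).subtype).IsIntegralElem
      (h : Germ (comap f (𝓝 x)) ℂ)) :
    ∃ (N : ℕ) (c : ℕ → X → ℂ), (∀ j, HolAt (c j) x) ∧
      ∀ᶠ m in comap f (𝓝 x), h m ^ N + ∑ j ∈ Finset.range N, c j (f m) * h m ^ j = 0 := by
  obtain ⟨p, hp, he⟩ := hi
  choose c hc hpc using fun j => (p.coeff j).2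
  refine ⟨p.natDegree, c, hc, ?_⟩
  rw [hp.as_sum] at he
  simp only [Polynomial.eval₂_add, Polynomial.eval₂_pow, Polynomial.eval₂_X,
      Polynomial.eval₂_finsetSum, Polynomial.eval₂_mul, Polynomial.eval₂_C] at he
  refine (germ_pow_add_sum_eq_zero_iff (c := fun j => c j ∘ f)).1 ?_
  rw [← he]
  congr 1
  refine Finset.sum_congr rfl fun j _ => ?_
  congr 1
  change _ = germComp f tendsto_comap (p.coeff j : Germ (𝓝 x) ℂ)
  rw [hpc j]
  rfl

/-- Applying the character to the integral equation kills all lower terms and leaves a vanishing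
`N`-th power in `ℂ`. -/
theorem Normalization.char_eq_zero (hf : IsHolMap f) {y : Normalization f} {h : M → ℂ}
    (hy : IsIntegralAt f h y.pt) {N : ℕ} {c : ℕ → X → ℂ} (hc : ∀ j, HolAt (c j) y.pt)
    (heq : ∀ᶠ m in comap f (𝓝 y.pt), h m ^ N + ∑ j ∈ Finset.range N, c j (f m) * h m ^ j = 0)
    (h0 : ∀ j < N, c j y.pt = 0) : y.char ⟨_, hy⟩ = 0 := by
  let a (j : ℕ) : integralStalk f y.pt :=
    ⟨((c j ∘ f : M → ℂ) : Germ (comap f (𝓝 y.pt)) ℂ), isIntegralAt_comp hf (hc j)⟩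
  have h1 : (⟨_, hy⟩ : integralStalk f y.pt) ^ N +
      ∑ j ∈ Finset.range N, a j * (⟨_, hy⟩ : integralStalk f y.pt) ^ j = 0 := by
    apply Subtype.ext
    have := (germ_pow_add_sum_eq_zero_iff (c := fun j => c j ∘ f)).2 heq
    push_cast
    exact this
  have h2 := congrArg y.char h1
  rw [map_add, map_sum, map_zero, Finset.sum_eq_zero, add_zero, map_pow] at h2
  · exact eq_zero_of_pow_eq_zero h2
  · intro j hj
    rw [map_mul, y.char_comp (c j) (hc j) _, h0 j (Finset.mem_range.1 hj), zero_mul]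

/-- Cauchy's bound for the roots of a monic polynomial: if `‖z‖ > 1`, the leading power is compared
with `N` terms of size at most `|B| * ‖z‖ ^ (N - 1)`. -/
theorem norm_le_of_pow_add_sum_eq_zero {N : ℕ} {c : ℕ → ℂ} {z : ℂ} {B : ℝ}
    (hB : ∀ j < N, ‖c j‖ ≤ B) (h : z ^ N + ∑ j ∈ Finset.range N, c j * z ^ j = 0) :
    ‖z‖ ≤ 1 + N * |B| := by
  by_cases hz : ‖z‖ ≤ 1
  · nlinarith [mul_nonneg (Nat.cast_nonneg (α := ℝ) N) (abs_nonneg B)]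
  push Not at hz
  rcases N with _ | N
  · simp at h
  have h1 : ‖z‖ ^ (N + 1) ≤ ∑ j ∈ Finset.range (N + 1), |B| * ‖z‖ ^ N := by
    have h2 : z ^ (N + 1) = -∑ j ∈ Finset.range (N + 1), c j * z ^ j := eq_neg_of_add_eq_zero_left h
    rw [← norm_pow, h2, norm_neg]
    refine (norm_sum_le _ _).trans (Finset.sum_le_sum fun j hj => ?_)
    rw [Finset.mem_range] at hj
    rw [norm_mul, norm_pow]
    refine mul_le_mul ((hB j hj).trans (le_abs_self B)) ?_ (by positivity) (abs_nonneg B)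
    exact pow_le_pow_right₀ hz.le (Nat.lt_succ_iff.1 hj)
  rw [Finset.sum_const, Finset.card_range, nsmul_eq_mul, pow_succ', ← mul_assoc] at h1
  have h3 := le_of_mul_le_mul_right h1 (by positivity)
  linarith

theorem IsIntegralAt.eventually_holAt (hf : IsHolMap f) {h : M → ℂ} {x : X}
    (hh : IsIntegralAt f h x) : ∀ᶠ m in comap f (𝓝 x), HolAt h m := by
  obtain ⟨k, hk, hhol, -⟩ := hh
  have h1 : ∀ᶠ m in comap f (𝓝 x), h m = k m := Germ.coe_eq.1 hk
  rw [eventually_comap] at h1 hhol ⊢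
  filter_upwards [h1.eventually_nhds, hhol] with x' h2 h3 m hm
  subst hm
  refine HolStructure.congr (h3 m rfl) ?_
  filter_upwards [hf.continuous.continuousAt.eventually h2] with m' hm'
  exact (hm' m' rfl).symm

theorem IsIntegralAt.isIntegralElem {h : M → ℂ} {x : X} (hh : IsIntegralAt f h x) :
    ((germComp f (tendsto_comap (x := 𝓝 x))).comp (holStalk x).subtype).IsIntegralElem
      (h : Germ (comap f (𝓝 x)) ℂ) := by
  obtain ⟨k, hk, -, hi⟩ := hh
  exact hi

theorem IsIntegralAt.congr {h k : M → ℂ} {x : X} (hh : IsIntegralAt f h x)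
    (hk : ∀ᶠ m in comap f (𝓝 x), h m = k m) : IsIntegralAt f k x := by
  have : (k : Germ (comap f (𝓝 x)) ℂ) = h := (Germ.coe_eq.2 hk).symm
  rwa [IsIntegralAt, this]

namespace Normalization

theorem eval_of_isIntegralAt {h : M → ℂ} {y : Normalization f} (hy : IsIntegralAt f h y.pt) :
    eval f h y = y.char ⟨_, hy⟩ := dif_pos hy

theorem eval_congr {h k : M → ℂ} {y : Normalization f}
    (hk : ∀ᶠ m in comap f (𝓝 y.pt), h m = k m) : eval f h y = eval f k y := by
  have : (k : Germ (comap f (𝓝 y.pt)) ℂ) = h := (Germ.coe_eq.2 hk).symm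
  by_cases hy : IsIntegralAt f h y.pt
  · rw [eval_of_isIntegralAt hy, eval_of_isIntegralAt (hy.congr hk)]
    congr 1
    exact Subtype.ext this.symm
  · have hy' : ¬ IsIntegralAt f k y.pt := by rwa [IsIntegralAt, this]
    rw [eval, eval, dif_neg hy, dif_neg hy']

theorem eval_comp (hf : IsHolMap f) {g : X → ℂ} {y : Normalization f} (hg : HolAt g y.pt) :
    eval f (g ∘ f) y = g y.pt := by
  rw [eval_of_isIntegralAt (isIntegralAt_comp hf hg)]
  exact y.char_comp g hg _

theorem isIntegralAt_const (c : ℂ) (x : X) : IsIntegralAt f (fun _ => c) x :=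
  ⟨_, rfl, .of_forall fun m => HolStructure.const c m, RingHom.isIntegralElem_map _
    (x := (⟨_, fun _ => c, HolStructure.const c x, rfl⟩ : holStalk x))⟩

theorem eval_const (c : ℂ) (y : Normalization f) : eval f (fun _ => c) y = c := by
  rw [eval_of_isIntegralAt (isIntegralAt_const c y.pt)]
  exact y.char_comp (fun _ => c) (HolStructure.const c _) _

theorem eval_pow {h : M → ℂ} {y : Normalization f} (hy : IsIntegralAt f h y.pt) (n : ℕ) :
    IsIntegralAt f (h ^ n) y.pt ∧ eval f (h ^ n) y = eval f h y ^ n := by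
  have h1 : IsIntegralAt f (h ^ n) y.pt := (integralStalk f y.pt).pow_mem hy n
  refine ⟨h1, ?_⟩
  rw [eval_of_isIntegralAt hy, eval_of_isIntegralAt h1, ← map_pow]
  rfl

theorem continuousAt_eval {h : M → ℂ} {y : Normalization f}
    (hh : ∀ᶠ x in 𝓝 y.pt, IsIntegralAt f h x) : ContinuousAt (eval f h) y := by
  obtain ⟨U, hU, hUo, hyU⟩ := eventually_nhds_iff.1 hh
  refine tendsto_def.2 fun W hW => ?_
  obtain ⟨W', hW', hWo, hyW⟩ := mem_nhds_iff.1 hW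
  refine mem_of_superset (IsOpen.mem_nhds (s := {z | z.pt ∈ U ∧ eval f h z ∈ W'}) ?_ ⟨hyU, hyW⟩)
    fun z hz => hW' hz.2
  exact TopologicalSpace.isOpen_generateFrom_of_mem ⟨U, h, W', hUo, hWo, hU, rfl⟩

theorem holAt_eval {h : M → ℂ} {y : Normalization f}
    (hh : ∀ᶠ x in 𝓝 y.pt, IsIntegralAt f h x) : HolAt (eval f h) y :=
  ⟨h, hh, EventuallyEq.rfl⟩

end Normalization

end IntegralEquations

theorem eventually_comap_nhds_nhds {X : Type*} {M : Type*} [TopologicalSpace X] {f : M → X}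
    {x : X} {Q : M → Prop} (h : ∀ᶠ m in Filter.comap f (𝓝 x), Q m) :
    ∀ᶠ x' in 𝓝 x, ∀ᶠ m in comap f (𝓝 x'), Q m := by
  simp only [eventually_comap] at h ⊢
  exact eventually_eventually_nhds.2 h

/-! ### Points of the normalization as limits along filters. -/

section Points

variable {X : Type u} {M : Type v} [TopologicalSpace X] [HolStructure X]
    [TopologicalSpace M] [HolStructure M] {f : M → X}

namespace Normalization

/-- A filter along which all integral functions have a limit defines a point of the
normalization. -/
theorem exists_pt_of_tendsto {x : X} (l : Filter M) [l.NeBot] (hl : l ≤ comap f (𝓝 x))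
    (hc : ∀ g : X → ℂ, HolAt g x → ContinuousAt g x)
    (hlim : ∀ h : M → ℂ, IsIntegralAt f h x → ∃ c, Tendsto h l (𝓝 c)) :
    ∃ y : Normalization f, y.pt = x ∧
      ∀ (h : M → ℂ) (c : ℂ), IsIntegralAt f h x → Tendsto h l (𝓝 c) → eval f h y = c := by
  have h1 (a : integralStalk f x) : ∃ c, ∀ h : M → ℂ,
      (a : Germ (comap f (𝓝 x)) ℂ) = h → Tendsto h l (𝓝 c) := by
    obtain ⟨a, h, rfl, hh⟩ := a
    obtain ⟨c, hc⟩ := hlim h ⟨h, rfl, hh⟩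
    refine ⟨c, fun k hk => hc.congr' ?_⟩
    exact hl (Germ.coe_eq.1 hk)
  choose L hL using h1
  have huniq (a : integralStalk f x) (h : M → ℂ) (c : ℂ)
      (hah : (a : Germ (comap f (𝓝 x)) ℂ) = h) (hc : Tendsto h l (𝓝 c)) : L a = c :=
    tendsto_nhds_unique (hL a h hah) hc
  let χ : integralStalk f x →+* ℂ :=
    { toFun := L
      map_one' := huniq 1 (fun _ => 1) 1 rfl tendsto_const_nhds
      map_zero' := huniq 0 (fun _ => 0) 0 rfl tendsto_const_nhds
      map_mul' := by
        intro a b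
        obtain ⟨h, hh, -⟩ := a.2
        obtain ⟨k, hk, -⟩ := b.2
        exact huniq _ (h * k) _ (by rw [Subring.coe_mul, hh, hk]; rfl)
          ((hL a h hh).mul (hL b k hk))
      map_add' := by
        intro a b
        obtain ⟨h, hh, -⟩ := a.2
        obtain ⟨k, hk, -⟩ := b.2
        exact huniq _ (h + k) _ (by rw [Subring.coe_add, hh, hk]; rfl)
          ((hL a h hh).add (hL b k hk)) }
  refine ⟨⟨x, χ, fun g hg hi => huniq _ (g ∘ f) _ rfl ?_⟩, rfl, fun h c hh hc => ?_⟩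
  · exact (hc g hg).tendsto.comp (tendsto_comap.mono_left hl)
  · rw [eval_of_isIntegralAt hh]
    exact huniq _ h c rfl hc

theorem tendsto_nhds_of_eval {α : Type*} {l : Filter α} {Θ : α → Normalization f}
    {y : Normalization f} (hpt : Tendsto (fun a => (Θ a).pt) l (𝓝 y.pt))
    (heval : ∀ h : M → ℂ, (∀ᶠ x in 𝓝 y.pt, IsIntegralAt f h x) →
      Tendsto (fun a => eval f h (Θ a)) l (𝓝 (eval f h y))) : Tendsto Θ l (𝓝 y) := by
  refine TopologicalSpace.tendsto_nhds_generateFrom_iff.2 ?_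
  rintro _ ⟨U, h, W, hU, hW, hh, rfl⟩ ⟨hy1, hy2⟩
  filter_upwards [hpt.eventually (hU.mem_nhds hy1),
    (heval h (mem_of_superset (hU.mem_nhds hy1) hh)).eventually (hW.mem_nhds hy2)] with a h1 h2
  exact ⟨h1, h2⟩

end Normalization

end Points

/-! ### Integral functions and points of the normalization in a Kummer model. -/

namespace KummerModel

open Normalization

variable {X : Type u} {M : Type v} [TopologicalSpace X] [HolStructure X]
    [TopologicalSpace M] [HolStructure M] {D : Set X} {f : M → X}
    {E : Type} [NormedAddCommGroup E] [NormedSpace ℂ E] (K : KummerModel.{u, v, w} D f E)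

theorem continuousAt_of_holAt {x : X} (hx : x ∈ K.chart.source) {g : X → ℂ} (hg : HolAt g x) :
    ContinuousAt g x := by
  have h1 := ((K.holAt_iff x hx g).1 hg).continuousAt.comp (K.chart.continuousAt hx)
  refine h1.congr ?_
  filter_upwards [K.chart.open_source.mem_nhds hx] with z hz
  simp [K.chart.left_inv hz]

/-- With its converse `exists_bound_of_isIntegralAt`, this identifies integral functions with
bounded holomorphic functions near the fibre. Boundedness can be tested sheet by sheet. -/
theorem isIntegralAt_of_bounded {x : X} (hx : x ∈ K.chart.source)
    (hxb : K.chart x ∈ K.base)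
    {h : M → ℂ} (hh : ∀ᶠ m in comap f (𝓝 x), HolAt h m)
    (hb : ∃ C, ∀ᶠ m in comap f (𝓝 x), ‖h m‖ ≤ C) : IsIntegralAt f h x := by
  obtain ⟨N, c, hc, heq, -⟩ := K.exists_coeff_of_bounded hx hxb hh hb
  exact ⟨h, rfl, hh, isIntegralElem_of_eventually hc heq⟩

theorem exists_bound_of_isIntegralAt {x : X} (hx : x ∈ K.chart.source) {h : M → ℂ}
    (hh : IsIntegralAt f h x) : ∃ C, ∀ᶠ m in comap f (𝓝 x), ‖h m‖ ≤ C := by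
  obtain ⟨N, c, hc, heq⟩ := exists_coeff_of_isIntegralElem hh.isIntegralElem
  let B : ℝ := ∑ j ∈ Finset.range N, (‖c j x‖ + 1)
  refine ⟨1 + N * |B|, ?_⟩
  have h1 : ∀ᶠ x' in 𝓝 x, ∀ j ∈ Finset.range N, ‖c j x'‖ ≤ B := by
    rw [Finset.eventually_all]
    intro j hj
    have h2 : ∀ᶠ x' in 𝓝 x, ‖c j x'‖ < ‖c j x‖ + 1 :=
      (K.continuousAt_of_holAt hx (hc j)).norm.eventually_lt continuousAt_const (lt_add_one _)
    filter_upwards [h2] with x' h3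
    refine h3.le.trans ?_
    exact Finset.single_le_sum (f := fun j => ‖c j x‖ + 1) (fun j _ => by positivity) hj
  filter_upwards [heq, tendsto_comap.eventually h1] with m h2 h3
  exact norm_le_of_pow_add_sum_eq_zero (c := fun j => c j (f m))
    (fun j hj => h3 j (Finset.mem_range.2 hj)) h2

/-- A character is not known in advance to be a limit of evaluations at points of `M`. The integral
equation, whose lower coefficients vanish at the base point, still forces its value. -/
theorem eval_eq_zero_of_tendsto (hf : IsHolMap f) {y : Normalization f}
    (hx : y.pt ∈ K.chart.source) (hxb : K.chart y.pt ∈ K.base) {h : M → ℂ}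
    (hh : IsIntegralAt f h y.pt)
    (h0 : Tendsto h (comap f (𝓝 y.pt)) (𝓝 0)) : eval f h y = 0 := by
  obtain ⟨N, c, hc, heq, hc0⟩ := K.exists_coeff_of_bounded hx hxb (hh.eventually_holAt hf)
    (K.exists_bound_of_isIntegralAt hx hh)
  rw [eval_of_isIntegralAt hh]
  exact char_eq_zero hf hh hc heq (hc0 h0)

theorem eventually_sheet_mem {v : ℂ × E} (h0 : v.1 ≠ 0) (hv : (v.1 ^ K.e, v.2) ∈ K.base) :
    ∀ᶠ v' in 𝓝 v, v'.1 ≠ 0 ∧ (v'.1 ^ K.e, v'.2) ∈ K.base :=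
  ((isOpen_ne_fun continuous_fst continuous_const).eventually_mem h0).and
    (K.eventually_mem_base hv)

/-- The points near the centre of a sheet lie over the domain of the model. -/
theorem eventually_nhdsWithin_mem {x : X} {b : E} (hxb : K.chart x = (0, b))
    (hb : K.chart x ∈ K.base) :
    ∀ᶠ v in 𝓝[{v | v.1 ≠ 0}] ((0 : ℂ), b), v.1 ≠ 0 ∧ (v.1 ^ K.e, v.2) ∈ K.base := by
  rw [eventually_nhdsWithin_iff]
  filter_upwards [K.eventually_mem_base (K.zero_pow_mem_base hxb hb)] with v hv h0
  exact ⟨h0, hv⟩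

/-- In the coordinates of a sheet, an integral function extends analytically. -/
theorem exists_analyticAt_sheet (hf : IsHolMap f) {x : X} (hx : x ∈ K.chart.source) {b : E}
    (hxb : K.chart x = (0, b)) (hb : K.chart x ∈ K.base) {h : M → ℂ} (hh : IsIntegralAt f h x)
    (i : K.ι) : ∃ H : ℂ × E → ℂ, AnalyticAt ℂ H (0, b) ∧
      ∀ᶠ v in 𝓝[{v | v.1 ≠ 0}] ((0 : ℂ), b), h (K.sheet i v) = H v := by
  obtain ⟨C, hC⟩ := K.exists_bound_of_isIntegralAt hx hh
  have h1 := (K.eventually_comap_iff hx hxb hb).1 (hh.eventually_holAt hf) i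
  have h2 := (K.eventually_comap_iff hx hxb hb).1 hC i
  have h3 : ∀ᶠ v in 𝓝[{v | v.1 ≠ 0}] ((0 : ℂ), b), AnalyticAt ℂ (h ∘ K.sheet i) v := by
    filter_upwards [h1, K.eventually_nhdsWithin_mem hxb hb] with v hv hvb
    exact (K.holAt_sheet i v hvb.1 hvb.2 h).1 hv
  obtain ⟨H, hH, hHh⟩ := exists_analyticAt_of_bounded (eventually_nhdsWithin_iff.1 h3)
    (eventually_nhdsWithin_iff.1 h2)
  refine ⟨H, hH, ?_⟩
  rw [eventually_nhdsWithin_iff]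
  filter_upwards [hHh] with v hv h0
  exact (hv h0).symm

open Classical in
/-- The function on the covering given by `k` in the coordinates of the sheet `i` and by zero on
the other sheets. -/
def push (i : K.ι) (k : ℂ × E → ℂ) (m : M) : ℂ :=
  if hm : ∃ v : ℂ × E, (v.1 ≠ 0 ∧ (v.1 ^ K.e, v.2) ∈ K.base) ∧ K.sheet i v = m
    then k hm.choose else 0

theorem push_sheet_self {i : K.ι} (k : ℂ × E → ℂ) {v : ℂ × E}
    (hv : v.1 ≠ 0 ∧ (v.1 ^ K.e, v.2) ∈ K.base) : K.push i k (K.sheet i v) = k v := by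
  have hm : ∃ v' : ℂ × E, (v'.1 ≠ 0 ∧ (v'.1 ^ K.e, v'.2) ∈ K.base) ∧
    K.sheet i v' = K.sheet i v := ⟨v, hv, rfl⟩
  rw [push, dif_pos hm]
  have h1 := hm.choose_spec
  rw [(K.sheet_inj _ _ _ _ h1.1.1 h1.1.2 hv.1 hv.2 h1.2).2]

theorem push_sheet_ne {i j : K.ι} (hij : j ≠ i) (k : ℂ × E → ℂ) {v : ℂ × E}
    (hv : v.1 ≠ 0 ∧ (v.1 ^ K.e, v.2) ∈ K.base) : K.push i k (K.sheet j v) = 0 := by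
  rw [push, dif_neg]
  rintro ⟨v', h1, h2⟩
  exact hij (K.sheet_inj _ _ _ _ h1.1 h1.2 hv.1 hv.2 h2).1.symm

/-- The sheets are disjoint, so extension by zero keeps `k` holomorphic and bounded along the fibre.
With `k = 1` this yields the idempotents that separate the sheets. -/
theorem eventually_isIntegralAt_push {x : X} (hx : x ∈ K.chart.source) {b : E}
    (hxb : K.chart x = (0, b)) (hb : K.chart x ∈ K.base) (i : K.ι) {k : ℂ × E → ℂ}
    (hk : AnalyticAt ℂ k (0, b)) : ∀ᶠ x' in 𝓝 x, IsIntegralAt f (K.push i k) x' := by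
  have h1 : ∀ᶠ m in comap f (𝓝 x), HolAt (K.push i k) m ∧ ‖K.push i k m‖ ≤ ‖k (0, b)‖ + 1 := by
    rw [K.eventually_comap_iff hx hxb hb]
    intro j
    have h2 : ∀ᶠ v in 𝓝 ((0 : ℂ), b), ‖k v‖ < ‖k (0, b)‖ + 1 :=
      hk.continuousAt.norm.eventually_lt continuousAt_const (lt_add_one _)
    filter_upwards [K.eventually_nhdsWithin_mem hxb hb,
      nhdsWithin_le_nhds hk.eventually_analyticAt, nhdsWithin_le_nhds h2] with v hv hkv hkb
    rw [K.holAt_sheet j v hv.1 hv.2]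
    by_cases hij : j = i
    · subst hij
      refine ⟨hkv.congr ?_, ?_⟩
      · filter_upwards [K.eventually_sheet_mem hv.1 hv.2] with v' hv'
        exact (K.push_sheet_self k hv').symm
      · rw [K.push_sheet_self k hv]
        exact hkb.le
    · refine ⟨(analyticAt_const (v := (0 : ℂ))).congr ?_, ?_⟩
      · filter_upwards [K.eventually_sheet_mem hv.1 hv.2] with v' hv'
        exact (K.push_sheet_ne hij k hv').symm
      · rw [K.push_sheet_ne hij k hv, norm_zero]
        positivity
  filter_upwards [eventually_comap_nhds_nhds h1, K.chart.open_source.mem_nhds hx,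
    (K.chart.continuousAt hx).eventually_mem (K.isOpen_base.mem_nhds hb)] with x' h2 h3 h4
  exact K.isIntegralAt_of_bounded h3 h4 (h2.mono fun m hm => hm.1)
    ⟨_, h2.mono fun m hm => hm.2⟩

theorem eventually_comap_forall_sheet {x : X} (hx : x ∈ K.chart.source)
    (hb : K.chart x ∈ K.base) : ∀ᶠ m in comap f (𝓝 x),
      ∃ i v, (v.1 ≠ 0 ∧ (v.1 ^ K.e, v.2) ∈ K.base) ∧ K.sheet i v = m := by
  rw [eventually_comap]
  filter_upwards [K.chart.open_source.mem_nhds hx,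
    (K.chart.continuousAt hx).eventually_mem (K.isOpen_base.mem_nhds hb)] with x' h3 h4 m hm
  subst hm
  obtain ⟨i, v, h1, h2, h5⟩ := K.exists_sheet m h3 h4
  exact ⟨i, v, ⟨h1, h2⟩, h5⟩

/-- Every point of the normalization over `D` lies on one of the sheets. -/
theorem exists_eval_push_one {y : Normalization f}
    (hx : y.pt ∈ K.chart.source) {b : E} (hxb : K.chart y.pt = (0, b))
    (hb : K.chart y.pt ∈ K.base) : ∃ i, eval f (K.push i 1) y = 1 := by
  have hint (i : K.ι) : IsIntegralAt f (K.push i 1) y.pt :=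
    (K.eventually_isIntegralAt_push hx hxb hb i analyticAt_const).self_of_nhds
  let a (i : K.ι) : integralStalk f y.pt := ⟨_, hint i⟩
  -- Every point near the fibre lies on some sheet, where the corresponding factor vanishes. A
  -- character to the field `ℂ` then kills one factor.
  have h1 : ∏ i, (1 - a i) = 0 := by
    apply Subtype.ext
    have h2 : ((∏ i, (1 - K.push i 1) : M → ℂ) : Germ (comap f (𝓝 y.pt)) ℂ) =
        ((0 : M → ℂ) : Germ (comap f (𝓝 y.pt)) ℂ) := by
      rw [Germ.coe_eq]
      filter_upwards [K.eventually_comap_forall_sheet hx hb] with m hm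
      obtain ⟨i, v, hv, rfl⟩ := hm
      rw [Finset.prod_apply]
      refine Finset.prod_eq_zero (Finset.mem_univ i) ?_
      simp [K.push_sheet_self (1 : ℂ × E → ℂ) hv]
    have h3 := map_prod (Germ.coeRingHom (comap f (𝓝 y.pt)) (R := ℂ))
      (fun i => (1 - K.push i 1 : M → ℂ)) Finset.univ
    simp only [map_sub, map_one] at h3
    have h4 := map_prod (integralStalk f y.pt).subtype (fun i => 1 - a i) Finset.univ
    exact h4.trans (h3.symm.trans h2)
  have h4 := congrArg y.char h1
  rw [map_prod, map_zero, Finset.prod_eq_zero_iff] at h4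
  obtain ⟨i, -, hi⟩ := h4
  refine ⟨i, ?_⟩
  rw [eval_of_isIntegralAt (hint i)]
  rw [map_sub, map_one, sub_eq_zero] at hi
  exact hi.symm

/-- The value of an integral function at a point of the normalization over `D`. -/
theorem eval_eq (hf : IsHolMap f) {y : Normalization f} (hx : y.pt ∈ K.chart.source) {b : E}
    (hxb : K.chart y.pt = (0, b)) (hb : K.chart y.pt ∈ K.base) {i : K.ι}
    (hi : eval f (K.push i 1) y = 1) {h : M → ℂ} (hh : IsIntegralAt f h y.pt)
    {H : ℂ × E → ℂ} (hH : AnalyticAt ℂ H (0, b))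
    (hHh : ∀ᶠ v in 𝓝[{v | v.1 ≠ 0}] ((0 : ℂ), b), h (K.sheet i v) = H v) :
    eval f h y = H (0, b) := by
  have hint : IsIntegralAt f (K.push i 1) y.pt :=
    (K.eventually_isIntegralAt_push hx hxb hb i analyticAt_const).self_of_nhds
  have hconst : IsIntegralAt f (fun _ : M => -H (0, b)) y.pt := isIntegralAt_const _ _
  have hsub : IsIntegralAt f (h + fun _ : M => -H (0, b)) y.pt :=
    (integralStalk f y.pt).add_mem hh hconst
  -- Subtracting the expected value and multiplying by the idempotent of the sheet `i` gives a
  -- function tending to zero along the whole fibre; the idempotent has value `1` at `y`.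
  have hk : IsIntegralAt f ((h + fun _ : M => -H (0, b)) * K.push i 1) y.pt :=
    (integralStalk f y.pt).mul_mem hsub hint
  have h0 := K.eval_eq_zero_of_tendsto hf hx hb hk (by
    rw [K.comap_nhds hx hxb hb, tendsto_iSup]
    intro j
    rw [tendsto_map'_iff]
    by_cases hij : j = i
    · subst hij
      have h1 : Tendsto (fun v => H v + -H (0, b)) (𝓝[{v | v.1 ≠ 0}] ((0 : ℂ), b)) (𝓝 0) := by
        have := (hH.continuousAt.tendsto.add_const (-H (0, b))).mono_left
          (nhdsWithin_le_nhds (s := {v | v.1 ≠ 0}))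
        rwa [add_neg_cancel] at this
      refine h1.congr' ?_
      filter_upwards [hHh, K.eventually_nhdsWithin_mem hxb hb] with v h2 h3
      simp [h2, K.push_sheet_self (1 : ℂ × E → ℂ) h3]
    · refine tendsto_const_nhds.congr' ?_
      filter_upwards [K.eventually_nhdsWithin_mem hxb hb] with v h3
      simp [K.push_sheet_ne hij (1 : ℂ × E → ℂ) h3])
  rw [eval_mul hsub hint, eval_add hh hconst, hi, mul_one, eval_const] at h0
  rwa [← sub_eq_add_neg, sub_eq_zero] at h0

/-- The centre of a sheet is a point of the normalization. -/
theorem exists_pt (hf : IsHolMap f) {x : X} (hx : x ∈ K.chart.source) {b : E}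
    (hxb : K.chart x = (0, b)) (hb : K.chart x ∈ K.base) (i : K.ι) :
    ∃ y : Normalization f, y.pt = x ∧ ∀ (h : M → ℂ) (H : ℂ × E → ℂ), IsIntegralAt f h x →
      AnalyticAt ℂ H (0, b) → (∀ᶠ v in 𝓝[{v | v.1 ≠ 0}] ((0 : ℂ), b), h (K.sheet i v) = H v) →
      eval f h y = H (0, b) := by
  have hne := neBot_nhdsWithin_fst_ne_zero ((0 : ℂ), b)
  have hlim (h : M → ℂ) (H : ℂ × E → ℂ) (hH : AnalyticAt ℂ H (0, b))
      (hHh : ∀ᶠ v in 𝓝[{v | v.1 ≠ 0}] ((0 : ℂ), b), h (K.sheet i v) = H v) :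
      Tendsto h (map (K.sheet i) (𝓝[{v | v.1 ≠ 0}] ((0 : ℂ), b))) (𝓝 (H (0, b))) := by
    rw [tendsto_map'_iff]
    refine (hH.continuousAt.tendsto.mono_left nhdsWithin_le_nhds).congr' ?_
    filter_upwards [hHh] with v hv using hv.symm
  obtain ⟨y, hy, hyh⟩ := exists_pt_of_tendsto (f := f) (x := x)
    (map (K.sheet i) (𝓝[{v | v.1 ≠ 0}] ((0 : ℂ), b)))
    (by rw [K.comap_nhds hx hxb hb]
        exact le_iSup (fun i => map (K.sheet i) (𝓝[{v | v.1 ≠ 0}] ((0 : ℂ), b))) i)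
    (fun g hg => K.continuousAt_of_holAt hx hg)
    (fun h hh => by
      obtain ⟨H, hH, hHh⟩ := K.exists_analyticAt_sheet hf hx hxb hb hh i
      exact ⟨_, hlim h H hH hHh⟩)
  exact ⟨y, hy, fun h H hh hH hHh => hyh h _ hh (hlim h H hH hHh)⟩

end KummerModel

/-! ### The ramification order of a Kummer model. -/

namespace KummerModel

open Normalization

variable {X : Type u} {M : Type v} [TopologicalSpace X] [HolStructure X]
    [TopologicalSpace M] [HolStructure M] {D : Set X} {f : M → X}
    {E : Type} [NormedAddCommGroup E] [NormedSpace ℂ E] (K : KummerModel.{u, v, w} D f E)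

theorem eventually_mem_domain {x : X} (hx : x ∈ K.chart.source) (hb : K.chart x ∈ K.base) :
    ∀ᶠ x' in 𝓝 x, x' ∈ K.chart.source ∧ K.chart x' ∈ K.base :=
  (K.chart.open_source.eventually_mem hx).and
    ((K.chart.continuousAt hx).eventually_mem (K.isOpen_base.mem_nhds hb))

/-- Functions on the covering that agree on all sheets agree along the nearby fibres. -/
theorem eventually_comap_eq {x : X} (hx : x ∈ K.chart.source) (hb : K.chart x ∈ K.base)
    {h k : M → ℂ} (hhk : ∀ i v, v.1 ≠ 0 ∧ (v.1 ^ K.e, v.2) ∈ K.base →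
      h (K.sheet i v) = k (K.sheet i v)) : ∀ᶠ m in comap f (𝓝 x), h m = k m := by
  filter_upwards [K.eventually_comap_forall_sheet hx hb] with m hm
  obtain ⟨i, v, hv, rfl⟩ := hm
  exact hhk i v hv

theorem holAt_fst {x : X} (hx : x ∈ K.chart.source) : HolAt (fun x => (K.chart x).1) x := by
  rw [K.holAt_iff x hx]
  refine analyticAt_fst.congr ?_
  filter_upwards [K.chart.open_target.mem_nhds (K.chart.map_source hx)] with z hz
  simp [K.chart.right_inv hz]

variable {y : Normalization f} {b : E} {i : K.ι}

/-- Near a point of the normalization on the sheet `i`, only this sheet is visible. -/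
theorem eventually_eval_push_one (hx : y.pt ∈ K.chart.source)
    (hxb : K.chart y.pt = (0, b)) (hb : K.chart y.pt ∈ K.base)
    (hi : eval f (K.push i 1) y = 1) : ∀ᶠ z in 𝓝 y, eval f (K.push i 1) z = 1 := by
  have hint := K.eventually_isIntegralAt_push hx hxb hb i (k := 1) analyticAt_const
  have hcont := continuousAt_eval hint
  have h0 : ∀ᶠ z in 𝓝 y, eval f (K.push i 1) z ≠ 0 := by
    refine hcont.eventually_ne ?_
    rw [hi]
    exact one_ne_zero
  filter_upwards [h0, continuous_pt.continuousAt.eventually hint,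
    continuous_pt.continuousAt.eventually (K.eventually_mem_domain hx hb)] with z h1 h2 h3
  -- The function is idempotent, so its values are `0` or `1`; by continuity it does not vanish near
  -- `y`.
  have h4 : eval f (K.push i 1 * K.push i 1) z = eval f (K.push i 1) z := by
    refine eval_congr (K.eventually_comap_eq h3.1 h3.2 fun j v hv => ?_)
    by_cases hij : j = i
    · subst hij
      simp [K.push_sheet_self (1 : ℂ × E → ℂ) hv]
    · simp [K.push_sheet_ne hij (1 : ℂ × E → ℂ) hv]
  rw [eval_mul h2 h2] at h4
  exact mul_left_cancel₀ h1 (by rw [h4, mul_one])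

/-- The coordinate `w` of the sheet `i`, as a function on the covering. -/
def coord (i : K.ι) : M → ℂ := K.push i Prod.fst

theorem eventually_isIntegralAt_coord (hx : y.pt ∈ K.chart.source)
    (hxb : K.chart y.pt = (0, b)) (hb : K.chart y.pt ∈ K.base) :
    ∀ᶠ x in 𝓝 y.pt, IsIntegralAt f (K.coord i) x :=
  K.eventually_isIntegralAt_push hx hxb hb i analyticAt_fst

/-- On the sheet `i`, the `e`-th power of the coordinate is the equation of `D`. -/
theorem eventually_eval_coord_pow (hf : IsHolMap f) (hx : y.pt ∈ K.chart.source)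
    (hxb : K.chart y.pt = (0, b)) (hb : K.chart y.pt ∈ K.base)
    (hi : eval f (K.push i 1) y = 1) :
    ∀ᶠ z in 𝓝 y, eval f (K.coord i) z ^ K.e = (K.chart z.pt).1 := by
  filter_upwards [K.eventually_eval_push_one hx hxb hb hi,
    continuous_pt.continuousAt.eventually (K.eventually_isIntegralAt_coord (i := i) hx hxb hb),
    continuous_pt.continuousAt.eventually
      (K.eventually_isIntegralAt_push hx hxb hb i (k := 1) analyticAt_const),
    continuous_pt.continuousAt.eventually (K.eventually_mem_domain hx hb)] with z h1 h2 h3 h4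
  have h5 := K.holAt_fst h4.1
  -- The functions agree on the sheet `i` by the Kummer equation. On the other sheets both vanish,
  -- which uses `K.e ≠ 0`.
  have h6 : eval f (((fun x => (K.chart x).1) ∘ f) * K.push i 1) z = eval f (K.coord i ^ K.e) z := by
    refine eval_congr (K.eventually_comap_eq h4.1 h4.2 fun j v hv => ?_)
    by_cases hij : j = i
    · subst hij
      simp [K.push_sheet_self (1 : ℂ × E → ℂ) hv, coord, K.push_sheet_self Prod.fst hv,
        K.chart_map_sheet hv.1 hv.2]
    · simp [K.push_sheet_ne hij (1 : ℂ × E → ℂ) hv, coord, K.push_sheet_ne hij Prod.fst hv,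
        K.e_pos.ne']
  rw [← (eval_pow h2 K.e).2, ← h6, eval_mul (isIntegralAt_comp hf h5) h3, h1, mul_one,
    eval_comp hf h5]

/-- The germ of the coordinate of the sheet `i`. -/
theorem coord_mem_holStalk (hx : y.pt ∈ K.chart.source)
    (hxb : K.chart y.pt = (0, b)) (hb : K.chart y.pt ∈ K.base) (i : K.ι) :
    ((eval f (K.coord i) : Normalization f → ℂ) : Germ (𝓝 y) ℂ) ∈ holStalk y :=
  ⟨_, holAt_eval (K.eventually_isIntegralAt_coord hx hxb hb), rfl⟩

/-- The points over `D` near a given point of the sheet `i`. -/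
theorem exists_tendsto_pt (hf : IsHolMap f) (hx : y.pt ∈ K.chart.source)
    (hxb : K.chart y.pt = (0, b)) (hb : K.chart y.pt ∈ K.base)
    (hi : eval f (K.push i 1) y = 1) : ∃ Θ : E → Normalization f, Tendsto Θ (𝓝 b) (𝓝 y) ∧
      (∀ᶠ b' in 𝓝 b, (Θ b').pt ∈ D) ∧
      ∀ (h : M → ℂ) (H : ℂ × E → ℂ), (∀ᶠ x in 𝓝 y.pt, IsIntegralAt f h x) →
        AnalyticAt ℂ H (0, b) →
        (∀ᶠ v in 𝓝[{v | v.1 ≠ 0}] ((0 : ℂ), b), h (K.sheet i v) = H v) →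
        ∀ᶠ b' in 𝓝 b, eval f h (Θ b') = H (0, b') := by
  have hex (b' : E) : ∃ z : Normalization f, ((0 : ℂ), b') ∈ K.base →
      z.pt = K.chart.symm (0, b') ∧ ∀ (h : M → ℂ) (H : ℂ × E → ℂ),
        IsIntegralAt f h (K.chart.symm (0, b')) → AnalyticAt ℂ H (0, b') →
        (∀ᶠ v in 𝓝[{v | v.1 ≠ 0}] ((0 : ℂ), b'), h (K.sheet i v) = H v) →
        eval f h z = H (0, b') := by
    by_cases hb' : ((0 : ℂ), b') ∈ K.base
    · have ht := K.base_subset hb'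
      obtain ⟨z, hz⟩ := K.exists_pt hf (K.chart.map_target ht) (b := b')
        (K.chart.right_inv ht) (by rwa [K.chart.right_inv ht]) i
      exact ⟨z, fun _ => hz⟩
    · exact ⟨y, fun h => absurd h hb'⟩
  choose Θ hΘ using hex
  have hb0 : ((0 : ℂ), b) ∈ K.base := hxb ▸ hb
  have hincl : Tendsto (fun b' : E => ((0 : ℂ), b')) (𝓝 b) (𝓝 (0, b)) :=
    Continuous.tendsto (by fun_prop) b
  have hmem : ∀ᶠ b' in 𝓝 b, ((0 : ℂ), b') ∈ K.base :=
    hincl.eventually (K.isOpen_base.mem_nhds hb0)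
  have hsymm : Tendsto (fun b' : E => K.chart.symm (0, b')) (𝓝 b) (𝓝 y.pt) := by
    have h1 : ContinuousAt K.chart.symm (0, b) :=
      K.chart.symm.continuousAt (K.base_subset hb0)
    have h2 := h1.tendsto.comp hincl
    rwa [← hxb, K.chart.left_inv hx] at h2
  have heval (h : M → ℂ) (H : ℂ × E → ℂ) (hh : ∀ᶠ x in 𝓝 y.pt, IsIntegralAt f h x)
      (hH : AnalyticAt ℂ H (0, b))
      (hHh : ∀ᶠ v in 𝓝[{v | v.1 ≠ 0}] ((0 : ℂ), b), h (K.sheet i v) = H v) :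
      ∀ᶠ b' in 𝓝 b, eval f h (Θ b') = H (0, b') := by
    filter_upwards [hmem, hsymm.eventually hh, hincl.eventually hH.eventually_analyticAt,
      hincl.eventually (eventually_eventually_nhds.2 (eventually_nhdsWithin_iff.1 hHh))]
      with b' h1 h2 h3 h4
    exact (hΘ b' h1).2 h H h2 h3 (eventually_nhdsWithin_iff.2 h4)
  refine ⟨Θ, tendsto_nhds_of_eval ?_ fun h hh => ?_, ?_, heval⟩
  · refine hsymm.congr' ?_
    filter_upwards [hmem] with b' hb'
    exact (hΘ b' hb').1.symm
  · obtain ⟨H, hH, hHh⟩ := K.exists_analyticAt_sheet hf hx hxb hb hh.self_of_nhds i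
    rw [K.eval_eq hf hx hxb hb hi hh.self_of_nhds hH hHh]
    refine (hH.continuousAt.tendsto.comp hincl).congr' ?_
    filter_upwards [heval h H hh hH hHh] with b' hb' using hb'.symm
  · filter_upwards [hmem] with b' hb'
    have ht := K.base_subset hb'
    rw [(hΘ b' hb').1, K.mem_iff _ (K.chart.map_target ht), K.chart.right_inv ht]

/-- The ideal of the inverse image of `D` is generated by the coordinate of the sheet. -/
theorem vanishingIdealAt_preimage (hf : IsHolMap f) (hx : y.pt ∈ K.chart.source)
    (hxb : K.chart y.pt = (0, b)) (hb : K.chart y.pt ∈ K.base)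
    (hi : eval f (K.push i 1) y = 1) :
    vanishingIdealAt ((pt : Normalization f → X) ⁻¹' D) y =
      Ideal.span {⟨_, K.coord_mem_holStalk hx hxb hb i⟩} := by
  have hdom := continuous_pt.continuousAt.eventually (K.eventually_mem_domain hx hb)
  have hpow := K.eventually_eval_coord_pow hf hx hxb hb hi
  apply le_antisymm
  · rintro ⟨_, g, ⟨h, hh, hgh⟩, rfl⟩ ⟨g', hg', hg0⟩
    obtain ⟨H, hH, hHh⟩ := K.exists_analyticAt_sheet hf hx hxb hb hh.self_of_nhds i
    obtain ⟨Θ, hΘ, hΘD, hΘe⟩ := K.exists_tendsto_pt hf hx hxb hb hi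
    have hgg' : g =ᶠ[𝓝 y] g' := Germ.coe_eq.1 hg'
    -- The centres `Θ b'` of the sheet lie over `D`, where the function vanishes; hence `H` is
    -- divisible by the coordinate `w`.
    have hH0 : ∀ᶠ b' in 𝓝 b, H (0, b') = 0 := by
      filter_upwards [hΘD, hΘe h H hh hH hHh, hΘ.eventually hgh, hΘ.eventually hgg',
        hΘ.eventually hg0] with b' h1 h2 h3 h4 h5
      rw [← h2, ← h3, h4]
      exact h5 h1
    obtain ⟨k, hk, hHk⟩ := hH.exists_eq_fst_mul hH0
    have hkint := K.eventually_isIntegralAt_push hx hxb hb i hk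
    have hwint := K.eventually_isIntegralAt_coord (i := i) hx hxb hb
    have h1int := K.eventually_isIntegralAt_push hx hxb hb i (k := 1) analyticAt_const
    -- The factorization `H = w * k` is transported to `M`. The idempotent removes the other sheets,
    -- on which `h` is arbitrary.
    have hfac : ∀ᶠ m in comap f (𝓝 y.pt),
        (h * K.push i 1) m = (K.coord i * K.push i k) m := by
      rw [K.eventually_comap_iff hx hxb hb]
      intro j
      filter_upwards [K.eventually_nhdsWithin_mem hxb hb, hHh, nhdsWithin_le_nhds hHk]
        with v hv h1 h2
      by_cases hij : j = i
      · subst hij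
        simp [coord, K.push_sheet_self _ hv, h1, h2]
      · simp [K.push_sheet_ne hij (1 : ℂ × E → ℂ) hv, coord, K.push_sheet_ne hij Prod.fst hv]
    rw [Ideal.mem_span_singleton]
    refine ⟨⟨_, eval f (K.push i k), holAt_eval hkint, rfl⟩, Subtype.ext ?_⟩
    refine Germ.coe_eq.2 ?_
    filter_upwards [hgh, continuous_pt.continuousAt.eventually hkint,
      continuous_pt.continuousAt.eventually hwint, continuous_pt.continuousAt.eventually h1int,
      continuous_pt.continuousAt.eventually hh, K.eventually_eval_push_one hx hxb hb hi,
      continuous_pt.continuousAt.eventually (eventually_comap_nhds_nhds hfac)]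
      with z h1 h2 h3 h4 h5 h6 h7
    have h8 := eval_congr h7
    rw [eval_mul h5 h4, eval_mul h3 h2, h6, mul_one] at h8
    rw [h1, h8]
  · rw [Ideal.span_singleton_le_iff_mem]
    refine ⟨eval f (K.coord i), rfl, ?_⟩
    filter_upwards [hdom, hpow] with z h1 h2 h3
    rw [(K.mem_iff _ h1.1).1 h3] at h2
    exact eq_zero_of_pow_eq_zero h2

/-- The ideal of `D` is generated by the first coordinate. -/
theorem vanishingIdealAt_eq {x : X} (hx : x ∈ K.chart.source) (hxb : K.chart x = (0, b)) :
    vanishingIdealAt D x = Ideal.span {⟨_, _, K.holAt_fst hx, rfl⟩} := by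
  have hsrc := K.chart.open_source.eventually_mem hx
  have hbt : ((0 : ℂ), b) ∈ K.chart.target := hxb ▸ K.chart.map_source hx
  have hxb' : K.chart.symm (0, b) = x := by rw [← hxb, K.chart.left_inv hx]
  apply le_antisymm
  · rintro ⟨_, g, hg, rfl⟩ ⟨g', hg', hg0⟩
    have hgg' : g =ᶠ[𝓝 x] g' := Germ.coe_eq.1 hg'
    have hG := (K.holAt_iff x hx g).1 hg
    rw [hxb] at hG
    have hsymm : Tendsto K.chart.symm (𝓝 (0, b)) (𝓝 x) := by
      have := K.chart.symm.continuousAt hbt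
      rwa [ContinuousAt, hxb'] at this
    have hincl : Tendsto (fun b' : E => ((0 : ℂ), b')) (𝓝 b) (𝓝 (0, b)) :=
      Continuous.tendsto (by fun_prop) b
    obtain ⟨k, hk, hGk⟩ := hG.exists_eq_fst_mul (by
      have h1 := hsymm.comp hincl
      filter_upwards [h1.eventually hgg', h1.eventually hg0,
        hincl.eventually (K.chart.open_target.mem_nhds hbt)] with b' h2 h3 h4
      change g (K.chart.symm (0, b')) = 0
      refine Eq.trans h2 (h3 ?_)
      change K.chart.symm (0, b') ∈ D
      rw [K.mem_iff _ (K.chart.map_target h4), K.chart.right_inv h4])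
    rw [Ideal.mem_span_singleton]
    have hkhol : HolAt (k ∘ K.chart) x := by
      rw [K.holAt_iff x hx, hxb]
      refine hk.congr ?_
      filter_upwards [K.chart.open_target.mem_nhds hbt] with z hz
      simp [K.chart.right_inv hz]
    refine ⟨⟨_, k ∘ K.chart, hkhol, rfl⟩, Subtype.ext ?_⟩
    refine Germ.coe_eq.2 ?_
    have hc := K.chart.continuousAt hx
    rw [ContinuousAt, hxb] at hc
    filter_upwards [hsrc, hc.eventually hGk] with x' h1 h2
    simpa [K.chart.left_inv h1] using h2
  · rw [Ideal.span_singleton_le_iff_mem]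
    refine ⟨_, rfl, ?_⟩
    filter_upwards [hsrc] with x' h1 h2
    exact (K.mem_iff x' h1).1 h2

theorem map_vanishingIdealAt (hf : IsHolMap f) (hx : y.pt ∈ K.chart.source)
    (hxb : K.chart y.pt = (0, b)) (hb : K.chart y.pt ∈ K.base)
    (hi : eval f (K.push i 1) y = 1) :
    (vanishingIdealAt D y.pt).map (holStalkMap _ (isHolMap_pt hf) y) =
      Ideal.span {⟨_, K.coord_mem_holStalk hx hxb hb i⟩ ^ K.e} := by
  rw [K.vanishingIdealAt_eq hx hxb, Ideal.map_span, Set.image_singleton]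
  congr 2
  apply Subtype.ext
  refine Germ.coe_eq.2 ?_
  filter_upwards [K.eventually_eval_coord_pow hf hx hxb hb hi] with z hz
  exact hz.symm

/-- The powers of the coordinate of the sheet generate distinct ideals. -/
theorem coord_pow_not_dvd (hf : IsHolMap f) (hx : y.pt ∈ K.chart.source)
    (hxb : K.chart y.pt = (0, b)) (hb : K.chart y.pt ∈ K.base)
    (hi : eval f (K.push i 1) y = 1) {m n : ℕ} (hmn : m < n) :
    ¬ (⟨_, K.coord_mem_holStalk hx hxb hb i⟩ : holStalk y) ^ n ∣
      ⟨_, K.coord_mem_holStalk hx hxb hb i⟩ ^ m := by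
  rintro ⟨⟨_, g, ⟨k, hk, hgk⟩, rfl⟩, hc⟩
  have hc' : ∀ᶠ z in 𝓝 y, eval f (K.coord i) z ^ m = eval f (K.coord i) z ^ n * g z :=
    Germ.coe_eq.1 (congrArg Subtype.val hc)
  have hne := neBot_nhdsWithin_fst_ne_zero ((0 : ℂ), b)
  have hw := K.eventually_isIntegralAt_coord (i := i) hx hxb hb
  -- Points of `M` themselves define points of the normalization, through the filter `pure`. Those
  -- on the sheet `i` converge to `y` and lie off `w = 0`.
  have hex (v : ℂ × E) : ∃ z : Normalization f, (v.1 ≠ 0 ∧ (v.1 ^ K.e, v.2) ∈ K.base) →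
      z.pt = f (K.sheet i v) ∧
      ∀ h, IsIntegralAt f h (f (K.sheet i v)) → eval f h z = h (K.sheet i v) := by
    by_cases hv : v.1 ≠ 0 ∧ (v.1 ^ K.e, v.2) ∈ K.base
    · obtain ⟨z, hz, hzh⟩ := exists_pt_of_tendsto (f := f) (x := f (K.sheet i v))
        (pure (K.sheet i v))
        (by rw [← tendsto_iff_comap]; exact tendsto_pure_left.2 fun s hs => mem_of_mem_nhds hs)
        (fun g hg => K.continuousAt_of_holAt (K.map_sheet_mem_source hv.1 hv.2) hg)
        (fun h _ => ⟨h (K.sheet i v), tendsto_pure_left.2 fun s hs => mem_of_mem_nhds hs⟩)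
      exact ⟨z, fun _ => ⟨hz, fun h hh => hzh h _ hh
        (tendsto_pure_left.2 fun s hs => mem_of_mem_nhds hs)⟩⟩
    · exact ⟨y, fun h => absurd h hv⟩
  choose Θ hΘ using hex
  have hdom := K.eventually_nhdsWithin_mem hxb hb
  have hpt : Tendsto (fun v => f (K.sheet i v)) (𝓝[{v | v.1 ≠ 0}] ((0 : ℂ), b)) (𝓝 y.pt) := by
    have h1 : map (K.sheet i) (𝓝[{v | v.1 ≠ 0}] ((0 : ℂ), b)) ≤ comap f (𝓝 y.pt) := by
      rw [K.comap_nhds hx hxb hb]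
      exact le_iSup (fun i => map (K.sheet i) (𝓝[{v | v.1 ≠ 0}] ((0 : ℂ), b))) i
    exact tendsto_comap.comp h1
  have heval (h : M → ℂ) (hh : ∀ᶠ x in 𝓝 y.pt, IsIntegralAt f h x) :
      ∀ᶠ v in 𝓝[{v | v.1 ≠ 0}] ((0 : ℂ), b), eval f h (Θ v) = h (K.sheet i v) := by
    filter_upwards [hdom, hpt.eventually hh] with v h1 h2
    exact (hΘ v h1).2 h h2
  have hlim (h : M → ℂ) (hh : ∀ᶠ x in 𝓝 y.pt, IsIntegralAt f h x) :
      Tendsto (fun v => eval f h (Θ v)) (𝓝[{v | v.1 ≠ 0}] ((0 : ℂ), b)) (𝓝 (eval f h y)) := by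
    obtain ⟨H, hH, hHh⟩ := K.exists_analyticAt_sheet hf hx hxb hb hh.self_of_nhds i
    rw [K.eval_eq hf hx hxb hb hi hh.self_of_nhds hH hHh]
    refine (hH.continuousAt.tendsto.mono_left nhdsWithin_le_nhds).congr' ?_
    filter_upwards [heval h hh, hHh] with v h1 h2
    rw [h1, h2]
  have hΘy : Tendsto Θ (𝓝[{v | v.1 ≠ 0}] ((0 : ℂ), b)) (𝓝 y) := by
    refine tendsto_nhds_of_eval (hpt.congr' ?_) hlim
    filter_upwards [hdom] with v hv
    exact (hΘ v hv).1.symm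
  -- Cancelling `w ^ m` off the hyperplane leaves `w ^ (n - m) * k = 1`, whose left side tends to
  -- zero at `y`.
  have h1 : ∀ᶠ v in 𝓝[{v | v.1 ≠ 0}] ((0 : ℂ), b), v.1 ^ (n - m) * eval f k (Θ v) = 1 := by
    filter_upwards [hdom, hΘy.eventually hc', hΘy.eventually hgk, heval _ hw] with v h2 h3 h4 h5
    rw [h4, h5, coord, K.push_sheet_self _ h2] at h3
    have h6 : v.1 ^ n = v.1 ^ m * v.1 ^ (n - m) := by
      rw [← pow_add, Nat.add_sub_cancel' hmn.le]
    rw [h6, mul_assoc] at h3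
    exact (mul_left_cancel₀ (pow_ne_zero m h2.1) (by rw [← h3, mul_one])).symm
  have h2 : Tendsto (fun v : ℂ × E => v.1 ^ (n - m)) (𝓝[{v | v.1 ≠ 0}] ((0 : ℂ), b)) (𝓝 0) := by
    have h3 : Continuous fun v : ℂ × E => v.1 ^ (n - m) := by fun_prop
    have h4 := (h3.tendsto ((0 : ℂ), b)).mono_left (nhdsWithin_le_nhds (s := {v | v.1 ≠ 0}))
    simpa [zero_pow (Nat.sub_pos_of_lt hmn).ne'] using h4
  have h3 := (h2.mul (hlim k hk)).congr' h1
  rw [zero_mul] at h3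
  exact zero_ne_one (tendsto_nhds_unique h3 tendsto_const_nhds)

/-- In a Kummer model, the ramification order along `D` is the degree of the Kummer coverings. -/
theorem hasRamificationOrderAt_iff (hf : IsHolMap f) (y : Normalization f)
    (hx : y.pt ∈ K.chart.source) (hb : K.chart y.pt ∈ K.base) (hD : y.pt ∈ D) (n : ℕ) :
    HasRamificationOrderAt pt (isHolMap_pt hf) D y n ↔ n = K.e := by
  have hxb : K.chart y.pt = (0, (K.chart y.pt).2) := Prod.ext ((K.mem_iff _ hx).1 hD) rfl
  obtain ⟨i, hi⟩ := K.exists_eval_push_one hx hxb hb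
  rw [HasRamificationOrderAt, K.map_vanishingIdealAt hf hx hxb hb hi,
    K.vanishingIdealAt_preimage hf hx hxb hb hi, Ideal.span_singleton_pow]
  refine ⟨fun h => ?_, fun h => by rw [h]⟩
  rcases lt_trichotomy n K.e with h1 | h1 | h1
  · refine absurd ?_ (K.coord_pow_not_dvd hf hx hxb hb hi h1)
    rw [← Ideal.span_singleton_le_span_singleton, h]
  · exact h1
  · refine absurd ?_ (K.coord_pow_not_dvd hf hx hxb hb hi h1)
    rw [← Ideal.span_singleton_le_span_singleton, h]

theorem exists_normalization_pt (hf : IsHolMap f) {x : X}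
    (hx : x ∈ K.chart.source) (hb : K.chart x ∈ K.base) (hD : x ∈ D) :
    ∃ y : Normalization f, y.pt = x := by
  have hxb : K.chart x = (0, (K.chart x).2) := Prod.ext ((K.mem_iff _ hx).1 hD) rfl
  obtain ⟨y, hy, -⟩ := K.exists_pt hf hx hxb hb (Classical.arbitrary K.ι)
  exact ⟨y, hy⟩

end KummerModel

/-! ### Flat sections of local systems -/

namespace LocalSystem

variable {S : Type u} [TopologicalSpace S] {r : ℕ} (L : LocalSystem.{u, v} S r)

/-- A neighbourhood of `x` over which the local system is trivial. -/
def trivSet (x : S) : Set S := (L.exists_trivialization x).choose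

/-- A trivialization of the local system near `x`. -/
def triv (x : S) : ∀ y, L.stalk y → (Fin r → ℤ) := (L.exists_trivialization x).choose_spec.choose

theorem isOpen_trivSet (x : S) : IsOpen (L.trivSet x) :=
  (L.exists_trivialization x).choose_spec.choose_spec.1

theorem mem_trivSet (x : S) : x ∈ L.trivSet x :=
  (L.exists_trivialization x).choose_spec.choose_spec.2.1

theorem triv_bijective {x y : S} (hy : y ∈ L.trivSet x) : Function.Bijective (L.triv x y) :=
  ((L.exists_trivialization x).choose_spec.choose_spec.2.2.1 y hy).1

theorem triv_add {x y : S} (hy : y ∈ L.trivSet x) (a b : L.stalk y) :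
    L.triv x y (a + b) = L.triv x y a + L.triv x y b :=
  ((L.exists_trivialization x).choose_spec.choose_spec.2.2.1 y hy).2 a b

theorem isFlatAt_iff {x y : S} (hy : y ∈ L.trivSet x) (s : ∀ x, L.stalk x) :
    L.IsFlatAt s y ↔ ∀ᶠ z in 𝓝 y, L.triv x z (s z) = L.triv x y (s y) :=
  (L.exists_trivialization x).choose_spec.choose_spec.2.2.2 y hy s

/-- The inverse of the trivialization near `x`. -/
def trivInv (x y : S) (v : Fin r → ℤ) : L.stalk y := Function.invFun (L.triv x y) v

theorem triv_trivInv {x y : S} (hy : y ∈ L.trivSet x) (v : Fin r → ℤ) :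
    L.triv x y (L.trivInv x y v) = v :=
  Function.rightInverse_invFun (L.triv_bijective hy).2 v

theorem trivInv_triv {x y : S} (hy : y ∈ L.trivSet x) (a : L.stalk y) :
    L.trivInv x y (L.triv x y a) = a :=
  Function.leftInverse_invFun (L.triv_bijective hy).1 a

/-- The trivialization near `x`, as a linear isomorphism of a stalk. -/
def trivEquiv {x y : S} (hy : y ∈ L.trivSet x) : L.stalk y ≃ₗ[ℤ] (Fin r → ℤ) :=
  (AddEquiv.mk' (Equiv.ofBijective _ (L.triv_bijective hy)) (L.triv_add hy)).toIntLinearEquiv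

theorem trivEquiv_apply {x y : S} (hy : y ∈ L.trivSet x) (a : L.stalk y) :
    L.trivEquiv hy a = L.triv x y a := rfl

theorem isFlatAt_trivInv {x y : S} (hy : y ∈ L.trivSet x) (v : Fin r → ℤ) :
    L.IsFlatAt (fun z => L.trivInv x z v) y := by
  rw [L.isFlatAt_iff hy]
  filter_upwards [(L.isOpen_trivSet x).mem_nhds hy] with z hz
  rw [L.triv_trivInv hz, L.triv_trivInv hy]

variable {L}

theorem IsFlatAt.add {σ τ : ∀ z, L.stalk z} {x : S} (hσ : L.IsFlatAt σ x)
    (hτ : L.IsFlatAt τ x) : L.IsFlatAt (fun z => σ z + τ z) x := by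
  rw [L.isFlatAt_iff (L.mem_trivSet x)] at hσ hτ ⊢
  filter_upwards [hσ, hτ, (L.isOpen_trivSet x).mem_nhds (L.mem_trivSet x)] with z h1 h2 hz
  rw [L.triv_add hz, h1, h2, L.triv_add (L.mem_trivSet x)]

theorem IsFlatAt.eventually_eq_iff {σ τ : ∀ z, L.stalk z} {x : S} (hσ : L.IsFlatAt σ x)
    (hτ : L.IsFlatAt τ x) : ∀ᶠ z in 𝓝 x, (σ z = τ z ↔ σ x = τ x) := by
  rw [L.isFlatAt_iff (L.mem_trivSet x)] at hσ hτ
  filter_upwards [hσ, hτ, (L.isOpen_trivSet x).mem_nhds (L.mem_trivSet x)] with z h1 h2 hz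
  rw [← (L.triv_bijective hz).1.eq_iff, h1, h2, (L.triv_bijective (L.mem_trivSet x)).1.eq_iff]

/-- A flat section takes corresponding values in nearby stalks. -/
theorem IsFlatAt.exists_linearEquiv {σ τ : ∀ z, L.stalk z} {x : S} (hσ : L.IsFlatAt σ x)
    (hτ : L.IsFlatAt τ x) :
    ∀ᶠ z in 𝓝 x, ∃ e : L.stalk x ≃ₗ[ℤ] L.stalk z, e (σ x) = σ z ∧ e (τ x) = τ z := by
  rw [L.isFlatAt_iff (L.mem_trivSet x)] at hσ hτ
  filter_upwards [hσ, hτ, (L.isOpen_trivSet x).mem_nhds (L.mem_trivSet x)] with z h1 h2 hz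
  refine ⟨(L.trivEquiv (L.mem_trivSet x)).trans (L.trivEquiv hz).symm, ?_, ?_⟩
  · rw [LinearEquiv.trans_apply, LinearEquiv.symm_apply_eq, trivEquiv_apply, trivEquiv_apply, h1]
  · rw [LinearEquiv.trans_apply, LinearEquiv.symm_apply_eq, trivEquiv_apply, trivEquiv_apply, h2]

variable (L)

/-- `s` is a section of the pullback of the local system by `g`; only the values `s (g t) t`
matter. -/
def FlatAlong {T : Type*} [TopologicalSpace T] (g : T → S) (s : ∀ z, T → L.stalk z) : Prop :=
  ∀ t₀, ∃ σ : ∀ z, L.stalk z, L.IsFlatAt σ (g t₀) ∧ ∀ᶠ t in 𝓝 t₀, s (g t) t = σ (g t)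

variable {L}

section FlatAlong

variable {T : Type*} [TopologicalSpace T] {g : T → S} {s s' : ∀ z, T → L.stalk z}

theorem FlatAlong.add (hs : L.FlatAlong g s) (hs' : L.FlatAlong g s') :
    L.FlatAlong g (fun z t => s z t + s' z t) := by
  intro t
  obtain ⟨σ, hσ, h1⟩ := hs t
  obtain ⟨τ, hτ, h2⟩ := hs' t
  refine ⟨_, hσ.add hτ, ?_⟩
  filter_upwards [h1, h2] with t h3 h4
  rw [h3, h4]

theorem FlatAlong.comp {T' : Type*} [TopologicalSpace T'] (hs : L.FlatAlong g s) {φ : T' → T}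
    (hφ : Continuous φ) : L.FlatAlong (g ∘ φ) (fun z t => s z (φ t)) := by
  intro t
  obtain ⟨σ, hσ, h1⟩ := hs (φ t)
  exact ⟨σ, hσ, hφ.continuousAt.eventually h1⟩

/-- Two sections of the pullback to a connected space that agree somewhere agree everywhere. -/
theorem FlatAlong.eq_of_eq [PreconnectedSpace T] (hg : Continuous g) (hs : L.FlatAlong g s)
    (hs' : L.FlatAlong g s') {t₀ : T} (h₀ : s (g t₀) t₀ = s' (g t₀) t₀) (t : T) :
    s (g t) t = s' (g t) t := by
  have hloc (t : T) : ∀ᶠ t' in 𝓝 t, (s (g t') t' = s' (g t') t' ↔ s (g t) t = s' (g t) t) := by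
    obtain ⟨σ, hσ, h1⟩ := hs t
    obtain ⟨τ, hτ, h2⟩ := hs' t
    filter_upwards [h1, h2, hg.continuousAt.eventually (hσ.eventually_eq_iff hτ)] with t' h3 h4 h5
    rw [h3, h4, h5, h1.self_of_nhds, h2.self_of_nhds]
  have hclopen : IsClopen {t | s (g t) t = s' (g t) t} := by
    refine ⟨⟨?_⟩, ?_⟩
    · rw [isOpen_iff_mem_nhds]
      intro t ht
      filter_upwards [hloc t] with t' ht' h
      exact ht (ht'.1 h)
    · rw [isOpen_iff_mem_nhds]
      intro t ht
      filter_upwards [hloc t] with t' ht'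
      exact ht'.2 ht
  exact (Set.ext_iff.1 (hclopen.eq_univ ⟨t₀, h₀⟩) t).2 trivial

variable (L)

/-- The covering space of all elements of the stalks of a local system. -/
def bundleCore : FiberBundleCore S S (Fin r → ℤ) where
  baseSet := L.trivSet
  isOpen_baseSet := L.isOpen_trivSet
  indexAt x := x
  mem_baseSet_at := L.mem_trivSet
  coordChange i j z v := L.triv j z (L.trivInv i z v)
  coordChange_self i z hz v := L.triv_trivInv hz v
  continuousOn_coordChange i j := by
    rintro ⟨z, v⟩ ⟨⟨hi, hj⟩, -⟩
    refine ContinuousAt.continuousWithinAt ?_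
    have h1 := (L.isFlatAt_iff hj _).1 (L.isFlatAt_trivInv hi v)
    refine ContinuousAt.congr (f := fun _ => L.triv j z (L.trivInv i z v)) continuousAt_const ?_
    have hv : ∀ᶠ w in 𝓝 v, w = v := by
      rw [nhds_discrete]
      exact eventually_pure.2 rfl
    have h2 : ∀ᶠ p : S × (Fin r → ℤ) in 𝓝 (z, v), p.2 = v :=
      (continuous_snd.tendsto (z, v)).eventually hv
    filter_upwards [h2, (continuous_fst.continuousAt (x := (z, v))).eventually h1] with p h3 h4
    rw [h3]
    exact h4.symm
  coordChange_comp i j k z hz v := by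
    rw [L.trivInv_triv hz.1.2]

/-- Sections of the pullback to a simply connected space exist. -/
theorem exists_flatAlong [SimplyConnectedSpace T] [LocallyPathConnectedSpace T] (hg : Continuous g)
    (t₁ : T) (a : L.stalk (g t₁)) :
    ∃ s : ∀ z, T → L.stalk z, L.FlatAlong g s ∧ s (g t₁) t₁ = a := by
  classical
  let Z := L.bundleCore
  have hcov : IsCoveringMap (Bundle.TotalSpace.proj : Bundle.TotalSpace (Fin r → ℤ) Z.Fiber → S) :=
    FiberBundle.isCoveringMap
  -- Flat sections along `g` are lifts of `g` to the covering space of the local system; simple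
  -- connectedness provides the lift.
  obtain ⟨G, ⟨hG1, hG⟩, -⟩ := hcov.existsUnique_continuousMap_lifts ⟨g, hg⟩ t₁
    ⟨g t₁, L.triv (g t₁) (g t₁) a⟩ rfl
  have hGp (t : T) : (G t).proj = g t := congrFun hG t
  let val (t : T) : Fin r → ℤ := (G t).snd
  -- The fibre coordinate of the lift is read in the trivialization indexed by its own base point,
  -- hence the repeated `z`.
  refine ⟨fun z t => L.trivInv z z (val t), fun t₀ => ?_, ?_⟩
  · have h1 : ContinuousAt (fun t => (Z.localTriv (g t₀) (G t)).2) t₀ := by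
      refine continuous_snd.continuousAt.comp (ContinuousAt.comp ?_ G.continuous.continuousAt)
      refine (Z.localTriv (g t₀)).continuousAt ?_
      rw [Z.mem_localTriv_source, hGp]
      exact L.mem_trivSet _
    have h2 (t : T) : (Z.localTriv (g t₀) (G t)).2 =
        L.triv (g t₀) (g t) (L.trivInv (g t) (g t) (val t)) := by
      rw [Z.localTriv_apply, ← hGp t]
      rfl
    simp only [h2] at h1
    refine ⟨fun z => L.trivInv (g t₀) z
      (L.triv (g t₀) (g t₀) (L.trivInv (g t₀) (g t₀) (val t₀))),
      L.isFlatAt_trivInv (L.mem_trivSet _) _, ?_⟩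
    -- In the fixed trivialization at `g t₀` the coordinate is continuous with values in a discrete
    -- group, hence locally constant.
    have h3 := h1.eventually (show ∀ᶠ w in 𝓝 (L.triv (g t₀) (g t₀)
      (L.trivInv (g t₀) (g t₀) (val t₀))), w = _ by rw [nhds_discrete]; exact eventually_pure.2 rfl)
    filter_upwards [h3, hg.continuousAt.eventually_mem
      ((L.isOpen_trivSet (g t₀)).mem_nhds (L.mem_trivSet _))] with t h4 h5
    rw [← h4, L.trivInv_triv h5]
  · have h1 : val t₁ = L.triv (g t₁) (g t₁) a := by
      have h2 : ∀ y : Bundle.TotalSpace (Fin r → ℤ) Z.Fiber, y = ⟨g t₁, L.triv (g t₁) (g t₁) a⟩ →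
          (show Fin r → ℤ from y.snd) = L.triv (g t₁) (g t₁) a := by
        rintro _ rfl
        rfl
      exact h2 _ hG1
    change L.trivInv _ _ (val t₁) = a
    rw [h1, L.trivInv_triv (L.mem_trivSet _)]

/-- A local system is trivial on a simply connected space. -/
theorem exists_flat_frame [SimplyConnectedSpace T] [LocallyPathConnectedSpace T]
    (hg : Continuous g) : ∃ ι : (Fin r → ℤ) → ∀ z, T → L.stalk z, (∀ v, L.FlatAlong g (ι v)) ∧
      ∀ t, Function.Bijective (fun v => ι v (g t) t) ∧
        ∀ v w, ι (v + w) (g t) t = ι v (g t) t + ι w (g t) t := by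
  obtain ⟨t₀⟩ : Nonempty T := inferInstance
  let e := L.trivEquiv (L.mem_trivSet (g t₀))
  choose ι hι hι0 using fun v => L.exists_flatAlong hg t₀ (e.symm v)
  refine ⟨ι, hι, fun t => ⟨⟨fun v w h => ?_, fun a => ?_⟩, fun v w => ?_⟩⟩
  · have h1 := (hι v).eq_of_eq hg (hι w) h t₀
    rw [hι0, hι0] at h1
    exact e.symm.injective h1
  · obtain ⟨s, hs, hsa⟩ := L.exists_flatAlong hg t a
    refine ⟨e (s (g t₀) t₀), ?_⟩
    have h1 : ι (e (s (g t₀) t₀)) (g t₀) t₀ = s (g t₀) t₀ := by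
      rw [hι0, LinearEquiv.symm_apply_apply]
    rw [← hsa]
    exact (hι _).eq_of_eq hg hs h1 t
  · exact (hι _).eq_of_eq hg ((hι v).add (hι w)) (t₀ := t₀) (by rw [hι0, hι0, hι0, map_add]) t

end FlatAlong

end LocalSystem

/-! ### The topology of the level covers -/

/-- Classes mod `n` lift to integers. Values of frames can thus be represented by lattice vectors,
for which flatness is defined. -/
theorem ZMod.exists_eq_one_tmul {n : ℕ} {N : Type*} [AddCommGroup N] (a : ZMod n ⊗[ℤ] N) :
    ∃ b : N, a = 1 ⊗ₜ[ℤ] b := by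
  induction a using TensorProduct.induction_on with
  | zero => exact ⟨0, by simp⟩
  | tmul c b =>
    obtain ⟨k, rfl⟩ := ZMod.intCast_surjective c
    refine ⟨k • b, ?_⟩
    rw [← TensorProduct.smul_tmul, zsmul_one]
  | add a a' h h' =>
    obtain ⟨b, rfl⟩ := h
    obtain ⟨b', rfl⟩ := h'
    exact ⟨b + b', by rw [TensorProduct.tmul_add]⟩

namespace LocalSystem

variable {S : Type u} [TopologicalSpace S] {r n : ℕ} {L : LocalSystem.{u, v} S r}

theorem IsFlatAt.eventually {σ : ∀ z, L.stalk z} {x : S} (hσ : L.IsFlatAt σ x) :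
    ∀ᶠ y in 𝓝 x, L.IsFlatAt σ y := by
  rw [L.isFlatAt_iff (L.mem_trivSet x)] at hσ
  filter_upwards [hσ, eventually_eventually_nhds.2 hσ,
    (L.isOpen_trivSet x).mem_nhds (L.mem_trivSet x)] with y h1 h2 hy
  rw [L.isFlatAt_iff hy, h1]
  exact h2

/-- Local sections of `L ⊗ ℤ/n` that agree at a point agree nearby. -/
theorem IsFlatAt.eventually_tmul_eq {σ τ : ∀ z, L.stalk z} {x : S} (hσ : L.IsFlatAt σ x)
    (hτ : L.IsFlatAt τ x) (h : (1 : ZMod n) ⊗ₜ[ℤ] σ x = 1 ⊗ₜ[ℤ] τ x) :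
    ∀ᶠ z in 𝓝 x, (1 : ZMod n) ⊗ₜ[ℤ] σ z = 1 ⊗ₜ[ℤ] τ z := by
  filter_upwards [hσ.exists_linearEquiv hτ] with z ⟨e, h1, h2⟩
  have h3 := congrArg (LinearMap.lTensor (ZMod n) e.toLinearMap) h
  simpa [h1, h2] using h3

theorem IsFlatFrameAt.eventually {σ : ∀ z, L.Frame n z} {x : S} [NeZero n]
    (hσ : L.IsFlatFrameAt n σ x) : ∀ᶠ y in 𝓝 x, L.IsFlatFrameAt n σ y := by
  refine eventually_all.2 fun c => ?_
  obtain ⟨s, hs, h⟩ := hσ c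
  filter_upwards [hs.eventually, eventually_eventually_nhds.2 h] with y h1 h2
  exact ⟨s, h1, h2⟩

/-- Two frames are compared on each vector of `(ℤ/n)ʳ`; this set is finite, so the neighbourhoods
can be intersected. -/
theorem IsFlatFrameAt.eventually_eq [NeZero n] {σ τ : ∀ z, L.Frame n z} {x : S}
    (hσ : L.IsFlatFrameAt n σ x) (hτ : L.IsFlatFrameAt n τ x) (h : σ x = τ x) :
    ∀ᶠ z in 𝓝 x, σ z = τ z := by
  have h1 : ∀ᶠ z in 𝓝 x, ∀ c, σ z c = τ z c := by
    refine eventually_all.2 fun c => ?_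
    obtain ⟨s, hs, h1⟩ := hσ c
    obtain ⟨t, ht, h2⟩ := hτ c
    have h3 : (1 : ZMod n) ⊗ₜ[ℤ] s x = 1 ⊗ₜ[ℤ] t x := by
      rw [← h1.self_of_nhds, ← h2.self_of_nhds, h]
    filter_upwards [h1, h2, hs.eventually_tmul_eq ht h3] with z h4 h5 h6
    rw [h4, h5, h6]
  exact h1.mono fun z hz => LinearEquiv.ext hz

/-- Flat frames through the same point agree nearby, so a flat frame maps small open sets to open
sets of the étalé space. Local questions on the cover thereby become questions on `S`. -/
theorem LevelCover.nhds_eq [NeZero n] {σ : ∀ z, L.Frame n z} {x : S}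
    (hσ : L.IsFlatFrameAt n σ x) :
    𝓝 (⟨x, σ x⟩ : L.LevelCover n) = map (fun z => ⟨z, σ z⟩) (𝓝 x) := by
  apply le_antisymm
  · intro V hV
    obtain ⟨W, hW, hWo, hx⟩ := eventually_nhds_iff.1 (hσ.eventually.and hV)
    have hopen : IsOpen {ξ : L.LevelCover n | ξ.pt ∈ W ∧ ξ.frame = σ ξ.pt} := by
      rintro ⟨z, F⟩ ⟨hz, rfl : F = σ z⟩ τ h1 h2
      filter_upwards [hWo.mem_nhds hz, h2.eventually_eq (hW z hz).1 h1] with y hy hy'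
      exact ⟨hy, hy'⟩
    filter_upwards [hopen.mem_nhds ⟨hx, rfl⟩]
    rintro ⟨z, F⟩ ⟨hz, rfl : F = σ z⟩
    exact (hW z hz).2
  · intro V hV
    obtain ⟨W, hWV, hWo, hx⟩ := mem_nhds_iff.1 hV
    exact mem_of_superset (hWo _ hx σ rfl hσ) fun z hz => hWV hz

theorem LevelCover.holAt_iff {X : Type u} [TopologicalSpace X] [HolStructure X] {D : Set X}
    {L : LocalSystem.{u, v} {x : X // x ∉ D} r} [NeZero n] {σ : ∀ z, L.Frame n z}
    {x : {x : X // x ∉ D}} (hσ : L.IsFlatFrameAt n σ x) (h : L.LevelCover n → ℂ) :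
    HolAt h (⟨x, σ x⟩ : L.LevelCover n) ↔
      ∃ g : X → ℂ, HolAt g x.1 ∧ ∀ᶠ z in 𝓝 x, h ⟨z, σ z⟩ = g z.1 := by
  refine exists_congr fun g => and_congr_right fun _ => ?_
  rw [EventuallyEq, LevelCover.nhds_eq hσ, eventually_map]
  rfl

end LocalSystem

/-! ### Trivializations of pullbacks of local systems -/

namespace LocalSystem

variable {S : Type u} [TopologicalSpace S] {r : ℕ} (L : LocalSystem.{u, v} S r)
  {T : Type} [TopologicalSpace T]

/-- A trivialization of the pullback of a local system by a map `g`. -/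
structure FlatFrame (g : T → S) where
  sec : (Fin r → ℤ) → ∀ z, T → L.stalk z
  flat : ∀ v, L.FlatAlong g (sec v)
  bijective : ∀ t, Function.Bijective (fun v => sec v (g t) t)
  add : ∀ t v w, sec (v + w) (g t) t = sec v (g t) t + sec w (g t) t

theorem nonempty_flatFrame [SimplyConnectedSpace T] [LocallyPathConnectedSpace T] {g : T → S}
    (hg : Continuous g) : Nonempty (L.FlatFrame g) := by
  obtain ⟨ι, h1, h2⟩ := L.exists_flat_frame hg
  exact ⟨⟨ι, h1, fun t => (h2 t).1, fun t => (h2 t).2⟩⟩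

namespace FlatFrame

variable {L} {g : T → S} (ι : L.FlatFrame g) {n : ℕ}

/-- The trivialization at a point. -/
def equiv {z : S} {t : T} (h : g t = z) : (Fin r → ℤ) ≃ₗ[ℤ] L.stalk z :=
  (AddEquiv.mk' (Equiv.ofBijective (fun v => ι.sec v z t) (h ▸ ι.bijective t))
    (h ▸ ι.add t)).toIntLinearEquiv

theorem equiv_apply {z : S} {t : T} (h : g t = z) (v : Fin r → ℤ) : ι.equiv h v = ι.sec v z t :=
  rfl

/-- The points of the level cover that correspond to a frame of the trivial local system. -/
def toCover (F : (Fin r → ZMod n) ≃ₗ[ZMod n] (ZMod n ⊗[ℤ] (Fin r → ℤ))) (t : T) :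
    L.LevelCover n :=
  ⟨g t, F.trans ((ι.equiv rfl).baseChange ℤ (ZMod n))⟩

theorem toCover_eq (F : (Fin r → ZMod n) ≃ₗ[ZMod n] (ZMod n ⊗[ℤ] (Fin r → ℤ))) {t : T} {z : S}
    (h : g t = z) : ι.toCover F t = ⟨z, F.trans ((ι.equiv h).baseChange ℤ (ZMod n))⟩ := by
  subst h
  rfl

theorem toCover_injective (t : T) : Function.Injective (fun F => ι.toCover (n := n) F t) := by
  intro F F' h
  have h1 := eq_of_heq (LevelCover.mk.inj h).2
  ext1 c
  exact ((ι.equiv rfl).baseChange ℤ (ZMod n)).injective (LinearEquiv.congr_fun h1 c)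

theorem exists_toCover_eq (ξ : L.LevelCover n) {t : T} (h : g t = ξ.pt) :
    ∃ F, ι.toCover F t = ξ := by
  refine ⟨ξ.frame.trans ((ι.equiv h).baseChange ℤ (ZMod n)).symm, ?_⟩
  rw [ι.toCover_eq _ h]
  obtain ⟨z, G⟩ := ξ
  congr 1
  ext1 c
  simp

/-- The local sections of the level cover. -/
theorem exists_isFlatFrameAt (F : (Fin r → ZMod n) ≃ₗ[ZMod n] (ZMod n ⊗[ℤ] (Fin r → ℤ))) {t₀ : T}
    {u : S → T} (hu : ContinuousAt u (g t₀)) (h₀ : u (g t₀) = t₀)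
    (hgu : ∀ᶠ z in 𝓝 (g t₀), g (u z) = z) :
    ∃ σ : ∀ z, L.Frame n z, L.IsFlatFrameAt n σ (g t₀) ∧
      ∀ z, g (u z) = z → (⟨z, σ z⟩ : L.LevelCover n) = ι.toCover F (u z) := by
  classical
  -- A frame is required at every `z`. Where `u` fails to be a section of `g`, an arbitrary frame
  -- from the trivialization at `z` is used.
  refine ⟨fun z => if h : g (u z) = z then F.trans ((ι.equiv h).baseChange ℤ (ZMod n)) else
    F.trans ((L.trivEquiv (L.mem_trivSet z)).symm.baseChange ℤ (ZMod n)), fun c => ?_,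
    fun z hz => ?_⟩
  · obtain ⟨v, hv⟩ := ZMod.exists_eq_one_tmul (F c)
    obtain ⟨σ, hσ, h1⟩ := ι.flat v t₀
    refine ⟨σ, hσ, ?_⟩
    have h2 : ∀ᶠ z in 𝓝 (g t₀), ι.sec v (g (u z)) (u z) = σ (g (u z)) := by
      rw [← h₀] at h1
      exact hu.eventually h1
    filter_upwards [hgu, h2] with z hz h3
    rw [dif_pos hz, LinearEquiv.trans_apply, hv, LinearEquiv.baseChange_tmul, equiv_apply]
    rw [hz] at h3
    rw [h3]
  · rw [ι.toCover_eq F hz]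
    congr 1
    exact dif_pos hz

section Monodromy

variable [AddAction ℤ T] (hg : ∀ (k : ℤ) t, g (k +ᵥ t) = g t)

include hg in
-- Since `g` is invariant under the translation, translating a flat section gives a flat section
-- along `g`. The matrix `A` is read off at one point, and uniqueness of flat sections on a
-- connected space gives the identity everywhere.
theorem exists_monodromy [PreconnectedSpace T] [Nonempty T] (hgc : Continuous g)
    (hc : Continuous fun t : T => (1 : ℤ) +ᵥ t) :
    ∃ A : (Fin r → ℤ) ≃ₗ[ℤ] (Fin r → ℤ), ∀ v t,
      ι.sec v (g t) ((1 : ℤ) +ᵥ t) = ι.sec (A v) (g t) t := by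
  obtain ⟨t₀⟩ : Nonempty T := inferInstance
  refine ⟨(ι.equiv (hg 1 t₀)).trans (ι.equiv rfl).symm, fun v => ?_⟩
  have h1 : L.FlatAlong g (fun z t => ι.sec v z ((1 : ℤ) +ᵥ t)) := by
    have h2 := (ι.flat v).comp hc
    rwa [show g ∘ (fun t : T => (1 : ℤ) +ᵥ t) = g from funext (hg 1)] at h2
  refine h1.eq_of_eq hgc (ι.flat _) (t₀ := t₀) ?_
  rw [← ι.equiv_apply (rfl : g t₀ = g t₀), ← ι.equiv_apply (hg 1 t₀), LinearEquiv.trans_apply,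
    LinearEquiv.apply_symm_apply]

variable {A : (Fin r → ℤ) ≃ₗ[ℤ] (Fin r → ℤ)}
  (hA : ∀ v t, ι.sec v (g t) ((1 : ℤ) +ᵥ t) = ι.sec (A v) (g t) t)

include hg hA in
theorem toCover_one_vadd (F : (Fin r → ZMod n) ≃ₗ[ZMod n] (ZMod n ⊗[ℤ] (Fin r → ℤ))) (t : T) :
    ι.toCover F ((1 : ℤ) +ᵥ t) = ι.toCover (F.trans (A.baseChange ℤ (ZMod n))) t := by
  rw [ι.toCover_eq F (hg 1 t)]
  unfold toCover
  congr 1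
  ext1 c
  obtain ⟨v, hv⟩ := ZMod.exists_eq_one_tmul (F c)
  simp only [LinearEquiv.trans_apply, hv, LinearEquiv.baseChange_tmul, equiv_apply, hA]

include hg hA in
theorem toCover_vadd (F : (Fin r → ZMod n) ≃ₗ[ZMod n] (ZMod n ⊗[ℤ] (Fin r → ℤ))) (k : ℤ) (t : T) :
    ι.toCover F (k +ᵥ t) = ι.toCover (F.trans ((A.baseChange ℤ (ZMod n)) ^ k)) t := by
  induction k generalizing t with
  | zero =>
    rw [zero_vadd, zpow_zero]
    rfl
  | succ k ih =>
    rw [add_vadd, ih, ι.toCover_one_vadd hg hA, add_comm, zpow_add, zpow_one]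
    rfl
  | pred k ih =>
    have h1 (G : (Fin r → ZMod n) ≃ₗ[ZMod n] (ZMod n ⊗[ℤ] (Fin r → ℤ))) :
        ι.toCover G ((-1 : ℤ) +ᵥ t) =
          ι.toCover (G.trans (A.baseChange ℤ (ZMod n))⁻¹) t := by
      have h2 := ι.toCover_one_vadd hg hA (G.trans (A.baseChange ℤ (ZMod n))⁻¹) ((-1 : ℤ) +ᵥ t)
      have h3 : (G.trans (A.baseChange ℤ (ZMod n))⁻¹).trans (A.baseChange ℤ (ZMod n)) = G := by
        ext1 c
        exact LinearEquiv.apply_symm_apply (A.baseChange ℤ (ZMod n)) (G c)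
      rw [vadd_vadd, add_neg_cancel, zero_vadd, h3] at h2
      exact h2.symm
    rw [sub_eq_add_neg, add_vadd, ih, h1, add_comm, zpow_add, zpow_neg_one]
    rfl

end Monodromy

end FlatFrame

end LocalSystem

/-! ### The universal cover of the complement of a hyperplane in a polydisc -/

/-- A chart of the ambient space whose image contains a polydisc of radius greater than one in the
first coordinate, and in which `D` is the hyperplane `z₀ = 0`. -/
structure PolydiscChart {X : Type u} [TopologicalSpace X] [HolStructure X] (D : Set X) (E : Type)
    [NormedAddCommGroup E] [NormedSpace ℂ E] where
  chart : OpenPartialHomeomorph X (ℂ × E)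
  holAt_iff : ∀ y ∈ chart.source, ∀ f : X → ℂ,
    HolAt f y ↔ AnalyticAt ℂ (f ∘ chart.symm) (chart y)
  mem_iff : ∀ y ∈ chart.source, (y ∈ D ↔ (chart y).1 = 0)
  radius : ℝ
  one_lt_radius : 1 < radius
  ε : ℝ
  ε_pos : 0 < ε
  mem_target : ∀ z : ℂ × E, ‖z.1‖ < radius → ‖z.2‖ < ε → z ∈ chart.target

/-- Polar coordinates: the exponential map in the first variable. -/
def polar {E : Type} (u : ℂ × E) : ℂ × E := (Complex.exp (2 * Real.pi * Complex.I * u.1), u.2)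

section polar

variable {E : Type}

theorem polar_add_int (u : ℂ × E) (k : ℤ) : polar (u.1 + k, u.2) = polar u := by
  refine Prod.ext ?_ rfl
  change Complex.exp _ = Complex.exp _
  rw [Complex.exp_eq_exp_iff_exists_int]
  exact ⟨k, by ring⟩

/-- A local branch of the inverse of the exponential map in the first variable. -/
def polarInv (u₀ z : ℂ × E) : ℂ × E :=
  (u₀.1 + Complex.log (z.1 / (polar u₀).1) / (2 * Real.pi * Complex.I), z.2)

theorem polar_fst_ne_zero (u : ℂ × E) : (polar u).1 ≠ 0 := Complex.exp_ne_zero _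

theorem polar_polarInv (u₀ : ℂ × E) {z : ℂ × E} (hz : z.1 ≠ 0) : polar (polarInv u₀ z) = z := by
  refine Prod.ext ?_ rfl
  change Complex.exp (2 * Real.pi * Complex.I * (u₀.1 + _ / (2 * Real.pi * Complex.I))) = z.1
  rw [mul_add, mul_div_cancel₀ _ Complex.two_pi_I_ne_zero, Complex.exp_add,
    Complex.exp_log (div_ne_zero hz (polar_fst_ne_zero u₀))]
  exact mul_div_cancel₀ _ (polar_fst_ne_zero u₀)

theorem polarInv_polar_self (u₀ : ℂ × E) : polarInv u₀ (polar u₀) = u₀ := by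
  simp [polarInv, polar]

variable [NormedAddCommGroup E]

theorem continuous_polar : Continuous (polar : ℂ × E → ℂ × E) := by
  unfold polar
  fun_prop

theorem polarInv_polar (u₀ : ℂ × E) : ∀ᶠ u in 𝓝 u₀, polarInv u₀ (polar u) = u := by
  have h : ∀ᶠ u : ℂ × E in 𝓝 u₀, ‖2 * Real.pi * Complex.I * (u.1 - u₀.1)‖ < Real.pi := by
    refine ContinuousAt.eventually_lt (by fun_prop) continuousAt_const ?_
    simpa using Real.pi_pos
  filter_upwards [h] with u hu
  refine Prod.ext ?_ rfl
  have h1 : (polar u).1 / (polar u₀).1 = Complex.exp (2 * Real.pi * Complex.I * (u.1 - u₀.1)) := by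
    rw [polar, polar, ← Complex.exp_sub, mul_sub]
  have h2 := (Complex.abs_im_le_norm _).trans_lt hu
  rw [abs_lt] at h2
  change u₀.1 + Complex.log ((polar u).1 / (polar u₀).1) / _ = u.1
  rw [h1, Complex.log_exp h2.1 h2.2.le, mul_div_cancel_left₀ _ Complex.two_pi_I_ne_zero]
  ring

variable [NormedSpace ℂ E]

theorem analyticAt_polar (u₀ : ℂ × E) : AnalyticAt ℂ polar u₀ :=
  (analyticAt_const.mul analyticAt_fst).cexp.prod analyticAt_snd

theorem analyticAt_polarInv (u₀ : ℂ × E) : AnalyticAt ℂ (polarInv u₀) (polar u₀) := by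
  refine (analyticAt_const.add (((analyticAt_fst.div analyticAt_const
    (polar_fst_ne_zero u₀)).clog ?_).div analyticAt_const Complex.two_pi_I_ne_zero)).prod
    analyticAt_snd
  change (polar u₀).1 / (polar u₀).1 ∈ Complex.slitPlane
  rw [div_self (polar_fst_ne_zero u₀)]
  simp

end polar

namespace PolydiscChart

variable {X : Type u} [TopologicalSpace X] [HolStructure X] {D : Set X} {E : Type}
  [NormedAddCommGroup E] [NormedSpace ℂ E] (P : PolydiscChart D E)

/-- The polydisc. -/
def base : Set (ℂ × E) := {z | ‖z.1‖ < P.radius ∧ ‖z.2‖ < P.ε}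

theorem isOpen_base : IsOpen P.base :=
  (isOpen_lt (f := fun z : ℂ × E => ‖z.1‖) (by fun_prop) continuous_const).inter
    (isOpen_lt (f := fun z : ℂ × E => ‖z.2‖) (by fun_prop) continuous_const)

/-- The universal cover of the complement of the hyperplane in the polydisc. -/
def coverSet : Set (ℂ × E) := {u | polar u ∈ P.base}

theorem isOpen_coverSet : IsOpen P.coverSet := P.isOpen_base.preimage continuous_polar

theorem mem_coverSet_iff (u : ℂ × E) :
    u ∈ P.coverSet ↔ -(2 * Real.pi) * u.1.im < Real.log P.radius ∧ ‖u.2‖ < P.ε := by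
  rw [Real.lt_log_iff_exp_lt (by linarith [P.one_lt_radius])]
  simp [coverSet, base, polar, Complex.norm_exp]

theorem convex_coverSet : Convex ℝ P.coverSet := by
  intro u hu u' hu' a b ha hb hab
  rw [mem_coverSet_iff] at *
  constructor
  · have h1 : (a • u + b • u').1.im = a * u.1.im + b * u'.1.im := by simp
    rw [h1]
    have h2 := convex_Iio (𝕜 := ℝ) (Real.log P.radius) hu.1 hu'.1 ha hb hab
    rw [Set.mem_Iio, smul_eq_mul, smul_eq_mul] at h2
    linarith
  · have h2 := convex_ball (0 : E) P.ε (mem_ball_zero_iff.2 hu.2) (mem_ball_zero_iff.2 hu'.2) ha hb hab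
    simpa using h2

theorem add_int_mem_coverSet {u : ℂ × E} (hu : u ∈ P.coverSet) (k : ℤ) :
    ((u.1 + k, u.2) : ℂ × E) ∈ P.coverSet := by
  rw [mem_coverSet_iff] at *
  simpa using hu

theorem real_mem_coverSet (t : ℝ) : (((t : ℂ), 0) : ℂ × E) ∈ P.coverSet := by
  rw [mem_coverSet_iff]
  simpa using ⟨Real.log_pos P.one_lt_radius, P.ε_pos⟩

/-- The universal cover, as a type. -/
abbrev Cover : Type := P.coverSet

instance : AddAction ℤ P.Cover where
  vadd k t := ⟨(t.1.1 + k, t.1.2), P.add_int_mem_coverSet t.2 k⟩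
  zero_vadd t := by
    refine Subtype.ext (Prod.ext ?_ rfl)
    change t.1.1 + ((0 : ℤ) : ℂ) = t.1.1
    simp
  add_vadd k l t := by
    refine Subtype.ext (Prod.ext ?_ rfl)
    change t.1.1 + ((k + l : ℤ) : ℂ) = t.1.1 + (l : ℂ) + (k : ℂ)
    push_cast
    ring

theorem coe_vadd (k : ℤ) (t : P.Cover) : ((k +ᵥ t : P.Cover) : ℂ × E) = (t.1.1 + k, t.1.2) := rfl

theorem continuous_vadd (k : ℤ) : Continuous fun t : P.Cover => k +ᵥ t := by
  refine Continuous.subtype_mk (f := fun t : P.Cover => (t.1.1 + (k : ℂ), t.1.2)) ?_ _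
  fun_prop

instance : Nonempty P.Cover := ⟨⟨_, P.real_mem_coverSet 0⟩⟩

instance : ContractibleSpace P.Cover := P.convex_coverSet.contractibleSpace ⟨_, P.real_mem_coverSet 0⟩

instance : SimplyConnectedSpace P.Cover := SimplyConnectedSpace.ofContractible _

instance : LocallyPathConnectedSpace P.Cover := P.isOpen_coverSet.locallyPathConnectedSpace

/-- The covering map. -/
def proj (t : P.Cover) : {x : X // x ∉ D} :=
  ⟨P.chart.symm (polar t.1), fun h => by
    have h1 := P.mem_target _ t.2.1 t.2.2
    rw [P.mem_iff _ (P.chart.map_target h1), P.chart.right_inv h1] at h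
    exact Complex.exp_ne_zero _ h⟩

theorem polar_mem_target (t : P.Cover) : polar t.1 ∈ P.chart.target :=
  P.mem_target _ t.2.1 t.2.2

theorem proj_mem_source (t : P.Cover) : (P.proj t).1 ∈ P.chart.source :=
  P.chart.map_target (P.polar_mem_target t)

theorem chart_proj (t : P.Cover) : P.chart (P.proj t).1 = polar t.1 :=
  P.chart.right_inv (P.polar_mem_target t)

theorem continuous_proj : Continuous P.proj :=
  Continuous.subtype_mk (P.chart.continuousOn_symm.comp_continuous
    (continuous_polar.comp continuous_subtype_val) P.polar_mem_target) _

theorem proj_eq_iff (t : P.Cover) (z : {x : X // x ∉ D}) (hz : z.1 ∈ P.chart.source) :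
    P.proj t = z ↔ polar t.1 = P.chart z.1 := by
  rw [← P.chart_proj t, ← Subtype.coe_inj]
  exact (P.chart.injOn.eq_iff (P.proj_mem_source t) hz).symm

theorem proj_vadd (k : ℤ) (t : P.Cover) : P.proj (k +ᵥ t) = P.proj t := by
  rw [proj_eq_iff _ _ _ (P.proj_mem_source t), chart_proj, coe_vadd, polar_add_int]

theorem exists_vadd_eq {t t' : P.Cover} (h : P.proj t = P.proj t') : ∃ k : ℤ, t = k +ᵥ t' := by
  rw [proj_eq_iff _ _ _ (P.proj_mem_source t'), chart_proj] at h
  obtain ⟨k, hk⟩ := Complex.exp_eq_exp_iff_exists_int.1 (congrArg Prod.fst h)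
  refine ⟨k, Subtype.ext (Prod.ext ?_ (Prod.ext_iff.1 h).2)⟩
  change t.1.1 = t'.1.1 + k
  have h0 := Complex.two_pi_I_ne_zero
  apply mul_left_cancel₀ h0
  rw [hk]
  ring

end PolydiscChart

/-! ### Level covers are Kummer coverings near the smooth points of the divisor -/

section Kummer

variable {E : Type} (e : ℕ)

/-- The principal lift of a point of the Kummer covering to the universal cover. -/
def kummerLog (v : ℂ × E) : ℂ × E := (e * (Complex.log v.1 / (2 * Real.pi * Complex.I)), v.2)

/-- The covering map from the universal cover to the Kummer covering. -/
def kummerExp (u : ℂ × E) : ℂ × E := (Complex.exp (2 * Real.pi * Complex.I * (u.1 / e)), u.2)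

variable {e}

theorem kummerExp_kummerLog (he : e ≠ 0) {v : ℂ × E} (hv : v.1 ≠ 0) :
    kummerExp e (kummerLog e v) = v := by
  refine Prod.ext ?_ rfl
  have he' : (e : ℂ) ≠ 0 := by exact_mod_cast he
  simp only [kummerExp, kummerLog]
  rw [mul_div_cancel_left₀ _ he', mul_div_cancel₀ _ Complex.two_pi_I_ne_zero, Complex.exp_log hv]

theorem kummerExp_fst_ne_zero (u : ℂ × E) : (kummerExp e u).1 ≠ 0 := Complex.exp_ne_zero _

theorem kummerExp_pow (he : e ≠ 0) (u : ℂ × E) :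
    ((kummerExp e u).1 ^ e, (kummerExp e u).2) = polar u := by
  refine Prod.ext ?_ rfl
  have he' : (e : ℂ) ≠ 0 := by exact_mod_cast he
  simp only [kummerExp, polar]
  rw [← Complex.exp_nat_mul]
  congr 1
  field_simp

theorem polar_kummerLog (he : e ≠ 0) {v : ℂ × E} (hv : v.1 ≠ 0) :
    polar (kummerLog e v) = (v.1 ^ e, v.2) := by
  rw [← kummerExp_pow he, kummerExp_kummerLog he hv]

theorem kummerLog_kummerExp (he : e ≠ 0) (u : ℂ × E) :
    ∃ k : ℤ, kummerLog e (kummerExp e u) = (u.1 + (e * k : ℤ), u.2) := by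
  have he' : (e : ℂ) ≠ 0 := by exact_mod_cast he
  obtain ⟨k, hk⟩ := Complex.exp_eq_exp_iff_exists_int.1
    (Complex.exp_log (kummerExp_fst_ne_zero (e := e) u))
  refine ⟨k, Prod.ext ?_ rfl⟩
  change e * (Complex.log (Complex.exp (2 * Real.pi * Complex.I * (u.1 / e))) / _) = u.1 + _
  rw [hk]
  have := Complex.two_pi_I_ne_zero
  push_cast
  field_simp

theorem kummerExp_add_mul (he : e ≠ 0) (u : ℂ × E) (k : ℤ) :
    kummerExp e (u.1 + (e * k : ℤ), u.2) = kummerExp e u := by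
  refine Prod.ext ?_ rfl
  have he' : (e : ℂ) ≠ 0 := by exact_mod_cast he
  simp only [kummerExp]
  rw [Complex.exp_eq_exp_iff_exists_int]
  refine ⟨k, ?_⟩
  push_cast
  field_simp

/-- A local branch of the inverse of the covering map to the Kummer covering. -/
def kummerLogAt (e : ℕ) (u₀ v : ℂ × E) : ℂ × E :=
  (u₀.1 + e * (Complex.log (v.1 / (kummerExp e u₀).1) / (2 * Real.pi * Complex.I)), v.2)

theorem kummerLogAt_self (u₀ : ℂ × E) : kummerLogAt e u₀ (kummerExp e u₀) = u₀ := by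
  simp [kummerLogAt, kummerExp]

theorem kummerExp_kummerLogAt (he : e ≠ 0) (u₀ : ℂ × E) {v : ℂ × E} (hv : v.1 ≠ 0) :
    kummerExp e (kummerLogAt e u₀ v) = v := by
  refine Prod.ext ?_ rfl
  have he' : (e : ℂ) ≠ 0 := by exact_mod_cast he
  change Complex.exp (2 * Real.pi * Complex.I * ((u₀.1 + e * (_ / _)) / e)) = _
  rw [add_div, mul_div_cancel_left₀ _ he', mul_add, mul_div_cancel₀ _ Complex.two_pi_I_ne_zero,
    Complex.exp_add, Complex.exp_log (div_ne_zero hv (kummerExp_fst_ne_zero u₀))]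
  exact mul_div_cancel₀ _ (kummerExp_fst_ne_zero u₀)

variable [NormedAddCommGroup E] [NormedSpace ℂ E]

theorem analyticAt_kummerExp (he : e ≠ 0) (u : ℂ × E) : AnalyticAt ℂ (kummerExp e) u := by
  have he' : (e : ℂ) ≠ 0 := by exact_mod_cast he
  exact (analyticAt_const.mul (analyticAt_fst.div analyticAt_const he')).cexp.prod analyticAt_snd

theorem analyticAt_kummerLogAt (u₀ : ℂ × E) :
    AnalyticAt ℂ (kummerLogAt e u₀) (kummerExp e u₀) := by
  refine (analyticAt_const.add (analyticAt_const.mul (((analyticAt_fst.div analyticAt_const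
    (kummerExp_fst_ne_zero u₀)).clog ?_).div analyticAt_const Complex.two_pi_I_ne_zero))).prod
    analyticAt_snd
  change (kummerExp e u₀).1 / (kummerExp e u₀).1 ∈ Complex.slitPlane
  rw [div_self (kummerExp_fst_ne_zero u₀)]
  simp

end Kummer

/-! ### Level covers over the complement of a hyperplane in a polydisc. -/

namespace PolydiscChart

variable {X : Type u} [TopologicalSpace X] [HolStructure X] {D : Set X} {E : Type}
  [NormedAddCommGroup E] [NormedSpace ℂ E] (P : PolydiscChart D E)
  {r n : ℕ} {L : LocalSystem.{u, v} {x : X // x ∉ D} r} (ι : L.FlatFrame P.proj)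

/-- The frames of `ℤ/n ⊗ ℤʳ`. -/
abbrev StdFrame (r n : ℕ) : Type := (Fin r → ZMod n) ≃ₗ[ZMod n] (ZMod n ⊗[ℤ] (Fin r → ℤ))

open Classical in
/-- The map from the universal cover to the level cover defined by a frame. -/
def lift (F : StdFrame r n) (u : ℂ × E) : L.LevelCover n :=
  if h : u ∈ P.coverSet then ι.toCover F ⟨u, h⟩ else ι.toCover F (Classical.arbitrary P.Cover)

theorem lift_eq (F : StdFrame r n) (t : P.Cover) : P.lift ι F t.1 = ι.toCover F t :=
  dif_pos t.2

/-- Both `proj` and `toCover F` are local isomorphisms. The branch `polarInv` gives a local inverse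
`u` of `proj`, hence a flat frame through the point, and germs are carried back and forth by `polar`
and `polarInv`. -/
theorem holAt_toCover [NeZero n] (F : StdFrame r n) (t₀ : P.Cover) (h : L.LevelCover n → ℂ) :
    HolAt h (ι.toCover F t₀) ↔ AnalyticAt ℂ (fun u => h (P.lift ι F u)) t₀.1 := by
  classical
  let w (z : X) : ℂ × E := polarInv t₀.1 (P.chart z)
  let u (z : {x : X // x ∉ D}) : P.Cover := if h : w z.1 ∈ P.coverSet then ⟨w z.1, h⟩ else t₀
  have hc : ContinuousAt P.chart (P.proj t₀).1 := P.chart.continuousAt (P.proj_mem_source t₀)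
  have hcw : ContinuousAt w (P.proj t₀).1 := by
    refine ContinuousAt.comp (g := polarInv t₀.1) ?_ hc
    rw [P.chart_proj]
    exact (analyticAt_polarInv t₀.1).continuousAt
  have hw0 : w (P.proj t₀).1 = t₀.1 := by
    change polarInv _ (P.chart _) = _
    rw [P.chart_proj, polarInv_polar_self]
  have hwc : ∀ᶠ z in 𝓝 (P.proj t₀).1, w z ∈ P.coverSet := by
    refine hcw.eventually_mem ?_
    rw [hw0]
    exact P.isOpen_coverSet.mem_nhds t₀.2
  have hs : ∀ᶠ z in 𝓝 (P.proj t₀).1, z ∈ P.chart.source :=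
    P.chart.open_source.mem_nhds (P.proj_mem_source t₀)
  have hval : ContinuousAt (Subtype.val : {x : X // x ∉ D} → X) (P.proj t₀) :=
    continuous_subtype_val.continuousAt
  have huw : ∀ᶠ z in 𝓝 (P.proj t₀), (u z).1 = w z.1 := by
    filter_upwards [hval.eventually hwc] with z hz
    simp only [u, dif_pos hz]
  have hu0 : u (P.proj t₀) = t₀ := Subtype.ext (huw.self_of_nhds.trans hw0)
  have hu : ContinuousAt u (P.proj t₀) := by
    rw [Topology.IsInducing.subtypeVal.continuousAt_iff]
    exact (ContinuousAt.comp (f := Subtype.val) hcw hval).congr (huw.mono fun z hz => hz.symm)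
  have hgu : ∀ᶠ z in 𝓝 (P.proj t₀), P.proj (u z) = z := by
    filter_upwards [huw, hval.eventually hs] with z h1 h2
    rw [P.proj_eq_iff _ _ h2, h1]
    exact polar_polarInv _ fun h3 => z.2 ((P.mem_iff _ h2).2 h3)
  obtain ⟨σ, hσ, hσu⟩ := ι.exists_isFlatFrameAt F hu hu0 hgu
  have hpt : ι.toCover F t₀ = ⟨P.proj t₀, σ (P.proj t₀)⟩ := by
    rw [hσu _ (by rw [hu0]), hu0]
  rw [hpt, LocalSystem.LevelCover.holAt_iff hσ]
  constructor
  · rintro ⟨g, hg, hgh⟩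
    rw [P.holAt_iff _ (P.proj_mem_source t₀), P.chart_proj] at hg
    refine (hg.fun_comp (analyticAt_polar t₀.1)).congr ?_
    have h1 : ∀ᶠ t in 𝓝 t₀, h ⟨P.proj t, σ (P.proj t)⟩ = g (P.proj t).1 :=
      P.continuous_proj.continuousAt.eventually hgh
    have h2 : ∀ᶠ t in 𝓝 t₀, (u (P.proj t)).1 = w (P.proj t).1 ∧ P.proj (u (P.proj t)) = P.proj t :=
      P.continuous_proj.continuousAt.eventually (huw.and hgu)
    have h3 : ∀ᶠ v in 𝓝 t₀.1, ∀ hv : v ∈ P.coverSet,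
        (h ⟨P.proj ⟨v, hv⟩, σ (P.proj ⟨v, hv⟩)⟩ = g (P.proj ⟨v, hv⟩).1 ∧
        (u (P.proj ⟨v, hv⟩)).1 = w (P.proj ⟨v, hv⟩).1 ∧
        P.proj (u (P.proj ⟨v, hv⟩)) = P.proj ⟨v, hv⟩) := by
      have h4 := h1.and h2
      rw [nhds_subtype_eq_comap, eventually_comap] at h4
      filter_upwards [h4] with v hv hvc
      exact hv ⟨v, hvc⟩ rfl
    filter_upwards [h3, polarInv_polar t₀.1, P.isOpen_coverSet.mem_nhds t₀.2] with v hv hv' hvc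
    obtain ⟨h5, h6, h7⟩ := hv hvc
    have h8 : u (P.proj ⟨v, hvc⟩) = ⟨v, hvc⟩ := by
      refine Subtype.ext (h6.trans ?_)
      change polarInv _ (P.chart _) = _
      rw [P.chart_proj, hv']
    rw [hσu _ h7, h8] at h5
    change g (P.proj ⟨v, hvc⟩).1 = _
    rw [← h5, ← P.lift_eq ι F ⟨v, hvc⟩]
  · intro ha
    refine ⟨fun x => h (P.lift ι F (w x)), ?_, ?_⟩
    · rw [P.holAt_iff _ (P.proj_mem_source t₀), P.chart_proj]
      have h1 := analyticAt_polarInv t₀.1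
      have h2 : AnalyticAt ℂ (fun z => h (P.lift ι F (polarInv t₀.1 z))) (polar t₀.1) := by
        refine AnalyticAt.fun_comp (g := fun u => h (P.lift ι F u)) ?_ h1
        rwa [polarInv_polar_self]
      refine h2.congr ?_
      filter_upwards [P.chart.open_target.mem_nhds (P.polar_mem_target t₀)] with z hz
      simp only [Function.comp, w, P.chart.right_inv hz]
    · filter_upwards [huw, hgu] with z h1 h2
      rw [hσu _ h2, ← h1, P.lift_eq]


end PolydiscChart

namespace PolydiscChart

variable {X : Type u} [TopologicalSpace X] [HolStructure X] {D : Set X} {E : Type}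
  [NormedAddCommGroup E] [NormedSpace ℂ E] (P : PolydiscChart D E)
  {r n : ℕ} {L : LocalSystem.{u, v} {x : X // x ∉ D} r}

theorem finite_stdTensor [NeZero n] : Finite (ZMod n ⊗[ℤ] (Fin r → ℤ)) :=
  Module.finite_of_finite (ZMod n)

instance [NeZero n] : Finite (StdFrame r n) :=
  haveI := finite_stdTensor (r := r) (n := n)
  Finite.of_injective (fun F => (F : (Fin r → ZMod n) → ZMod n ⊗[ℤ] (Fin r → ℤ)))
    DFunLike.coe_injective

instance : Nonempty (StdFrame r n) :=
  ⟨(TensorProduct.piScalarRight ℤ (ZMod n) (ZMod n) (Fin r)).symm⟩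

variable (A : (Fin r → ℤ) ≃ₗ[ℤ] (Fin r → ℤ))

theorem orderOf_baseChange_pos [NeZero n] : 0 < orderOf (A.baseChange ℤ (ZMod n)) := by
  have := finite_stdTensor (r := r) (n := n)
  have : Finite ((ZMod n ⊗[ℤ] (Fin r → ℤ)) ≃ₗ[ZMod n] (ZMod n ⊗[ℤ] (Fin r → ℤ))) :=
    Finite.of_injective (fun F => (F : ZMod n ⊗[ℤ] (Fin r → ℤ) → ZMod n ⊗[ℤ] (Fin r → ℤ)))
      DFunLike.coe_injective
  exact orderOf_pos _

/-- Frames are equivalent if they differ by a power of the monodromy. -/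
def frameSetoid (n : ℕ) : Setoid (StdFrame r n) where
  r F F' := ∃ k : ℤ, F' = F.trans ((A.baseChange ℤ (ZMod n)) ^ k)
  iseqv :=
    { refl := fun F => ⟨0, by rw [zpow_zero]; rfl⟩
      symm := by
        rintro F _ ⟨k, rfl⟩
        refine ⟨-k, ?_⟩
        rw [zpow_neg]
        ext1 c
        exact (LinearEquiv.symm_apply_apply ((A.baseChange ℤ (ZMod n)) ^ k) (F c)).symm
      trans := by
        rintro F _ _ ⟨k, rfl⟩ ⟨l, rfl⟩
        refine ⟨l + k, ?_⟩
        rw [zpow_add]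
        rfl }

variable (ι : L.FlatFrame P.proj)

/-- Points of the universal cover with the same projection differ by a translation by some `k`,
which changes the frame by `A ^ k`. At a fixed point, the frame is determined by its image in the
level cover. -/
theorem toCover_eq_iff {A : (Fin r → ℤ) ≃ₗ[ℤ] (Fin r → ℤ)}
    (hA : ∀ v t, ι.sec v (P.proj t) ((1 : ℤ) +ᵥ t) = ι.sec (A v) (P.proj t) t)
    {F F' : StdFrame r n} {t t' : P.Cover} : ι.toCover F t = ι.toCover F' t' ↔
      ∃ k : ℤ, t = k +ᵥ t' ∧ F' = F.trans ((A.baseChange ℤ (ZMod n)) ^ k) := by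
  constructor
  · intro h
    obtain ⟨k, rfl⟩ := P.exists_vadd_eq (congrArg LocalSystem.LevelCover.pt h)
    rw [ι.toCover_vadd P.proj_vadd hA] at h
    exact ⟨k, rfl, (ι.toCover_injective t' h).symm⟩
  · rintro ⟨k, rfl, rfl⟩
    rw [ι.toCover_vadd P.proj_vadd hA]

variable {A}

/-- The map from the Kummer covering to the level cover defined by a frame. -/
def sheet (A : (Fin r → ℤ) ≃ₗ[ℤ] (Fin r → ℤ)) (F : StdFrame r n) (v : ℂ × E) : L.LevelCover n :=
  P.lift ι F (kummerLog (orderOf (A.baseChange ℤ (ZMod n))) v)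

/-- The principal lift differs from `t` by a multiple of the order of `A` mod `n`, under which
frames do not change. The cut of the logarithm is therefore invisible in `sheet`. -/
theorem sheet_kummerExp [NeZero n]
    (hA : ∀ v t, ι.sec v (P.proj t) ((1 : ℤ) +ᵥ t) = ι.sec (A v) (P.proj t) t)
    (F : StdFrame r n) (t : P.Cover) :
    P.sheet ι A F (kummerExp (orderOf (A.baseChange ℤ (ZMod n))) t.1) = ι.toCover F t := by
  obtain ⟨k, hk⟩ := kummerLog_kummerExp (orderOf_baseChange_pos (n := n) A).ne' t.1
  rw [sheet, hk, ← P.coe_vadd, lift_eq, ι.toCover_vadd P.proj_vadd hA, zpow_mul, zpow_natCast,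
    pow_orderOf_eq_one, one_zpow]
  rfl

theorem kummerLog_mem_coverSet {e : ℕ} (he : e ≠ 0) {v : ℂ × E} (h0 : v.1 ≠ 0)
    (hv : (v.1 ^ e, v.2) ∈ P.base) : kummerLog e v ∈ P.coverSet := by
  change polar _ ∈ P.base
  rwa [polar_kummerLog he h0]

/-- The level cover is a disjoint union of Kummer coverings, whose degree is the order of the
monodromy. -/
def kummerModel [NeZero n]
    (hA : ∀ v t, ι.sec v (P.proj t) ((1 : ℤ) +ᵥ t) = ι.sec (A v) (P.proj t) t) :
    KummerModel D (L.levelMap n) E where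
  chart := P.chart
  holAt_iff := P.holAt_iff
  mem_iff := P.mem_iff
  base := P.base
  isOpen_base := P.isOpen_base
  base_subset z hz := P.mem_target z hz.1 hz.2
  e := orderOf (A.baseChange ℤ (ZMod n))
  e_pos := orderOf_baseChange_pos A
  -- One sheet for each orbit of the monodromy on frames; the orbits have length `e` since a
  -- nontrivial power of the reduced `A` fixes no frame.
  ι := Quotient (frameSetoid A n)
  fintype := Fintype.ofFinite _
  nonempty := Nonempty.map (Quotient.mk (frameSetoid A n)) inferInstance
  sheet i := P.sheet ι A i.out
  map_sheet i v h0 hv := by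
    have he := (orderOf_baseChange_pos (n := n) A).ne'
    rw [sheet, P.lift_eq ι _ ⟨_, P.kummerLog_mem_coverSet he h0 hv⟩]
    change P.chart.symm (polar _) = _
    rw [polar_kummerLog he h0]
  exists_sheet m hs hb := by
    have he := (orderOf_baseChange_pos (n := n) A).ne'
    have h0 : (P.chart m.pt.1).1 ≠ 0 := fun h => m.pt.2 ((P.mem_iff _ hs).2 h)
    -- For degree one, `kummerLog` is the principal logarithm divided by `2πi`, which lifts the base
    -- point to the universal cover.
    have h1 : polar (kummerLog 1 (P.chart m.pt.1)) = P.chart m.pt.1 := by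
      rw [polar_kummerLog one_ne_zero h0, pow_one]
    let t : P.Cover := ⟨kummerLog 1 (P.chart m.pt.1), by
      change polar _ ∈ P.base
      rw [h1]
      exact hb⟩
    have ht : P.proj t = m.pt := (P.proj_eq_iff _ _ hs).2 h1
    obtain ⟨F, hF⟩ := ι.exists_toCover_eq m ht
    -- The frame differs from the chosen representative of its orbit by a power of the monodromy;
    -- translating `t` by `k` absorbs it.
    obtain ⟨k, hk⟩ : ∃ k : ℤ, F = (Quotient.out (Quotient.mk (frameSetoid A n) F)).trans
      ((A.baseChange ℤ (ZMod n)) ^ k) := Quotient.exact (s := frameSetoid A n) (Quotient.out_eq _)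
    refine ⟨Quotient.mk (frameSetoid A n) F,
      kummerExp (orderOf (A.baseChange ℤ (ZMod n))) (k +ᵥ t : P.Cover).1,
      kummerExp_fst_ne_zero _, ?_, ?_⟩
    · rw [kummerExp_pow he]
      exact (k +ᵥ t : P.Cover).2
    · rw [P.sheet_kummerExp ι hA, ι.toCover_vadd P.proj_vadd hA, ← hk, hF]
  sheet_inj i j v v' h0 hv h0' hv' h := by
    have he := (orderOf_baseChange_pos (n := n) A).ne'
    rw [sheet, sheet, P.lift_eq ι _ ⟨_, P.kummerLog_mem_coverSet he h0 hv⟩,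
      P.lift_eq ι _ ⟨_, P.kummerLog_mem_coverSet he h0' hv'⟩, P.toCover_eq_iff ι hA] at h
    obtain ⟨k, hk, hF⟩ := h
    have hij : i = j := by
      rw [← Quotient.out_eq i, ← Quotient.out_eq j]
      exact Quotient.sound ⟨k, hF⟩
    refine ⟨hij, ?_⟩
    subst hij
    -- A power that fixes a frame is the identity, as frames are surjective. So `k` is a multiple of
    -- `e`, and translation by such `k` does not change `kummerExp`.
    have hk1 : (A.baseChange ℤ (ZMod n)) ^ k = 1 := by
      ext1 c
      obtain ⟨b, rfl⟩ := (Quotient.out i).surjective c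
      exact (LinearEquiv.congr_fun hF b).symm
    obtain ⟨l, rfl⟩ := orderOf_dvd_iff_zpow_eq_one.2 hk1
    rw [← kummerExp_kummerLog he h0, ← kummerExp_kummerLog he h0']
    have h1 := congrArg Subtype.val hk
    rw [P.coe_vadd] at h1
    rw [show kummerLog _ v = _ from h1, kummerExp_add_mul he]
  holAt_sheet i v h0 hv h := by
    have he := (orderOf_baseChange_pos (n := n) A).ne'
    set e := orderOf (A.baseChange ℤ (ZMod n)) with he_def
    let t : P.Cover := ⟨kummerLog e v, P.kummerLog_mem_coverSet he h0 hv⟩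
    have hvt : kummerExp e t.1 = v := kummerExp_kummerLog he h0
    have h1 : P.sheet ι A i.out v = ι.toCover i.out t := P.lift_eq ι _ t
    rw [h1, P.holAt_toCover]
    constructor
    · intro ha
      have h2 := analyticAt_kummerLogAt (e := e) t.1
      have h3 : AnalyticAt ℂ (fun z => h (P.lift ι i.out (kummerLogAt e t.1 z)))
          (kummerExp e t.1) := by
        refine AnalyticAt.fun_comp (g := fun u => h (P.lift ι i.out u)) ?_ h2
        rwa [kummerLogAt_self]
      rw [hvt] at h3
      have h4 : ContinuousAt (kummerLogAt e t.1) v := by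
        rw [← hvt]
        exact h2.continuousAt
      refine h3.congr ?_
      have h5 : ∀ᶠ z in 𝓝 v, kummerLogAt e t.1 z ∈ P.coverSet := by
        refine h4.eventually_mem (P.isOpen_coverSet.mem_nhds ?_)
        rw [← hvt, kummerLogAt_self]
        exact t.2
      have h6 : ∀ᶠ z : ℂ × E in 𝓝 v, z.1 ≠ 0 := continuousAt_fst.eventually_ne h0
      filter_upwards [h5, h6] with z hz hz0
      rw [P.lift_eq ι i.out ⟨_, hz⟩, ← P.sheet_kummerExp ι hA]
      simp only [Function.comp, ← he_def, kummerExp_kummerLogAt he t.1 hz0]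
    · intro ha
      have h2 : AnalyticAt ℂ (fun u => (h ∘ P.sheet ι A i.out) (kummerExp e u)) t.1 := by
        refine AnalyticAt.fun_comp (g := h ∘ P.sheet ι A i.out) ?_ (analyticAt_kummerExp he _)
        rwa [hvt]
      refine h2.congr ?_
      filter_upwards [P.isOpen_coverSet.mem_nhds t.2] with u hu
      rw [P.lift_eq ι i.out ⟨u, hu⟩, ← P.sheet_kummerExp ι hA]
      rfl

/-- The monodromy along a circle in the polydisc. -/
theorem isMonodromy_conj (hA : ∀ v t, ι.sec v (P.proj t) ((1 : ℤ) +ᵥ t) = ι.sec (A v) (P.proj t) t)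
    {x : {x : X // x ∉ D}} {γ : Path x x} {T : L.stalk x ≃ₗ[ℤ] L.stalk x} (hT : L.IsMonodromy γ T)
    (hγ : ∀ t : unitInterval, (γ t).1 =
      P.chart.symm (Complex.exp (2 * Real.pi * Complex.I * (t : ℝ)), 0)) :
    ∃ e : (Fin r → ℤ) ≃ₗ[ℤ] L.stalk x, ∀ v, T (e v) = e (A v) := by
  -- The loop lifts to the real segment from `0` to `1`, whose endpoint is the translate of its
  -- origin by `1`. Transport along the loop thus compares the frame with its translate.
  let φ (t : unitInterval) : P.Cover := ⟨(((t : ℝ) : ℂ), 0), P.real_mem_coverSet t⟩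
  have hφ : Continuous φ := by
    refine Continuous.subtype_mk (f := fun t : unitInterval => ((((t : ℝ) : ℂ), 0) : ℂ × E)) ?_ _
    fun_prop
  have hγφ (t : unitInterval) : P.proj (φ t) = γ t := Subtype.ext (hγ t).symm
  have hx : P.proj (φ 0) = x := (hγφ 0).trans γ.source
  refine ⟨ι.equiv hx, fun v => ?_⟩
  obtain ⟨s, hs0, hs1, hs⟩ := hT (ι.equiv hx v)
  have h1 : L.FlatAlong γ (fun z t => ι.sec v z (φ t)) := by
    have h2 := (ι.flat v).comp hφ
    rwa [show P.proj ∘ φ = γ from funext hγφ] at h2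
  have h3 : ∀ z, z = x → s z 0 = ι.sec v z (φ 0) := by
    rintro _ rfl
    rw [hs0, ι.equiv_apply]
  have h4 := LocalSystem.FlatAlong.eq_of_eq γ.continuous hs h1 (h3 _ γ.source) 1
  have h5 : ∀ z, γ 1 = z → s z 1 = ι.sec v z (φ 1) := by
    rintro _ rfl
    exact h4
  have h6 : φ 1 = (1 : ℤ) +ᵥ φ 0 := by
    refine Subtype.ext (Prod.ext ?_ rfl)
    rw [P.coe_vadd]
    simp [φ]
  rw [← hs1, h5 _ γ.target, h6, ι.equiv_apply]
  have h7 := hA v (φ 0)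
  rwa [hx] at h7

end PolydiscChart

/-! ### From adapted charts to Kummer models. -/

namespace AdaptedChart

variable {X : Type u} [TopologicalSpace X] [HolStructure X] {D : Set X} {x : X}
  (c : AdaptedChart D x)

/-- The splitting of the first coordinate. -/
def consHomeomorph (n : ℕ) : (Fin (n + 1) → ℂ) ≃L[ℂ] ℂ × (Fin n → ℂ) :=
  (Fin.consEquivL ℂ (fun _ : Fin (n + 1) => ℂ)).symm

theorem consHomeomorph_fst {n : ℕ} (z : Fin (n + 1) → ℂ) : (consHomeomorph n z).1 = z 0 := rfl

theorem consHomeomorph_symm_zero (n : ℕ) (z : ℂ) :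
    (consHomeomorph n).symm (z, 0) = Pi.single 0 z := by
  rw [ContinuousLinearEquiv.symm_apply_eq]
  refine Prod.ext ?_ ?_
  · simp [consHomeomorph_fst]
  · funext i
    change 0 = (Pi.single 0 z : Fin (n + 1) → ℂ) i.succ
    simp

/-- The chart with values in a product. -/
def prodChart : OpenPartialHomeomorph X (ℂ × (Fin c.dim → ℂ)) :=
  c.chart.transHomeomorph (consHomeomorph c.dim).toHomeomorph

theorem prodChart_apply (y : X) : c.prodChart y = consHomeomorph c.dim (c.chart y) := rfl

theorem prodChart_symm_apply (z : ℂ × (Fin c.dim → ℂ)) :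
    c.prodChart.symm z = c.chart.symm ((consHomeomorph c.dim).symm z) := rfl

theorem prodChart_point : c.prodChart x = 0 := by
  rw [prodChart_apply, c.map_point, map_zero]

theorem mem_prodChart_target (z : ℂ) (hz : ‖z‖ ≤ 1) :
    ((z, 0) : ℂ × (Fin c.dim → ℂ)) ∈ c.prodChart.target := by
  change (consHomeomorph c.dim).symm (z, 0) ∈ c.chart.target
  rw [consHomeomorph_symm_zero]
  exact c.disk z hz

theorem prodChart_holAt_iff (y : X) (hy : y ∈ c.prodChart.source) (f : X → ℂ) :
    HolAt f y ↔ AnalyticAt ℂ (f ∘ c.prodChart.symm) (c.prodChart y) := by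
  rw [c.holAt_iff y hy]
  constructor
  · intro h
    refine AnalyticAt.comp (g := f ∘ c.chart.symm) ?_
      ((consHomeomorph c.dim).symm.toContinuousLinearMap.analyticAt _)
    simpa [prodChart_apply] using h
  · intro h
    have h1 : f ∘ c.chart.symm = (f ∘ c.prodChart.symm) ∘ consHomeomorph c.dim := by
      funext z
      simp [prodChart_symm_apply]
    rw [h1]
    exact AnalyticAt.comp h ((consHomeomorph c.dim).toContinuousLinearMap.analyticAt _)

theorem prodChart_mem_iff (y : X) (hy : y ∈ c.prodChart.source) :
    y ∈ D ↔ (c.prodChart y).1 = 0 :=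
  c.mem_iff y hy

/-- Compactness of the closed unit disc of the axis (tube lemma) provides the margin. A radius
larger than `1` keeps the meridian, of radius exactly `1`, inside the polydisc. -/
theorem exists_polydisc_subset : ∃ R : ℝ, 1 < R ∧ ∃ ε : ℝ, 0 < ε ∧
    ∀ z : ℂ × (Fin c.dim → ℂ), ‖z.1‖ < R → ‖z.2‖ < ε → z ∈ c.prodChart.target := by
  obtain ⟨U, V, hU, hV, hsU, htV, h⟩ := generalized_tube_lemma (isCompact_closedBall (0 : ℂ) 1)
    (isCompact_singleton (x := (0 : Fin c.dim → ℂ))) c.prodChart.open_target (by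
      rintro ⟨z, b⟩ ⟨hz, rfl : b = 0⟩
      exact c.mem_prodChart_target z (by simpa using hz))
  obtain ⟨δ, hδ, hδU⟩ := (isCompact_closedBall (0 : ℂ) 1).exists_thickening_subset_open hU hsU
  rw [thickening_closedBall hδ zero_le_one] at hδU
  obtain ⟨ε, hε, hεV⟩ := Metric.isOpen_iff.1 hV 0 (htV rfl)
  refine ⟨δ + 1, by linarith, ε, hε, fun z h1 h2 => h ⟨hδU ?_, hεV ?_⟩⟩
  · simpa using h1
  · simpa using h2

/-- The restriction of an adapted chart to a polydisc. -/
def polydiscChart : PolydiscChart D (Fin c.dim → ℂ) where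
  chart := c.prodChart
  holAt_iff := c.prodChart_holAt_iff
  mem_iff := c.prodChart_mem_iff
  radius := c.exists_polydisc_subset.choose
  one_lt_radius := c.exists_polydisc_subset.choose_spec.1
  ε := c.exists_polydisc_subset.choose_spec.2.choose
  ε_pos := c.exists_polydisc_subset.choose_spec.2.choose_spec.1
  mem_target := c.exists_polydisc_subset.choose_spec.2.choose_spec.2

/-- Near a smooth point of the divisor, the level covers are disjoint unions of Kummer coverings;
their degrees are the orders of the reductions of the monodromy. -/
theorem exists_kummerModel {r : ℕ} (L : LocalSystem.{u, v} {x : X // x ∉ D} r)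
    {T : L.stalk c.basePoint ≃ₗ[ℤ] L.stalk c.basePoint} (hT : L.IsMonodromy c.meridian T) :
    ∃ A : (Fin r → ℤ) ≃ₗ[ℤ] (Fin r → ℤ),
      (∃ e : (Fin r → ℤ) ≃ₗ[ℤ] L.stalk c.basePoint, ∀ v, T (e v) = e (A v)) ∧
      ∀ n : ℕ, n ≠ 0 → ∃ K : KummerModel.{u, max u v, 0} D (L.levelMap n) (Fin c.dim → ℂ),
        x ∈ K.chart.source ∧ K.chart x ∈ K.base ∧ K.e = orderOf (A.baseChange ℤ (ZMod n)) := by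
  obtain ⟨ι⟩ := L.nonempty_flatFrame c.polydiscChart.continuous_proj
  obtain ⟨A, hA⟩ := ι.exists_monodromy c.polydiscChart.proj_vadd c.polydiscChart.continuous_proj
    (c.polydiscChart.continuous_vadd 1)
  refine ⟨A, c.polydiscChart.isMonodromy_conj ι hA hT fun t => ?_, fun n hn => ?_⟩
  · change _ = c.chart.symm ((consHomeomorph c.dim).symm _)
    rw [consHomeomorph_symm_zero]
    rfl
  · have : NeZero n := ⟨hn⟩
    refine ⟨c.polydiscChart.kummerModel ι hA, c.mem_source, ?_, rfl⟩
    change ‖(c.prodChart x).1‖ < _ ∧ ‖(c.prodChart x).2‖ < _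
    rw [c.prodChart_point]
    simpa using ⟨by linarith [c.polydiscChart.one_lt_radius], c.polydiscChart.ε_pos⟩

end AdaptedChart

/-! ### Reductions of quasi-unipotent automorphisms -/

/-- The common exponent of the roots of an integral polynomial with roots of modulus one. -/
theorem Polynomial.Monic.exists_dvd_X_pow_sub_one_pow {P : Polynomial ℤ} (hP : P.Monic)
    (h : ∀ z : ℂ, (P.map (algebraMap ℤ ℂ)).IsRoot z → ‖z‖ = 1) :
    ∃ m : ℕ, 0 < m ∧ P.map (algebraMap ℤ ℂ) ∣ (Polynomial.X ^ m - 1) ^ P.natDegree := by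
  classical
  set Q := P.map (algebraMap ℤ ℂ) with hQ
  have hQm : Q.Monic := hP.map _
  -- A monic polynomial with all roots on the unit circle has Mahler measure one; Kronecker's
  -- theorem then makes its roots, which are nonzero, roots of unity.
  have hmahler : Q.mahlerMeasure = 1 := by
    rw [Polynomial.mahlerMeasure_eq_leadingCoeff_mul_prod_roots, hQm.leadingCoeff, norm_one, one_mul]
    refine Multiset.prod_eq_one fun a ha => ?_
    obtain ⟨z, hz, rfl⟩ := Multiset.mem_map.1 ha
    rw [h z (Polynomial.isRoot_of_mem_roots hz), max_self]
  have hroot (z : ℂ) (hz : z ∈ Q.roots) : ∃ n, 0 < n ∧ z ^ n = 1 := by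
    have hz1 := h z (Polynomial.isRoot_of_mem_roots hz)
    refine Polynomial.pow_eq_one_of_mahlerMeasure_eq_one (p := P) hmahler ?_ hz
    rintro rfl
    simp at hz1
  choose! n hn0 hn using hroot
  -- The product of the exponents of the distinct roots makes each linear factor divide `X ^ m - 1`;
  -- multiplicities are absorbed by the power `natDegree`.
  refine ⟨∏ z ∈ Q.roots.toFinset, n z, Finset.prod_pos fun z hz =>
    hn0 z (Multiset.mem_toFinset.1 hz), ?_⟩
  have hsplit : Q = (Q.roots.map fun a => Polynomial.X - Polynomial.C a).prod :=
    (IsAlgClosed.splits Q).eq_prod_roots_of_monic hQm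
  have hcard : Multiset.card Q.roots = P.natDegree := by
    rw [IsAlgClosed.card_roots_eq_natDegree, hQ, hP.natDegree_map]
  rw [← hcard]
  nth_rewrite 1 [hsplit]
  have hdvd : ∀ a ∈ Q.roots.map fun a => Polynomial.X - Polynomial.C a,
      a ∣ (Polynomial.X ^ (∏ z ∈ Q.roots.toFinset, n z) - 1 : Polynomial ℂ) := by
    intro a ha
    obtain ⟨z, hz, rfl⟩ := Multiset.mem_map.1 ha
    rw [Polynomial.dvd_iff_isRoot]
    obtain ⟨k, hk⟩ := Finset.dvd_prod_of_mem n (Multiset.mem_toFinset.2 hz)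
    simp [hk, pow_mul, hn z hz]
  have h1 := Multiset.prod_dvd_prod_of_dvd (S := Q.roots) (fun a => Polynomial.X - Polynomial.C a)
    (fun _ => (Polynomial.X ^ (∏ z ∈ Q.roots.toFinset, n z) - 1 : Polynomial ℂ))
    fun a ha => hdvd _ (Multiset.mem_map_of_mem _ ha)
  simpa using h1

/-- An endomorphism of a free abelian group all of whose eigenvalues have modulus one is
quasi-unipotent. -/
theorem Module.End.exists_isNilpotent_pow_sub_one {M : Type*} [AddCommGroup M] [Module.Free ℤ M]
    [Module.Finite ℤ M] (f : Module.End ℤ M)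
    (h : ∀ μ : ℂ, Module.End.HasEigenvalue (LinearMap.baseChange ℂ f) μ → ‖μ‖ = 1) :
    ∃ m : ℕ, 0 < m ∧ IsNilpotent (f ^ m - 1) := by
  obtain ⟨m, hm, k, hk⟩ := f.charpoly_monic.exists_dvd_X_pow_sub_one_pow fun z hz => h z (by
    rw [Module.End.hasEigenvalue_iff_isRoot_charpoly, LinearMap.charpoly_baseChange]
    exact hz)
  refine ⟨m, hm, f.charpoly.natDegree, ?_⟩
  -- Cayley–Hamilton over `ℂ`. The relation descends to `ℤ` because base change of endomorphisms of
  -- a free module is injective.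
  have h1 : (Module.End.baseChangeHom ℤ ℂ M f ^ m - 1) ^ f.charpoly.natDegree = 0 := by
    have h2 := congrArg (Polynomial.aeval (LinearMap.baseChange ℂ f)) hk
    rw [map_mul, ← LinearMap.charpoly_baseChange, LinearMap.aeval_self_charpoly, zero_mul] at h2
    simp only [map_pow, map_sub, map_one, Polynomial.aeval_X] at h2
    exact h2
  have h3 : Function.Injective (Module.End.baseChangeHom ℤ ℂ M) :=
    LinearMap.baseChangeHom_injective ℤ M ℂ
  apply h3
  simpa using h1

/-- A unipotent element of finite order `d` of an algebra in which `d` is invertible is trivial. -/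
theorem eq_one_of_isNilpotent_sub_one {R : Type*} [Ring R] {x : R} (hx : IsNilpotent (x - 1))
    {d : ℕ} (hd : IsUnit (d : R)) (h : x ^ d = 1) : x = 1 := by
  have h1 : (x - 1) * ∑ i ∈ Finset.range d, x ^ i = 0 := by rw [mul_geom_sum, h, sub_self]
  -- The geometric sum is congruent to `d` modulo the nilpotent `x - 1`, hence is a unit, while its
  -- product with `x - 1` vanishes.
  have h2 : ∑ i ∈ Finset.range d, x ^ i =
      d + (x - 1) * ∑ i ∈ Finset.range d, ∑ j ∈ Finset.range i, x ^ j := by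
    rw [Finset.mul_sum]
    simp_rw [mul_geom_sum, Finset.sum_sub_distrib]
    simp
  have hc : Commute (x - 1) (∑ i ∈ Finset.range d, ∑ j ∈ Finset.range i, x ^ j) :=
    Commute.sum_right _ _ _ fun i _ => Commute.sum_right _ _ _ fun j _ =>
      ((Commute.refl x).pow_right j).sub_left (Commute.one_left _)
  have h3 : IsUnit (∑ i ∈ Finset.range d, x ^ i) := by
    rw [h2]
    exact (hc.isNilpotent_mul_right hx).isUnit_add_left_of_commute hd (Nat.commute_cast _ _)
  rwa [h3.mul_left_eq_zero, sub_eq_zero] at h1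

theorem LinearEquiv.baseChange_pow_toLinearMap {M : Type*} [AddCommGroup M] (n : ℕ) (A : M ≃ₗ[ℤ] M) (k : ℕ) :
    ((A.baseChange ℤ (ZMod n) ^ k : (ZMod n ⊗[ℤ] M) ≃ₗ[ZMod n] (ZMod n ⊗[ℤ] M))
      : Module.End (ZMod n) (ZMod n ⊗[ℤ] M)) =
      Module.End.baseChangeHom ℤ (ZMod n) M A.toLinearMap ^ k :=
  map_pow (LinearEquiv.automorphismGroup.toLinearMapMonoidHom (R := ZMod n)) _ k

/-- For almost all primes `p`, the order of the reduction modulo `p` of an automorphism of `ℤʳ` of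
infinite order with eigenvalues of modulus one is divisible by `p`. -/
theorem LinearEquiv.finite_setOf_not_dvd_orderOf {r : ℕ} (A : (Fin r → ℤ) ≃ₗ[ℤ] (Fin r → ℤ))
    (hA : ¬ IsOfFinOrder A)
    (h : ∀ μ : ℂ, Module.End.HasEigenvalue (LinearMap.baseChange ℂ A.toLinearMap) μ → ‖μ‖ = 1) :
    {p : ℕ | p.Prime ∧ ¬ p ∣ orderOf (A.baseChange ℤ (ZMod p))}.Finite := by
  classical
  obtain ⟨m, hm, hnil⟩ := Module.End.exists_isNilpotent_pow_sub_one A.toLinearMap h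
  have hpow (k : ℕ) : ((A ^ k : (Fin r → ℤ) ≃ₗ[ℤ] (Fin r → ℤ)) : Module.End ℤ (Fin r → ℤ)) =
      A.toLinearMap ^ k := map_pow (LinearEquiv.automorphismGroup.toLinearMapMonoidHom (R := ℤ)) _ k
  have hne : A.toLinearMap ^ m - 1 ≠ 0 := by
    intro h0
    refine hA (isOfFinOrder_iff_pow_eq_one.2 ⟨m, hm, ?_⟩)
    apply LinearEquiv.toLinearMap_injective
    rw [hpow, sub_eq_zero.1 h0]
    rfl
  obtain ⟨v, hv⟩ : ∃ v, (A.toLinearMap ^ m - 1) v ≠ 0 := by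
    by_contra! h0
    exact hne (LinearMap.ext h0)
  obtain ⟨i, hi⟩ := Function.ne_iff.1 hv
  -- The exceptional primes are among the divisors of one nonzero coordinate of `(A ^ m - 1) v`,
  -- chosen independently of `p`.
  refine (Nat.primeFactors ((A.toLinearMap ^ m - 1) v i).natAbs).finite_toSet.subset ?_
  rintro p ⟨hp, hpd⟩
  have : Fact p.Prime := ⟨hp⟩
  refine Finset.mem_coe.2 (Nat.mem_primeFactors.2 ⟨hp, ?_, by simpa using hi⟩)
  set d := orderOf (A.baseChange ℤ (ZMod p)) with hd
  let φ := Module.End.baseChangeHom ℤ (ZMod p) (Fin r → ℤ)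
  have h1 : φ A.toLinearMap ^ d = 1 := by
    rw [← LinearEquiv.baseChange_pow_toLinearMap, hd, pow_orderOf_eq_one]
    rfl
  have hunit : IsUnit (d : Module.End (ZMod p) (ZMod p ⊗[ℤ] (Fin r → ℤ))) := by
    have h2 : IsUnit (d : ZMod p) := by
      rw [isUnit_iff_ne_zero, Ne, ZMod.natCast_eq_zero_iff]
      exact hpd
    simpa using h2.map (algebraMap (ZMod p) (Module.End (ZMod p) (ZMod p ⊗[ℤ] (Fin r → ℤ))))
  -- When `p` does not divide the order `d`, `d` is invertible mod `p`, and the reduction of `A ^ m`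
  -- is unipotent and killed by `d`.
  have h3 : φ (A.toLinearMap ^ m) = 1 := by
    refine eq_one_of_isNilpotent_sub_one ?_ hunit ?_
    · have := hnil.map φ
      rwa [map_sub, map_one] at this
    · rw [map_pow, ← pow_mul, mul_comm, pow_mul, h1, one_pow]
  have h4 : (1 : ZMod p) ⊗ₜ[ℤ] ((A.toLinearMap ^ m - 1) v) = 0 := by
    have h5 : φ (A.toLinearMap ^ m - 1) = 0 := by rw [map_sub, h3, map_one, sub_self]
    exact LinearMap.congr_fun h5 (1 ⊗ₜ v)
  have h6 := congrFun (congrArg (TensorProduct.piScalarRight ℤ (ZMod p) (ZMod p) (Fin r)) h4) i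
  rw [TensorProduct.piScalarRight_apply, TensorProduct.piScalarRightHom_tmul, map_zero] at h6
  have h7 : (((A.toLinearMap ^ m - 1) v i : ℤ) : ZMod p) = 0 := by simpa using h6
  exact Int.natCast_dvd.1 ((ZMod.intCast_zmod_eq_zero_iff_dvd _ _).1 h7)

/-- Eigenvalues of conjugate endomorphisms. -/
theorem Module.End.HasEigenvalue.of_baseChange_conj {M N : Type*} [AddCommGroup M] [AddCommGroup N]
    (e : M ≃ₗ[ℤ] N) {A : M →ₗ[ℤ] M} {T : N →ₗ[ℤ] N} (h : ∀ v, T (e v) = e (A v)) {μ : ℂ}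
    (hμ : Module.End.HasEigenvalue (LinearMap.baseChange ℂ A) μ) :
    Module.End.HasEigenvalue (LinearMap.baseChange ℂ T) μ := by
  obtain ⟨x, hx⟩ := hμ.exists_hasEigenvector
  let E := e.baseChange ℤ ℂ
  have h1 : LinearMap.baseChange ℂ T (E x) = E (LinearMap.baseChange ℂ A x) := by
    have h2 : LinearMap.baseChange ℂ T ∘ₗ LinearMap.baseChange ℂ e.toLinearMap =
        LinearMap.baseChange ℂ e.toLinearMap ∘ₗ LinearMap.baseChange ℂ A := by
      rw [← LinearMap.baseChange_comp, ← LinearMap.baseChange_comp]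
      congr 1
      exact LinearMap.ext h
    exact LinearMap.congr_fun h2 x
  refine Module.End.hasEigenvalue_of_hasEigenvector (x := E x) ⟨?_, ?_⟩
  · rw [Module.End.mem_eigenspace_iff, h1, hx.apply_eq_smul, map_smul]
  · simpa using hx.2

theorem LinearEquiv.isOfFinOrder_of_conj {M N : Type*} [AddCommGroup M] [AddCommGroup N]
    (e : M ≃ₗ[ℤ] N) {A : M ≃ₗ[ℤ] M} {T : N ≃ₗ[ℤ] N} (h : ∀ v, T (e v) = e (A v))
    (hA : IsOfFinOrder A) : IsOfFinOrder T := by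
  obtain ⟨k, hk, hAk⟩ := isOfFinOrder_iff_pow_eq_one.1 hA
  refine isOfFinOrder_iff_pow_eq_one.2 ⟨k, hk, ?_⟩
  have h1 : ∀ (k : ℕ) v, (T ^ k) (e v) = e ((A ^ k) v) := by
    intro k
    induction k with
    | zero => exact fun v => rfl
    | succ k ih =>
      intro v
      rw [pow_succ', pow_succ', LinearEquiv.mul_apply, LinearEquiv.mul_apply, ih, h]
  ext1 b
  obtain ⟨v, rfl⟩ := e.surjective b
  rw [h1, hAk]
  rfl

/-! ### Locally constant predicates on complements of zero sets -/

/-- A predicate which is locally constant on a set `S`, near the points of a connected subset of the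
closure of `S`, is constant. -/
theorem IsPreconnected.exists_forall_eventually_iff {Y : Type*} [TopologicalSpace Y] {W S : Set Y}
    (hW : IsPreconnected W) (hd : W ⊆ closure S) {P : Y → Prop}
    (h : ∀ y ∈ W, ∃ q : Prop, ∀ᶠ a in 𝓝[S] y, (P a ↔ q)) :
    ∃ q : Prop, ∀ y ∈ W, ∀ᶠ a in 𝓝[S] y, (P a ↔ q) := by
  let O (q : Prop) : Set Y := {y | ∀ᶠ a in 𝓝[S] y, (P a ↔ q)}
  have hO (q : Prop) : IsOpen (O q) := by
    rw [isOpen_iff_mem_nhds]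
    intro y hy
    have h1 : ∀ᶠ a in 𝓝 y, a ∈ S → (P a ↔ q) := eventually_nhdsWithin_iff.1 hy
    filter_upwards [eventually_eventually_nhds.2 h1] with z hz
    exact eventually_nhdsWithin_iff.2 hz
  have hcover : W ⊆ O True ∪ O False := by
    intro y hy
    obtain ⟨q, hq⟩ := h y hy
    by_cases hq' : q
    · left
      exact hq.mono fun a ha => by simpa [hq'] using ha
    · right
      exact hq.mono fun a ha => by simpa [hq'] using ha
  have hdisj : W ∩ (O True ∩ O False) = ∅ := by
    refine Set.eq_empty_of_forall_notMem fun y hy => ?_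
    have : (𝓝[S] y).NeBot := mem_closure_iff_nhdsWithin_neBot.1 (hd hy.1)
    obtain ⟨a, h1, h2⟩ := (Eventually.and (show ∀ᶠ a in 𝓝[S] y, (P a ↔ True) from hy.2.1)
      (show ∀ᶠ a in 𝓝[S] y, (P a ↔ False) from hy.2.2)).exists
    exact h2.1 (h1.2 trivial)
  rcases isPreconnected_iff_subset_of_disjoint.1 hW _ _ (hO True) (hO False) hcover hdisj with h1 | h1
  · exact ⟨True, fun y hy => h1 hy⟩
  · exact ⟨False, fun y hy => h1 hy⟩

/-- The punctured disc is the image of a half plane under a translated exponential. -/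
theorem isPreconnected_ball_diff_singleton (c : ℂ) (δ : ℝ) :
    IsPreconnected (Metric.ball c δ \ {c}) := by
  rcases le_or_gt δ 0 with hδ | hδ
  · rw [Metric.ball_eq_empty.2 hδ, Set.empty_sdiff]
    exact isPreconnected_empty
  have h1 : Metric.ball c δ \ {c} =
      (fun w => c + Complex.exp w) '' {w : ℂ | w.re < Real.log δ} := by
    ext z
    constructor
    · rintro ⟨h1, h2⟩
      have h3 : z - c ≠ 0 := sub_ne_zero.2 h2
      refine ⟨Complex.log (z - c), ?_, ?_⟩
      · rw [Set.mem_ofPred_eq, Complex.log_re]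
        exact Real.log_lt_log (norm_pos_iff.2 h3) (by simpa [dist_eq_norm] using h1)
      · simp [Complex.exp_log h3]
    · rintro ⟨w, hw, rfl⟩
      refine ⟨?_, ?_⟩
      · rw [Metric.mem_ball, dist_eq_norm, add_sub_cancel_left, Complex.norm_exp]
        exact (Real.lt_log_iff_exp_lt hδ).1 hw
      · simp [Complex.exp_ne_zero]
  rw [h1]
  exact (convex_halfSpace_re_lt _).isPreconnected.image _ (by fun_prop)

/-- A predicate which is locally constant off the zeros of an analytic function of one variable is
constant. -/
theorem AnalyticOnNhd.iff_of_eventually_iff {Ω : Set ℂ} (hΩo : IsOpen Ω) (hΩ : IsPreconnected Ω)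
    {f : ℂ → ℂ} (hf : AnalyticOnNhd ℂ f Ω) {P : ℂ → Prop}
    (hP : ∀ t ∈ Ω, f t ≠ 0 → ∀ᶠ t' in 𝓝 t, (P t' ↔ P t)) {x y : ℂ} (hx : x ∈ Ω) (hfx : f x ≠ 0)
    (hy : y ∈ Ω) (hfy : f y ≠ 0) : P x ↔ P y := by
  have hiso (t : ℂ) (ht : t ∈ Ω) : ∀ᶠ t' in 𝓝[≠] t, f t' ≠ 0 := by
    refine (hf t ht).eventually_eq_zero_or_eventually_ne_zero.resolve_left fun h0 => hfx ?_
    exact hf.eqOn_zero_of_preconnected_of_eventuallyEq_zero hΩ ht h0 hx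
  have hloc (t : ℂ) (ht : t ∈ Ω) : ∃ q : Prop, ∀ᶠ a in 𝓝[≠] t, (P a ↔ q) := by
    obtain ⟨δ, hδ, hball⟩ := Metric.eventually_nhds_iff_ball.1
      ((eventually_nhdsWithin_iff.1 (hiso t ht)).and (hΩo.mem_nhds ht))
    obtain ⟨q, hq⟩ := (isPreconnected_ball_diff_singleton t δ).exists_forall_eventually_iff
      subset_closure (P := P) fun z hz => ⟨P z, nhdsWithin_le_nhds
        (hP z (hball z hz.1).2 ((hball z hz.1).1 hz.2))⟩
    refine ⟨q, ?_⟩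
    filter_upwards [inter_mem_nhdsWithin {t}ᶜ (Metric.ball_mem_nhds t hδ)] with a ha
    exact (hq a ⟨ha.2, ha.1⟩).self_of_nhdsWithin ⟨ha.2, ha.1⟩
  let S : Set ℂ := {t | f t ≠ 0}
  have hSle (t : ℂ) (ht : t ∈ Ω) : ∃ q : Prop, ∀ᶠ a in 𝓝[S] t, (P a ↔ q) := by
    by_cases h0 : f t = 0
    · obtain ⟨q, hq⟩ := hloc t ht
      refine ⟨q, nhdsWithin_mono t (fun a ha => ?_) hq⟩
      rintro rfl
      exact ha h0
    · exact ⟨P t, nhdsWithin_le_nhds (hP t ht h0)⟩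
  have hcl : Ω ⊆ closure S := fun t ht =>
    mem_closure_iff_frequently.2 (((hiso t ht).frequently).filter_mono nhdsWithin_le_nhds)
  obtain ⟨q, hq⟩ := hΩ.exists_forall_eventually_iff hcl hSle
  exact ((hq x hx).self_of_nhdsWithin hfx).trans ((hq y hy).self_of_nhdsWithin hfy).symm

/-- A predicate which is locally constant off the zeros of an analytic function on a convex set is
constant. -/
theorem AnalyticOnNhd.iff_of_eventually_iff_of_convex {E : Type*} [NormedAddCommGroup E]
    [NormedSpace ℂ E] {B : Set E} (hBo : IsOpen B) (hB : Convex ℝ B) {f : E → ℂ}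
    (hf : AnalyticOnNhd ℂ f B) {P : E → Prop}
    (hP : ∀ b ∈ B, f b ≠ 0 → ∀ᶠ b' in 𝓝 b, (P b' ↔ P b)) {x y : E} (hx : x ∈ B) (hfx : f x ≠ 0)
    (hy : y ∈ B) (hfy : f y ≠ 0) : P x ↔ P y := by
  -- Restriction to the complex line through the two points reduces to one variable; the preimage of
  -- the convex set in `ℂ` is convex, hence connected.
  let l (t : ℂ) : E := x + t • (y - x)
  have hl (t : ℂ) : AnalyticAt ℂ l t := analyticAt_const.add (analyticAt_id.smul analyticAt_const)
  have hlc : Continuous l := by fun_prop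
  have hconv : Convex ℝ (l ⁻¹' B) := by
    intro s hs t ht a b ha hb hab
    have h1 : l (a • s + b • t) = a • l s + b • l t := by
      have h2 : a • l s + b • l t = (a + b) • x + ((a • s + b • t) • (y - x)) := by
        simp only [l, smul_add, add_smul, smul_assoc]
        abel
      rw [h2, hab, one_smul]
    change l _ ∈ B
    rw [h1]
    exact hB hs ht ha hb hab
  have h0 : l 0 = x := by simp [l]
  have h1 : l 1 = y := by simp [l]
  have key := AnalyticOnNhd.iff_of_eventually_iff (hBo.preimage hlc) hconv.isPreconnected
    (f := f ∘ l) (fun t ht => (hf _ ht).comp (hl t)) (P := P ∘ l)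
    (fun t ht hft => hlc.continuousAt.eventually (hP _ ht hft)) (x := 0) (y := 1)
  simpa [h0, h1, hx, hy, hfx, hfy] using key

/-! ### Prime divisors in adapted charts -/

namespace AdaptedChart

variable {X : Type u} [TopologicalSpace X] [HolStructure X] {Z Z' : Set X} {y : X}

/-- The points of a hypersurface near a smooth point are smooth points of every set that agrees
locally with the hypersurface. -/
theorem mem_smoothPoints (c : AdaptedChart Z y) {s : X} (hs : s ∈ c.chart.source) (hsZ : s ∈ Z)
    {D : Set X} (h : ∀ᶠ x in 𝓝 s, (x ∈ D ↔ x ∈ Z)) : s ∈ smoothPoints D := by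
  obtain ⟨U, hUD, hU, hsU⟩ := eventually_nhds_iff.1 h
  refine ⟨(hUD s hsU).2 hsZ, ?_⟩
  let φ := c.chart.restrOpen U hU
  have hφs : s ∈ φ.source := by
    rw [OpenPartialHomeomorph.restrOpen_source]
    exact ⟨hs, hsU⟩
  have hsub : φ.source ⊆ c.chart.source := by
    rw [OpenPartialHomeomorph.restrOpen_source]
    exact Set.inter_subset_left
  have hsubU : φ.source ⊆ U := by
    rw [OpenPartialHomeomorph.restrOpen_source]
    exact Set.inter_subset_right
  set a := c.chart s with ha
  have ha0 : a 0 = 0 := (c.mem_iff s hs).1 hsZ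
  obtain ⟨ε, hε, hball⟩ := Metric.isOpen_iff.1 φ.open_target a (φ.map_source hφs)
  have hε2 : (ε / 2 : ℝ) ≠ 0 := by positivity
  have hεc : ((ε / 2 : ℝ) : ℂ) ≠ 0 := by exact_mod_cast hε2
  -- Recentring at `s` and dividing by `ε / 2` places the closed unit disc of the axis in the image
  -- of the ball of radius `ε`, as `AdaptedChart.disk` demands.
  let A : (Fin (c.dim + 1) → ℂ) ≃ₜ (Fin (c.dim + 1) → ℂ) :=
    (Homeomorph.addRight (-a)).trans (Homeomorph.smulOfNeZero ((ε / 2 : ℝ) : ℂ)⁻¹ (inv_ne_zero hεc))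
  have hA (z) : A z = ((ε / 2 : ℝ) : ℂ)⁻¹ • (z - a) := by
    simp [A, sub_eq_add_neg]
  have hAs (z) : A.symm z = ((ε / 2 : ℝ) : ℂ) • z + a := by
    rw [Homeomorph.symm_apply_eq, hA, add_sub_cancel_right, inv_smul_smul₀ hεc]
  refine ⟨⟨c.dim, φ.transHomeomorph A, hφs, ?_, ?_, ?_, ?_⟩⟩
  · change A (c.chart s) = 0
    rw [hA, sub_self, smul_zero]
  · intro x hx f
    rw [c.holAt_iff x (hsub hx)]
    change _ ↔ AnalyticAt ℂ (f ∘ (c.chart.symm ∘ A.symm)) (A (c.chart x))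
    have hAan : AnalyticAt ℂ A (c.chart x) := by
      rw [show (A : (Fin (c.dim + 1) → ℂ) → _) = _ from funext hA]
      exact AnalyticAt.fun_const_smul (analyticAt_id.sub analyticAt_const)
    have hAsan : AnalyticAt ℂ A.symm (A (c.chart x)) := by
      rw [show (A.symm : (Fin (c.dim + 1) → ℂ) → _) = _ from funext hAs]
      exact (AnalyticAt.fun_const_smul analyticAt_id).add analyticAt_const
    constructor
    · intro h
      refine AnalyticAt.comp (g := f ∘ c.chart.symm) ?_ hAsan
      rwa [A.symm_apply_apply]
    · intro h
      have h1 : f ∘ c.chart.symm = (f ∘ (c.chart.symm ∘ A.symm)) ∘ A := by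
        funext z
        simp
      rw [h1]
      exact AnalyticAt.comp h hAan
  · intro x hx
    rw [hUD x (hsubU hx), c.mem_iff x (hsub hx)]
    change _ ↔ A (c.chart x) 0 = 0
    rw [hA, Pi.smul_apply, Pi.sub_apply, ha0, sub_zero, smul_eq_zero]
    simp [hε.ne']
  · intro z hz
    change A.symm (Pi.single 0 z) ∈ φ.target
    apply hball
    rw [hAs, Metric.mem_ball, dist_eq_norm, add_sub_cancel_right, norm_smul, Pi.norm_single,
      Complex.norm_real, Real.norm_of_nonneg (by positivity)]
    nlinarith

theorem eventually_symm (c : AdaptedChart Z y) {s : X} (hs : s ∈ c.prodChart.source) {Q : X → Prop}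
    (h : ∀ᶠ x in 𝓝 s, Q x) : ∀ᶠ z in 𝓝 (c.prodChart s), Q (c.prodChart.symm z) := by
  have h1 : ContinuousAt c.prodChart.symm (c.prodChart s) :=
    c.prodChart.symm.continuousAt (c.prodChart.map_source hs)
  rw [ContinuousAt, c.prodChart.left_inv hs] at h1
  exact h1.eventually h

theorem eventually_prodChart (c : AdaptedChart Z y) {Q : ℂ × (Fin c.dim → ℂ) → Prop}
    (h : ∀ᶠ z in 𝓝 0, Q z) : ∀ᶠ x in 𝓝 y, Q (c.prodChart x) := by
  have h1 := c.prodChart.continuousAt (x := y) c.mem_source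
  rw [ContinuousAt, c.prodChart_point] at h1
  exact h1.eventually h

theorem eventually_mem_source (c : AdaptedChart Z y) : ∀ᶠ x in 𝓝 y, x ∈ c.prodChart.source :=
  c.prodChart.open_source.mem_nhds c.mem_source

theorem eventually_analyticAt (c : AdaptedChart Z y) {g : X → ℂ} (hg : HolAt g y) :
    ∀ᶠ z in 𝓝 (0 : ℂ × (Fin c.dim → ℂ)), AnalyticAt ℂ (g ∘ c.prodChart.symm) z := by
  have h1 := (c.prodChart_holAt_iff y c.mem_source g).1 hg
  rw [c.prodChart_point] at h1
  exact h1.eventually_analyticAt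

theorem symm_mem_iff (c : AdaptedChart Z y) {z : ℂ × (Fin c.dim → ℂ)} (hz : z ∈ c.prodChart.target) :
    c.prodChart.symm z ∈ Z ↔ z.1 = 0 := by
  rw [c.prodChart_mem_iff _ (c.prodChart.map_target hz), c.prodChart.right_inv hz]

/-- Equations of an analytic subset in an adapted chart. -/
theorem exists_equations (c : AdaptedChart Z y) (hZ' : IsAnalyticSubset Z') :
    ∃ (k : ℕ) (G : Fin k → ℂ × (Fin c.dim → ℂ) → ℂ) (δ : ℝ), 0 < δ ∧
      Metric.ball 0 δ ⊆ c.prodChart.target ∧ (∀ i, AnalyticOnNhd ℂ (G i) (Metric.ball 0 δ)) ∧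
      ∀ z ∈ Metric.ball 0 δ, (c.prodChart.symm z ∈ Z' ↔ ∀ i, G i z = 0) := by
  obtain ⟨k, g, hg, hgZ⟩ := hZ' y
  have h1 := c.eventually_symm c.mem_source hgZ
  rw [c.prodChart_point] at h1
  have h2 : ∀ᶠ z in 𝓝 (0 : ℂ × (Fin c.dim → ℂ)), ∀ i, AnalyticAt ℂ (g i ∘ c.prodChart.symm) z :=
    eventually_all.2 fun i => c.eventually_analyticAt (hg i)
  have h3 : ∀ᶠ z in 𝓝 (0 : ℂ × (Fin c.dim → ℂ)), z ∈ c.prodChart.target := by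
    refine c.prodChart.open_target.mem_nhds ?_
    rw [← c.prodChart_point]
    exact c.prodChart.map_source c.mem_source
  obtain ⟨δ, hδ, hball⟩ := Metric.eventually_nhds_iff_ball.1 (h1.and (h2.and h3))
  exact ⟨k, fun i => g i ∘ c.prodChart.symm, δ, hδ, fun z hz => (hball z hz).2.2,
    fun i z hz => (hball z hz).2.1 i, fun z hz => (hball z hz).1⟩

theorem mem_ball_zero_mk {E : Type} [NormedAddCommGroup E] {δ : ℝ} {b : E} :
    ((0, b) : ℂ × E) ∈ Metric.ball 0 δ ↔ b ∈ Metric.ball 0 δ := by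
  simp [Prod.norm_def]

theorem analyticAt_zero_mk {E : Type} [NormedAddCommGroup E] [NormedSpace ℂ E] (b : E) :
    AnalyticAt ℂ (fun b : E => ((0, b) : ℂ × E)) b :=
  analyticAt_const.prod analyticAt_id

/-- If an analytic subset contains the hypersurface near some point of a chart, then it contains it
near the center of the chart. -/
theorem eventually_forall_eventually (c : AdaptedChart Z y) (hZ' : IsAnalyticSubset Z') :
    ∀ᶠ y₁ in 𝓝 y, y₁ ∈ Z → (∀ᶠ x in 𝓝 y₁, x ∈ Z → x ∈ Z') → ∀ᶠ x in 𝓝 y, x ∈ Z → x ∈ Z' := by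
  obtain ⟨k, G, δ, hδ, htarget, hG, hGZ⟩ := c.exists_equations hZ'
  have hnear : ∀ᶠ x in 𝓝 y, x ∈ c.prodChart.source ∧ c.prodChart x ∈ Metric.ball 0 δ :=
    c.eventually_mem_source.and (c.eventually_prodChart (Metric.ball_mem_nhds 0 hδ))
  have hform {x : X} (hx : x ∈ c.prodChart.source) (hxZ : x ∈ Z) :
      c.prodChart x = (0, (c.prodChart x).2) :=
    Prod.ext ((c.prodChart_mem_iff x hx).1 hxZ) rfl
  filter_upwards [hnear] with y₁ ⟨hs, hb⟩ hy₁ h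
  -- The identity theorem on the ball of the hyperplane: each equation of `Z'` vanishes near one
  -- point of it, hence on all of it.
  have hzero (i : Fin k) : Set.EqOn (fun b => G i (0, b)) 0 (Metric.ball 0 δ) := by
    have han : AnalyticOnNhd ℂ (fun b => G i (0, b)) (Metric.ball 0 δ) := fun b hb =>
      (hG i _ ((mem_ball_zero_mk).2 hb)).fun_comp (analyticAt_zero_mk b)
    rw [hform hs hy₁, mem_ball_zero_mk] at hb
    refine han.eqOn_zero_of_preconnected_of_eventuallyEq_zero
      (convex_ball 0 δ).isPreconnected hb ?_
    have h1 := c.eventually_symm hs h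
    rw [hform hs hy₁] at h1
    have h2 := (analyticAt_zero_mk (c.prodChart y₁).2).continuousAt.eventually h1
    filter_upwards [h2, Metric.isOpen_ball.mem_nhds hb] with b h3 h4
    have h5 := (mem_ball_zero_mk).2 h4
    exact (hGZ _ h5).1 (h3 ((c.symm_mem_iff (htarget h5)).2 rfl)) i
  filter_upwards [hnear] with x ⟨hxs, hxb⟩ hxZ
  rw [← c.prodChart.left_inv hxs, hGZ _ hxb]
  intro i
  rw [hform hxs hxZ] at hxb ⊢
  exact hzero i ((mem_ball_zero_mk).1 hxb)

end AdaptedChart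

/-! ### The identity principle for prime divisors. -/

section IsPrimeDivisor

variable {X : Type u} [TopologicalSpace X] [HolStructure X] {Z Z' : Set X}

theorem IsComplexSpace.continuousAt [IsComplexSpace X] {g : X → ℂ} {x : X} (hg : HolAt g x) :
    ContinuousAt g x := by
  obtain ⟨U, n, φ, Ω, k, G, hU, hx, -, -, -, hφ, h⟩ := IsComplexSpace.exists_localModel x
  obtain ⟨F, hF, hgF⟩ := (h x hx g).1 hg
  have h1 : ContinuousAt φ x :=
    (continuousOn_iff_continuous_domRestrict.2 hφ.continuous).continuousAt (hU.mem_nhds hx)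
  exact (hF.continuousAt.comp h1).congr hgF.symm

theorem IsAnalyticSubset.isClosed [IsComplexSpace X] (hZ : IsAnalyticSubset Z) : IsClosed Z := by
  rw [← isOpen_compl_iff, isOpen_iff_mem_nhds]
  intro x hx
  obtain ⟨k, g, hg, h⟩ := hZ x
  have h1 : ¬ ∀ i, g i x = 0 := fun h0 => hx (h.self_of_nhds.2 h0)
  push Not at h1
  obtain ⟨i, hi⟩ := h1
  filter_upwards [h, (IsComplexSpace.continuousAt (hg i)).eventually_ne hi] with z h2 h3 h4
  exact h3 ((h2.1 h4) i)

/-- A prime divisor that is contained in a closed analytic subset near a smooth point is contained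
in it. -/
theorem IsPrimeDivisor.subset_of_eventually [IsComplexSpace X] (hZ : IsPrimeDivisor Z)
    (hZ' : IsAnalyticSubset Z') {y : X} (hy : y ∈ smoothPoints Z)
    (h : ∀ᶠ x in 𝓝 y, x ∈ Z → x ∈ Z') : Z ⊆ Z' := by
  let O₁ : Set X := {y | ∀ᶠ x in 𝓝 y, x ∈ Z → x ∈ Z'}
  -- A smooth point of `Z` outside `O₁` has no nearby point of `Z` in `O₁`. So two open sets,
  -- disjoint on the smooth points, cover this connected set.
  let O₂ : Set X := {y | ∀ᶠ y₁ in 𝓝 y, y₁ ∈ Z → y₁ ∉ O₁}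
  have hO₁ : IsOpen O₁ := isOpen_iff_mem_nhds.2 fun y hy => eventually_eventually_nhds.2 hy
  have hO₂ : IsOpen O₂ := isOpen_iff_mem_nhds.2 fun y hy => eventually_eventually_nhds.2 hy
  have hcover : smoothPoints Z ⊆ O₁ ∪ O₂ := by
    rintro y ⟨hy, ⟨c⟩⟩
    by_cases h1 : y ∈ O₁
    · exact Or.inl h1
    · right
      filter_upwards [c.eventually_forall_eventually hZ'] with y₁ h2 h3 h4
      exact h1 (h2 h3 h4)
  have hdisj : smoothPoints Z ∩ (O₁ ∩ O₂) = ∅ :=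
    Set.eq_empty_of_forall_notMem fun y hy => Eventually.self_of_nhds hy.2.2 hy.1.1 hy.2.1
  have h1 : smoothPoints Z ⊆ O₁ := by
    refine (isPreconnected_iff_subset_of_disjoint.1 hZ.isConnected.isPreconnected _ _ hO₁ hO₂
      hcover hdisj).resolve_right fun h2 => ?_
    exact Eventually.self_of_nhds (h2 hy) hy.1 h
  have h2 : smoothPoints Z ⊆ Z' := fun x hx => Eventually.self_of_nhds (h1 hx) hx.1
  exact hZ.dense.trans (closure_minimal h2 hZ'.isClosed)

end IsPrimeDivisor

/-- An analytic function factors as a power of the first coordinate and a function that does not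
vanish identically on the hyperplane `z.1 = 0`. -/
theorem AnalyticAt.exists_eq_fst_pow_mul {E : Type*} [NormedAddCommGroup E] [NormedSpace ℂ E]
    {G : ℂ × E → ℂ} {b : E} (hG : AnalyticAt ℂ G (0, b)) (h : ¬ ∀ᶠ z in 𝓝 (0 : ℂ), G (z, b) = 0) :
    ∃ (a : ℕ) (H : ℂ × E → ℂ), AnalyticAt ℂ H (0, b) ∧
      (∀ᶠ z in 𝓝 ((0 : ℂ), b), G z = z.1 ^ a * H z) ∧ ¬ ∀ᶠ b' in 𝓝 b, H (0, b') = 0 := by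
  have hline {K : ℂ × E → ℂ} (hK : AnalyticAt ℂ K (0, b)) :
      AnalyticAt ℂ (fun z : ℂ => K (z, b)) 0 :=
    hK.fun_comp (f := fun z : ℂ => (z, b)) (analyticAt_id.prod analyticAt_const)
  obtain ⟨n, g, hg, hg0, hGg⟩ := (hline hG).exists_eventuallyEq_pow_smul_nonzero_iff.2 h
  simp only [sub_zero, smul_eq_mul] at hGg
  clear h
  induction n generalizing G with
  | zero =>
    refine ⟨0, G, hG, .of_forall fun z => by simp, fun h0 => hg0 ?_⟩
    have h1 := hGg.self_of_nhds
    rw [pow_zero, one_mul] at h1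
    rw [← h1, h0.self_of_nhds]
  | succ n ih =>
    -- The induction is on the vanishing order along the line through `b`. As long as `G` vanishes
    -- on the hyperplane, a factor `z.1` can be removed, which lowers this order by one.
    by_cases h0 : ∀ᶠ b' in 𝓝 b, G (0, b') = 0
    · obtain ⟨K, hK, hGK⟩ := hG.exists_eq_fst_mul h0
      have hcont : ContinuousAt (fun z : ℂ => (z, b)) 0 := by fun_prop
      have h1 : ∀ᶠ z in 𝓝[≠] (0 : ℂ), K (z, b) = z ^ n * g z := by
        filter_upwards [nhdsWithin_le_nhds hGg, nhdsWithin_le_nhds (hcont.eventually hGK),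
          self_mem_nhdsWithin] with z h2 h3 h4
        rw [h3, pow_succ', mul_assoc] at h2
        exact mul_left_cancel₀ h4 h2
      have h2 : ∀ᶠ z in 𝓝 (0 : ℂ), K (z, b) = z ^ n * g z :=
        ((hline hK).frequently_eq_iff_eventually_eq ((analyticAt_id.pow n).mul hg)).1 h1.frequently
      obtain ⟨a, H, hH, hKH, hne⟩ := ih hK h2
      refine ⟨a + 1, H, hH, ?_, hne⟩
      filter_upwards [hGK, hKH] with z h3 h4
      rw [h3, h4]
      ring
    · exact ⟨0, G, hG, .of_forall fun z => by simp, h0⟩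

namespace AdaptedChart

variable {X : Type u} [TopologicalSpace X] [HolStructure X] {Z Z' : Set X} {y : X}

/-- The zero set of a nonzero holomorphic function is contained in the hypersurface near some
smooth points of the hypersurface. -/
theorem exists_mem_smoothPoints (c : AdaptedChart Z y) {g : X → ℂ} (hg : HolAt g y)
    (hne : ¬ ∀ᶠ x in 𝓝 y, g x = 0) {Q : X → Prop} (hQ : ∀ᶠ x in 𝓝 y, Q x) :
    ∃ y₁ ∈ smoothPoints Z, Q y₁ ∧ ∀ᶠ x in 𝓝 y₁, g x = 0 → x ∈ Z := by
  set G := g ∘ c.prodChart.symm with hGdef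
  have h1 := c.eventually_symm c.mem_source hQ
  rw [c.prodChart_point] at h1
  have h3 : ∀ᶠ z in 𝓝 (0 : ℂ × (Fin c.dim → ℂ)), z ∈ c.prodChart.target := by
    refine c.prodChart.open_target.mem_nhds ?_
    rw [← c.prodChart_point]
    exact c.prodChart.map_source c.mem_source
  obtain ⟨δ, hδ, hball⟩ := Metric.eventually_nhds_iff_ball.1
    ((c.eventually_analyticAt hg).and (h1.and h3))
  obtain ⟨⟨z₁, b₁⟩, hz₁, hGz₁⟩ : ∃ z ∈ Metric.ball (0 : ℂ × (Fin c.dim → ℂ)) δ, G z ≠ 0 := by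
    by_contra! h0
    refine hne ?_
    filter_upwards [c.eventually_mem_source, c.eventually_prodChart (Metric.ball_mem_nhds 0 hδ)]
      with x hx hxb
    have h4 := h0 _ hxb
    rwa [hGdef, Function.comp_apply, c.prodChart.left_inv hx] at h4
  have hball_iff {z : ℂ} {b : Fin c.dim → ℂ} : (z, b) ∈ Metric.ball (0 : ℂ × (Fin c.dim → ℂ)) δ ↔
      z ∈ Metric.ball 0 δ ∧ b ∈ Metric.ball 0 δ := by
    simp only [mem_ball_zero_iff, Prod.norm_def, sup_lt_iff]
  have hline : AnalyticOnNhd ℂ (fun z : ℂ => G (z, b₁)) (Metric.ball 0 δ) := fun z hz =>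
    (hball _ (hball_iff.2 ⟨hz, (hball_iff.1 hz₁).2⟩)).1.fun_comp (f := fun z : ℂ => (z, b₁))
      (analyticAt_id.prod analyticAt_const)
  have hline0 : ¬ ∀ᶠ z in 𝓝 (0 : ℂ), G (z, b₁) = 0 := fun h0 => hGz₁ (
    hline.eqOn_zero_of_preconnected_of_eventuallyEq_zero (convex_ball 0 δ).isPreconnected
      (Metric.mem_ball_self hδ) h0 (hball_iff.1 hz₁).1)
  have hb₁ : ((0 : ℂ), b₁) ∈ Metric.ball (0 : ℂ × (Fin c.dim → ℂ)) δ :=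
    hball_iff.2 ⟨Metric.mem_ball_self hδ, (hball_iff.1 hz₁).2⟩
  -- On the slice through `b₁` the function is not identically zero, so the factorization applies.
  -- Near `(0, b)` with `H (0, b) ≠ 0`, its zeros lie on the hyperplane.
  obtain ⟨a, H, hH, hGH, hHne⟩ := (hball _ hb₁).1.exists_eq_fst_pow_mul hline0
  have hcont : ContinuousAt (fun b : Fin c.dim → ℂ => ((0 : ℂ), b)) b₁ := by fun_prop
  have h4 : ∀ᶠ b in 𝓝 b₁, ((0 : ℂ), b) ∈ Metric.ball (0 : ℂ × (Fin c.dim → ℂ)) δ ∧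
      AnalyticAt ℂ H (0, b) ∧ ∀ᶠ z in 𝓝 ((0 : ℂ), b), G z = z.1 ^ a * H z :=
    hcont.eventually ((Metric.isOpen_ball.eventually_mem hb₁).and
      (hH.eventually_analyticAt.and (eventually_eventually_nhds.2 hGH)))
  obtain ⟨b, hHb, hb, hHan, hGb⟩ := ((not_eventually.1 hHne).and_eventually h4).exists
  have ht : ((0 : ℂ), b) ∈ c.prodChart.target := (hball _ hb).2.2
  have hys := c.prodChart.map_target ht
  have hyZ : c.prodChart.symm (0, b) ∈ Z := (c.symm_mem_iff ht).2 rfl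
  refine ⟨c.prodChart.symm (0, b), c.mem_smoothPoints hys hyZ (.of_forall fun x => Iff.rfl),
    (hball _ hb).2.1, ?_⟩
  have h5 : ∀ᶠ z in 𝓝 ((0 : ℂ), b), G z = 0 → z.1 = 0 := by
    filter_upwards [hGb, hHan.continuousAt.eventually_ne hHb] with z h6 h7 h8
    rw [h6, mul_eq_zero] at h8
    exact eq_zero_of_pow_eq_zero (h8.resolve_right h7)
  have h6 := c.prodChart.continuousAt hys
  rw [ContinuousAt, c.prodChart.right_inv ht] at h6
  filter_upwards [h6.eventually h5, c.prodChart.open_source.mem_nhds hys] with x h7 hx h8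
  rw [c.prodChart_mem_iff x hx]
  apply h7
  rwa [hGdef, Function.comp_apply, c.prodChart.left_inv hx]

theorem not_eventually_mem (c : AdaptedChart Z y) : ¬ ∀ᶠ x in 𝓝 y, x ∈ Z := by
  intro h
  have h1 := c.eventually_symm c.mem_source h
  have h2 := c.prodChart.open_target.mem_nhds (c.prodChart.map_source c.mem_source)
  have h3 : ∀ᶠ z in 𝓝 (c.prodChart y), z.1 = 0 := by
    filter_upwards [h1, h2] with z h4 h5
    exact (c.symm_mem_iff h5).1 h4
  have := neBot_nhdsWithin_fst_ne_zero (c.prodChart y)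
  obtain ⟨z, hz, hz'⟩ := (Eventually.and (nhdsWithin_le_nhds h3) self_mem_nhdsWithin :
    ∀ᶠ z in 𝓝[{v : ℂ × (Fin c.dim → ℂ) | v.1 ≠ 0}] (c.prodChart y), _).exists
  exact hz' hz

end AdaptedChart

/-- A prime divisor that is contained in a prime divisor near a smooth point is equal to it. -/
theorem IsPrimeDivisor.eq_of_eventually {X : Type u} [TopologicalSpace X] [HolStructure X]
    [IsComplexSpace X] {Z Z' : Set X} (hZ : IsPrimeDivisor Z) (hZ' : IsPrimeDivisor Z') {y : X}
    (hy : y ∈ smoothPoints Z) (h : ∀ᶠ x in 𝓝 y, x ∈ Z → x ∈ Z') : Z = Z' := by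
  have hsub := hZ.subset_of_eventually hZ'.isAnalyticSubset hy h
  refine hsub.antisymm ?_
  obtain ⟨k, g, hg, hgZ⟩ := hZ'.isAnalyticSubset y
  -- If every equation of `Z'` vanished near `y`, then `Z'` would contain an open set; but the
  -- smooth points of `Z'` are dense in it, and a hypersurface has empty interior there.
  obtain ⟨i, hi⟩ : ∃ i, ¬ ∀ᶠ x in 𝓝 y, g i x = 0 := by
    by_contra! h0
    have h1 : ∀ᶠ x in 𝓝 y, x ∈ Z' := by
      filter_upwards [eventually_all.2 h0, hgZ] with x h2 h3 using h3.2 h2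
    obtain ⟨w, ⟨-, ⟨c⟩⟩, hw⟩ := ((mem_closure_iff_frequently.1 (hZ'.dense (hsub hy.1))).and_eventually
      (eventually_eventually_nhds.2 h1)).exists
    exact c.not_eventually_mem hw
  have h2 : ∀ᶠ x in 𝓝 y, x ∈ Z' → g i x = 0 := hgZ.mono fun x hx hxZ => hx.1 hxZ i
  obtain ⟨c⟩ := hy.2
  -- Near `y₁` the zeros of `g i` lie in `Z`, so the two divisors coincide there. Thus `y₁` is also
  -- a smooth point of `Z'`, and the other inclusion propagates from it.
  obtain ⟨y₁, hy₁, ⟨h3, h4⟩, h5⟩ := c.exists_mem_smoothPoints (hg i) hi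
    ((eventually_eventually_nhds.2 h).and (eventually_eventually_nhds.2 h2))
  have h6 : ∀ᶠ x in 𝓝 y₁, x ∈ Z' → x ∈ Z := by
    filter_upwards [h4, h5] with x h7 h8 h9 using h8 (h7 h9)
  obtain ⟨c₁⟩ := hy₁.2
  refine hZ'.subset_of_eventually hZ.isAnalyticSubset
    (c₁.mem_smoothPoints c₁.mem_source hy₁.1 ?_) h6
  filter_upwards [h3, h6] with x h7 h8 using ⟨h8, h7⟩

/-- Germs of analytic functions form a domain: where `f` is nonzero `g` vanishes on an open set,
hence on the ball by the identity theorem. -/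
theorem AnalyticAt.eventually_eq_zero_or_of_mul {E : Type*} [NormedAddCommGroup E] [NormedSpace ℂ E]
    {f g : E → ℂ} {b : E} (hf : AnalyticAt ℂ f b) (hg : AnalyticAt ℂ g b)
    (h : ∀ᶠ x in 𝓝 b, f x * g x = 0) : (∀ᶠ x in 𝓝 b, f x = 0) ∨ ∀ᶠ x in 𝓝 b, g x = 0 := by
  obtain ⟨δ, hδ, hball⟩ := Metric.eventually_nhds_iff_ball.1
    (hf.eventually_analyticAt.and (hg.eventually_analyticAt.and h))
  by_cases h0 : ∀ x ∈ Metric.ball b δ, f x = 0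
  · exact Or.inl (mem_of_superset (Metric.ball_mem_nhds b hδ) h0)
  · right
    push Not at h0
    obtain ⟨x, hx, hfx⟩ := h0
    have h1 : ∀ᶠ z in 𝓝 x, g z = 0 := by
      filter_upwards [(hball x hx).1.continuousAt.eventually_ne hfx, Metric.isOpen_ball.mem_nhds hx]
        with z h2 h3
      exact (mul_eq_zero.1 (hball z h3).2.2).resolve_left h2
    have h2 : AnalyticOnNhd ℂ g (Metric.ball b δ) := fun z hz => (hball z hz).2.1
    exact mem_of_superset (Metric.ball_mem_nhds b hδ)
      (h2.eqOn_zero_of_preconnected_of_eventuallyEq_zero (convex_ball b δ).isPreconnected hx h1)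

theorem Finset.exists_eventually_eq_zero_of_prod {ι : Type*} {E : Type*} [NormedAddCommGroup E]
    [NormedSpace ℂ E] (s : Finset ι) {f : ι → E → ℂ} {b : E} (hf : ∀ i ∈ s, AnalyticAt ℂ (f i) b)
    (h : ∀ᶠ x in 𝓝 b, ∏ i ∈ s, f i x = 0) : ∃ i ∈ s, ∀ᶠ x in 𝓝 b, f i x = 0 := by
  classical
  induction s using Finset.induction_on with
  | empty =>
    obtain ⟨x, hx⟩ := h.exists
    simp at hx
  | insert i s hi ih =>
    simp only [Finset.prod_insert hi] at h
    rcases (hf i (Finset.mem_insert_self i s)).eventually_eq_zero_or_of_mul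
      (Finset.analyticAt_fun_prod s fun j hj => hf j (Finset.mem_insert_of_mem hj)) h with h1 | h1
    · exact ⟨i, Finset.mem_insert_self i s, h1⟩
    · obtain ⟨j, hj, h2⟩ := ih (fun j hj => hf j (Finset.mem_insert_of_mem hj)) h1
      exact ⟨j, Finset.mem_insert_of_mem hj, h2⟩

/-! ### Locally constant predicates on the smooth points of the divisor in one component. -/

section Components

variable {X : Type u} [TopologicalSpace X] [HolStructure X] {Z : Set X} {y : X}

/-- If an analytic subset does not contain the hypersurface near the center of a chart, then one of
its equations does not vanish identically on the hypersurface. -/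
theorem AdaptedChart.exists_equation (c : AdaptedChart Z y) {Z' : Set X}
    (hZ' : IsAnalyticSubset Z') (hne : ¬ ∀ᶠ x in 𝓝 y, x ∈ Z → x ∈ Z') :
    ∃ h : (Fin c.dim → ℂ) → ℂ, (∀ᶠ b in 𝓝 0, AnalyticAt ℂ h b ∧
      (c.prodChart.symm (0, b) ∈ Z' → h b = 0)) ∧ ¬ ∀ᶠ b in 𝓝 0, h b = 0 := by
  obtain ⟨k, G, δ, hδ, htarget, hG, hGZ⟩ := c.exists_equations hZ'
  obtain ⟨i, hi⟩ : ∃ i, ¬ ∀ᶠ b in 𝓝 (0 : Fin c.dim → ℂ), G i (0, b) = 0 := by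
    by_contra! h0
    refine hne ?_
    have h1 : ∀ᶠ z in 𝓝 (0 : ℂ × (Fin c.dim → ℂ)), ∀ i, G i (0, z.2) = 0 :=
      (continuous_snd.tendsto' (0 : ℂ × (Fin c.dim → ℂ)) 0 rfl).eventually (eventually_all.2 h0)
    filter_upwards [c.eventually_mem_source, c.eventually_prodChart (Metric.ball_mem_nhds 0 hδ),
      c.eventually_prodChart h1] with x hx hxb hx0 hxZ
    rw [← c.prodChart.left_inv hx, hGZ _ hxb]
    intro i
    rw [← hx0 i]
    congr 1
    exact Prod.ext ((c.prodChart_mem_iff x hx).1 hxZ) rfl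
  refine ⟨fun b => G i (0, b), ?_, hi⟩
  filter_upwards [Metric.ball_mem_nhds (0 : Fin c.dim → ℂ) hδ] with b hb
  have hb' := AdaptedChart.mem_ball_zero_mk.2 hb
  exact ⟨(hG i _ hb').fun_comp (AdaptedChart.analyticAt_zero_mk b), fun h => (hGZ _ hb').1 h i⟩

variable [IsComplexSpace X] {components : Finset (Set X)}
  (hcomponents : ∀ Z ∈ components, IsPrimeDivisor Z) {D : Set X}
  (hD : D = ⋃ Z ∈ components, Z)

include hcomponents hD in
/-- Near a smooth point of a component, a predicate which is locally constant on the smooth part of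
the divisor is constant on the smooth part of the divisor lying in the component. -/
theorem AdaptedChart.exists_forall_eventually_iff (hZ : Z ∈ components) (c : AdaptedChart Z y)
    (hy : y ∈ Z) {P : X → Prop} (hP : ∀ x ∈ smoothPoints D, ∀ᶠ x' in 𝓝 x, x' ∈ D → (P x' ↔ P x)) :
    y ∈ closure (Z ∩ smoothPoints D) ∧
      ∃ q : Prop, ∀ᶠ a in 𝓝[Z ∩ smoothPoints D] y, (P a ↔ q) := by
  classical
  have hZD : Z ⊆ D := by
    rw [hD]
    exact Set.subset_biUnion_of_mem (u := fun Z : Set X => Z) hZ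
  have hex : ∀ Z' ∈ components.erase Z, ∃ h : (Fin c.dim → ℂ) → ℂ, (∀ᶠ b in 𝓝 0, AnalyticAt ℂ h b ∧
      (c.prodChart.symm (0, b) ∈ Z' → h b = 0)) ∧ ¬ ∀ᶠ b in 𝓝 0, h b = 0 := by
    intro Z' hZ'
    rw [Finset.mem_erase] at hZ'
    exact c.exists_equation (hcomponents Z' hZ'.2).isAnalyticSubset fun h => hZ'.1
      ((hcomponents Z hZ).eq_of_eventually (hcomponents Z' hZ'.2) ⟨hy, ⟨c⟩⟩ h).symm
  choose! h hh hne using hex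
  -- A product of nonzero equations, one for each other component restricted to `Z`. Where it does
  -- not vanish, `D` agrees locally with `Z`, so the point is smooth on `D`.
  let f (b : Fin c.dim → ℂ) : ℂ := ∏ Z' ∈ components.erase Z, h Z' b
  have hf0 : ¬ ∀ᶠ b in 𝓝 0, f b = 0 := fun h0 => by
    obtain ⟨Z', hZ', h1⟩ := (components.erase Z).exists_eventually_eq_zero_of_prod
      (fun Z' hZ' => (hh Z' hZ').self_of_nhds.1) h0
    exact hne Z' hZ' h1
  have ht : ∀ᶠ b in 𝓝 (0 : Fin c.dim → ℂ), ((0 : ℂ), b) ∈ c.prodChart.target := by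
    have h1 : ContinuousAt (fun b : Fin c.dim → ℂ => ((0 : ℂ), b)) 0 := by fun_prop
    refine h1.eventually_mem (c.prodChart.open_target.mem_nhds ?_)
    rw [← Prod.zero_eq_mk, ← c.prodChart_point]
    exact c.prodChart.map_source c.mem_source
  obtain ⟨δ, hδ, hball⟩ := Metric.eventually_nhds_iff_ball.1
    (((Finset.eventually_all _).2 hh).and ht)
  have hfan : AnalyticOnNhd ℂ f (Metric.ball 0 δ) := fun b hb =>
    Finset.analyticAt_fun_prod _ fun Z' hZ' => ((hball b hb).1 Z' hZ').1
  let p (b : Fin c.dim → ℂ) : X := c.prodChart.symm (0, b)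
  have hp (b : Fin c.dim → ℂ) (hb : b ∈ Metric.ball 0 δ) : ContinuousAt p b :=
    ContinuousAt.comp (f := fun b : Fin c.dim → ℂ => ((0 : ℂ), b))
      (c.prodChart.symm.continuousAt (hball b hb).2) (by fun_prop)
  have hpZ (b : Fin c.dim → ℂ) (hb : b ∈ Metric.ball 0 δ) : p b ∈ Z :=
    (c.symm_mem_iff (hball b hb).2).2 rfl
  have hpS (b : Fin c.dim → ℂ) (hb : b ∈ Metric.ball 0 δ) (hfb : f b ≠ 0) :
      p b ∈ Z ∩ smoothPoints D := by
    refine ⟨hpZ b hb, c.mem_smoothPoints (c.prodChart.map_target (hball b hb).2) (hpZ b hb) ?_⟩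
    have h1 : ∀ Z' ∈ components.erase Z, ∀ᶠ x in 𝓝 (p b), x ∉ Z' := fun Z' hZ' =>
      (hcomponents Z' (Finset.mem_of_mem_erase hZ')).isAnalyticSubset.isClosed.isOpen_compl.mem_nhds
        fun h2 => Finset.prod_ne_zero_iff.1 hfb Z' hZ' (((hball b hb).1 Z' hZ').2 h2)
    filter_upwards [(Finset.eventually_all _).2 h1] with x hx
    refine ⟨fun hxD => ?_, fun hxZ => hZD hxZ⟩
    rw [hD, Set.mem_iUnion₂] at hxD
    obtain ⟨Z', hZ', hxZ'⟩ := hxD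
    by_contra hxZ
    refine hx Z' (Finset.mem_erase.2 ⟨?_, hZ'⟩) hxZ'
    rintro rfl
    exact hxZ hxZ'
  have hpP (b : Fin c.dim → ℂ) (hb : b ∈ Metric.ball 0 δ) {x : X}
      (hx : ∀ᶠ x' in 𝓝 (p b), x' ∈ D → (P x' ↔ P x)) : ∀ᶠ b' in 𝓝 b, (P (p b') ↔ P x) := by
    filter_upwards [(hp b hb).eventually hx, Metric.isOpen_ball.mem_nhds hb] with b' h1 h2
    exact h1 (hZD (hpZ b' h2))
  have hfreq (b : Fin c.dim → ℂ) (hb : b ∈ Metric.ball 0 δ) : ∃ᶠ b' in 𝓝 b, f b' ≠ 0 := by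
    intro h0
    simp only [ne_eq, not_not] at h0
    exact hf0 (mem_of_superset (Metric.ball_mem_nhds 0 hδ)
      (hfan.eqOn_zero_of_preconnected_of_eventuallyEq_zero (convex_ball 0 δ).isPreconnected hb h0))
  have h0 : (0 : Fin c.dim → ℂ) ∈ Metric.ball 0 δ := Metric.mem_ball_self hδ
  have hp0 : p 0 = y := by
    have h1 := c.prodChart.left_inv c.mem_source
    rwa [c.prodChart_point] at h1
  obtain ⟨b₀, hfb₀, hb₀⟩ := ((hfreq 0 h0).and_eventually (Metric.isOpen_ball.eventually_mem h0)).exists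
  refine ⟨?_, P (p b₀), ?_⟩
  · rw [mem_closure_iff_frequently, ← hp0]
    refine (hp 0 h0).frequently (((hfreq 0 h0).and_eventually
      (Metric.isOpen_ball.eventually_mem h0)).mono fun b hb => hpS b hb.2 hb.1)
  · rw [eventually_nhdsWithin_iff]
    filter_upwards [c.eventually_mem_source, c.eventually_prodChart (Metric.ball_mem_nhds 0 hδ)]
      with a has hab haS
    have hform : c.prodChart a = (0, (c.prodChart a).2) :=
      Prod.ext ((c.prodChart_mem_iff a has).1 haS.1) rfl
    rw [hform] at hab
    replace hab := AdaptedChart.mem_ball_zero_mk.1 hab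
    have hpa : p (c.prodChart a).2 = a := by
      change c.prodChart.symm (0, _) = a
      rw [← hform, c.prodChart.left_inv has]
    have h1 := hpP _ hab (x := a) (by
      rw [hpa]
      exact hP a haS.2)
    -- The product `f` may vanish at `a`. Local constancy of `P` at `a` allows a move to a nearby
    -- zero-free point `b`, comparable with the reference point `b₀`.
    obtain ⟨b, hfb, hb, h2⟩ := ((hfreq _ hab).and_eventually
      ((Metric.isOpen_ball.eventually_mem hab).and h1)).exists
    rw [← h2]
    exact hfan.iff_of_eventually_iff_of_convex Metric.isOpen_ball (convex_ball 0 δ) (P := P ∘ p)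
      (fun b hb hfb => hpP b hb (hP _ (hpS b hb hfb).2)) hb hfb hb₀ hfb₀

include hcomponents hD in
/-- A predicate which is locally constant on the smooth part of the divisor is constant on the part
lying in a component. -/
theorem IsPrimeDivisor.iff_of_eventually_iff (hZ : Z ∈ components) {P : X → Prop}
    (hP : ∀ x ∈ smoothPoints D, ∀ᶠ x' in 𝓝 x, x' ∈ D → (P x' ↔ P x)) {x x' : X}
    (hx : x ∈ Z) (hxD : x ∈ smoothPoints D) (hx' : x' ∈ Z) (hxD' : x' ∈ smoothPoints D) :
    P x ↔ P x' := by
  have hloc : ∀ y ∈ smoothPoints Z, y ∈ closure (Z ∩ smoothPoints D) ∧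
      ∃ q : Prop, ∀ᶠ a in 𝓝[Z ∩ smoothPoints D] y, (P a ↔ q) := by
    rintro y ⟨hy, ⟨c⟩⟩
    exact c.exists_forall_eventually_iff hcomponents hD hZ hy hP
  obtain ⟨q, hq⟩ := (hcomponents Z hZ).isConnected.isPreconnected.exists_forall_eventually_iff
    (fun y hy => (hloc y hy).1) fun y hy => (hloc y hy).2
  -- The point `x` is approximated first by a smooth point `w` of `Z`, where `q` is available, and
  -- then by a point of `Z` smooth on `D`.
  have key {x : X} (hx : x ∈ Z) (hxD : x ∈ smoothPoints D) : P x ↔ q := by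
    obtain ⟨w, hw, h1⟩ := ((mem_closure_iff_frequently.1 ((hcomponents Z hZ).dense hx)).and_eventually
      (eventually_eventually_nhds.2 (hP x hxD))).exists
    have h2 := eventually_nhdsWithin_iff.1 (hq w hw)
    obtain ⟨a, ha, h3, h4⟩ := ((mem_closure_iff_frequently.1 (hloc w hw).1).and_eventually
      (h1.and h2)).exists
    rw [← h3 ha.2.1, h4 ha]
  rw [key hx hxD, key hx' hxD']

end Components

/-! ### Ramification of the level covers -/

section Ramification

variable {X : Type u} [TopologicalSpace X] [HolStructure X] {D : Set X} {r : ℕ}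

/-- The normalization of the level cover has ramification order divisible by `p` at all points over
`x`. -/
def LocalSystem.RamifiesOver (L : LocalSystem.{u, v} {x : X // x ∉ D} r) (p : ℕ) (x : X) : Prop :=
  ∀ y : Normalization (L.levelMap p), y.pt = x → ∃ e : ℕ, 0 < e ∧ p ∣ e ∧
    HasRamificationOrderAt Normalization.pt (Normalization.isHolMap_pt (L.isHolMap_levelMap p)) D y e

variable {L : LocalSystem.{u, v} {x : X // x ∉ D} r} {x : X} (c : AdaptedChart D x)

/-- The ramification order is the order of the reduction of the monodromy. -/
theorem AdaptedChart.exists_ramifiesOver_iff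
    {T : L.stalk c.basePoint ≃ₗ[ℤ] L.stalk c.basePoint} (hT : L.IsMonodromy c.meridian T) :
    ∃ A : (Fin r → ℤ) ≃ₗ[ℤ] (Fin r → ℤ),
      (∃ e : (Fin r → ℤ) ≃ₗ[ℤ] L.stalk c.basePoint, ∀ v, T (e v) = e (A v)) ∧
      ∀ p : ℕ, p ≠ 0 → ∀ᶠ x' in 𝓝 x, x' ∈ D →
        (L.RamifiesOver p x' ↔ p ∣ orderOf (A.baseChange ℤ (ZMod p))) := by
  obtain ⟨A, hA, h⟩ := c.exists_kummerModel L hT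
  refine ⟨A, hA, fun p hp => ?_⟩
  obtain ⟨K, hxs, hxb, he⟩ := h p hp
  filter_upwards [K.chart.open_source.mem_nhds hxs,
    (K.chart.continuousAt hxs).eventually_mem (K.isOpen_base.mem_nhds hxb)] with x' hs hb hD
  rw [← he]
  have hf := L.isHolMap_levelMap p
  constructor
  · intro h1
    -- A point over `x'` is needed so that `RamifiesOver` is not vacuous; uniqueness of the order
    -- there then yields the divisibility.
    obtain ⟨y, rfl⟩ := K.exists_normalization_pt hf hs hb hD
    obtain ⟨e, -, hpe, h2⟩ := h1 y rfl
    rwa [(K.hasRamificationOrderAt_iff hf y hs hb hD e).1 h2] at hpe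
  · rintro hpe y rfl
    exact ⟨K.e, K.e_pos, hpe, (K.hasRamificationOrderAt_iff hf y hs hb hD K.e).2 rfl⟩

end Ramification
end

/-! ### Finiteness of the set of exceptional primes. -/

theorem mainTheorem6 {X : Type u} [TopologicalSpace X] [CompactSpace X] [HolStructure X]
    [IsNormalComplexSpace X]
    -- the divisor `D`, with its finitely many irreducible components
    (components : Finset (Set X)) (hcomponents : ∀ Z ∈ components, IsPrimeDivisor Z)
    (D : Set X) (hD : D = ⋃ Z ∈ components, Z)
    -- the local system on the complement of `D`
    (r : ℕ) (L : LocalSystem.{u, v} {x : X // x ∉ D} r)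
    -- the monodromies around the components of `D`, at general points of these
    (hL : ∀ Z ∈ components, ∀ x ∈ Z, ∀ c : AdaptedChart D x,
      ∃ T : L.stalk c.basePoint ≃ₗ[ℤ] L.stalk c.basePoint, L.IsMonodromy c.meridian T ∧
        ¬ IsOfFinOrder T ∧
        ∀ μ : ℂ, Module.End.HasEigenvalue (LinearMap.baseChange ℂ T.toLinearMap) μ → ‖μ‖ = 1) :
    {p : ℕ | p.Prime ∧ ¬ ∀ Z ∈ components,
      RamifiesWithOrderDivisibleBy (Normalization.pt : Normalization (L.levelMap p) → X)
        (Normalization.isHolMap_pt (L.isHolMap_levelMap p)) D Z p}.Finite := by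
  have hsub {Z : Set X} (hZ : Z ∈ components) : Z ⊆ D := by
    rw [hD]
    exact Set.subset_biUnion_of_mem (u := fun Z : Set X => Z) hZ
  -- A single matrix `A` governs all points of `D` near `x`.
  have hlocal (p : ℕ) (hp : p ≠ 0) : ∀ x ∈ smoothPoints D,
      ∀ᶠ x' in 𝓝 x, x' ∈ D → (L.RamifiesOver p x' ↔ L.RamifiesOver p x) := by
    rintro x ⟨hx, ⟨c⟩⟩
    obtain ⟨Z, hZ, hxZ⟩ := Set.mem_iUnion₂.1 (hD ▸ hx)
    obtain ⟨T, hT, -⟩ := hL Z hZ x hxZ c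
    obtain ⟨A, -, h⟩ := c.exists_ramifiesOver_iff hT
    have h1 := h p hp
    filter_upwards [h1] with x' h2 hx'
    rw [h2 hx', h1.self_of_nhds hx]
  have hfin (Z : Set X) (hZ : Z ∈ components) : {p : ℕ | p.Prime ∧
      ¬ RamifiesWithOrderDivisibleBy (Normalization.pt : Normalization (L.levelMap p) → X)
        (Normalization.isHolMap_pt (L.isHolMap_levelMap p)) D Z p}.Finite := by
    -- One smooth point of `D` on the component determines the finite exceptional set for the whole
    -- component; in the other case the ramification condition is vacuous.
    by_cases hne : ∃ x ∈ Z, x ∈ smoothPoints D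
    · obtain ⟨x, hxZ, hx⟩ := hne
      obtain ⟨c⟩ := hx.2
      obtain ⟨T, hT, hord, heig⟩ := hL Z hZ x hxZ c
      obtain ⟨A, ⟨e, he⟩, h⟩ := c.exists_ramifiesOver_iff hT
      refine (A.finite_setOf_not_dvd_orderOf (fun h0 => hord (e.isOfFinOrder_of_conj he h0))
        fun μ hμ => heig μ (hμ.of_baseChange_conj e he)).subset ?_
      rintro p ⟨hp, hram⟩
      refine ⟨hp, fun hdvd => hram fun y hyZ hyD => ?_⟩
      have h1 := ((h p hp.ne_zero).self_of_nhds hx.1).2 hdvd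
      exact (IsPrimeDivisor.iff_of_eventually_iff hcomponents hD hZ (hlocal p hp.ne_zero) hxZ hx
        hyZ hyD).1 h1 y rfl
    · refine Set.finite_empty.subset ?_
      rintro p ⟨-, hram⟩
      exact hram fun y hyZ hyD => (hne ⟨_, hyZ, hyD⟩).elim
  refine (components.finite_toSet.biUnion hfin).subset ?_
  rintro p ⟨hp, hram⟩
  push Not at hram
  obtain ⟨Z, hZ, h⟩ := hram
  exact Set.mem_biUnion hZ ⟨hp, h⟩
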